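/- Let $1\le k<d$ be integers, $G=\mathrm{SL}(d,\mathbb R)$, $\Gamma=\mathrm{SL}(d,\mathbb Z)$ and $X=G/\Gamma$, where $g\Gamma\in X$ is identified with the unimodular lattice $\Lambda=g\mathbb Z^d$. For a lattice $\Lambda\subset\mathbb R^d$ let $P^k(\Lambda)$ be the set of primitive $k$-tuples of $\Lambda$, i.e. ordered $k$-tuples $(v_1,\dots,v_k)\in\Lambda^k$ that can be extended to a $\mathbb Z$-basis of $\Lambda$; for $f:(\mathbb R^d)^k\to\mathbb R$ put $\hat f^k(\Lambda)=\sum_{(v_1,\dots,v_k)\in P^k(\Lambda)}f(v_1,\dots,v_k)$. Put $\zeta(s)=\sum_{n\ge1}n^{-s}$ and $$c_{d,k}=\frac{1}{\zeta(d)\,\zeta(d-1)\cdots\zeta(d-k+1)} .$$ (1) There is exactly one $G$-invariant Borel probability measure $\mu$ on $X$, and for every $f\in L^1(\mathbb R^{dk})$ the series $\hat f^k(\Lambda)$ converges absolutely for $\mu$-almost every $\Lambda$, $\hat f^k\in L^1(X,\mu)$, and $$\int_X \hat f^k\,d\mu=c_{d,k}\int_{\mathbb R^{dk}}f\,dv_1\cdots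 dv_k .$$ (2) Let $G_k=\{g\in G: ge_i=e_i,\ 1\le i\le k\}$ and $\Gamma_k=G_k\cap\Gamma$. For every Haar measure $\nu$ on $G$ there is exactly one Haar measure $\nu_k$ on $G_k$ satisfying the quotient integral formula $$\int_G\varphi\,d\nu=\int_{\mathbb R^{dk}}\Big(\int_{G_k}\varphi(g_vh)\,d\nu_k(h)\Big)\,dv\qquad(\varphi\ge0\text{ measurable}),$$ where, for linearly independent $v=(v_1,\dots,v_k)$, $g_v\in G$ is any element with $g_ve_i=v_i$ for $1\le i\le k$ (the linearly dependent $v$ form a null set). For it, $$\mathrm{vol}_{\nu_k}(G_k/\Gamma_k)=c_{d,k}\,\mathrm{vol}_{\nu}(G/\Gamma);$$ in particular $\mathrm{vol}_{\nu_k}(G_k/\Gamma_k)=c_{d,k}$ if $\nu$ is normalized by $\mathrm{vol}_\nu(G/\Gamma)=1$. (3) Let $dk$ be the Haar measure on $K=\mathrm{SO}(d)$ of total mass $\prod_{i=1}^{d-1}\mathrm{Vol}(S^i)$, where $\mathrm{Vol}(S^i)$ is the surface measure of the unit sphere in $\mathbb R^{i+1}$. Let $A$ be the group of diagonal matrices $a=\mathrm{diag}(a_1,\dots,a_d)$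 with $a_i>0$ and $a_1\cdots a_d=1$, with $da=\prod_{i=1}^{d-1}\frac{da_i}{a_i}$; let $N$ be the group of upper triangular unipotent matrices, with $dn=\prod_{i<j}dn_{ij}$. Let $dg$ be the image of the measure $\big(\prod_{i<j}\tfrac{a_i}{a_j}\big)\,dk\,da\,dn$ under $K\times A\times N\to G$, $(k,a,n)\mapsto kan$. Then $dg$ is a Haar measure on $G$, and for it $$\mathrm{vol}\big(\mathrm{SL}(d,\mathbb R)/\mathrm{SL}(d,\mathbb Z)\big)=\zeta(2)\zeta(3)\cdots\zeta(d).$$ Here $\mathrm{vol}(H/\Delta)$, for a discrete subgroup $\Delta$ of $H$, denotes the measure of a fundamental domain for the right translation action of $\Delta$ on $H$. -/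

import Mathlib

open MeasureTheory Matrix
open scoped ENNReal

noncomputable section

/-! ### The group, the lattice subgroup and the space of unimodular lattices -/

/-- The group `SL(d, ℝ)`, with Mathlib's topology (induced from matrices). -/
abbrev SLR (d : ℕ) : Type := Matrix.SpecialLinearGroup (Fin d) ℝ

/-- `SL(d, ℝ)` carries its Borel sigma-algebra. -/
instance SLR.instMeasurableSpace (d : ℕ) : MeasurableSpace (SLR d) := borel _

instance SLR.instBorelSpace (d : ℕ) : BorelSpace (SLR d) := ⟨rfl⟩

/-- `SL(d, ℤ)` as a subgroup of `SL(d, ℝ)`. -/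
def SLZ (d : ℕ) : Subgroup (SLR d) :=
  (Matrix.SpecialLinearGroup.map (n := Fin d) (Int.castRingHom ℝ)).range

/-- The space `X = SL(d, ℝ) / SL(d, ℤ)` (left cosets `g SL(d, ℤ)`). -/
abbrev LatticeSpace (d : ℕ) : Type := SLR d ⧸ SLZ d

/-- The lattice `g ℤ^d`: the integer span of the columns of `g`. -/
def latticeOf {d : ℕ} (g : SLR d) : Submodule ℤ (Fin d → ℝ) :=
  Submodule.span ℤ (Set.range fun j : Fin d => fun i : Fin d => (g : Matrix (Fin d) (Fin d) ℝ) i j)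

theorem latticeOf_mul_le {d : ℕ} (g : SLR d) {γ : SLR d} (hγ : γ ∈ SLZ d) :
    latticeOf (g * γ) ≤ latticeOf g := by
  obtain ⟨m, rfl⟩ := hγ
  refine Submodule.span_le.2 ?_
  rintro _ ⟨j, rfl⟩
  have h : (fun i : Fin d => ((g * SpecialLinearGroup.map (Int.castRingHom ℝ) m : SLR d) :
      Matrix (Fin d) (Fin d) ℝ) i j) =
      ∑ l : Fin d, (m : Matrix (Fin d) (Fin d) ℤ) l j •
        fun i : Fin d => (g : Matrix (Fin d) (Fin d) ℝ) i l := by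
    funext i
    simp [Matrix.mul_apply, mul_comm]
  change (fun i : Fin d => ((g * SpecialLinearGroup.map (Int.castRingHom ℝ) m : SLR d) :
      Matrix (Fin d) (Fin d) ℝ) i j) ∈ latticeOf g
  rw [h]
  exact Submodule.sum_mem _ fun l _ =>
    Submodule.smul_mem _ _ (Submodule.subset_span ⟨l, rfl⟩)

theorem latticeOf_mul {d : ℕ} (g : SLR d) {γ : SLR d} (hγ : γ ∈ SLZ d) :
    latticeOf (g * γ) = latticeOf g := by
  refine le_antisymm (latticeOf_mul_le g hγ) ?_
  simpa using latticeOf_mul_le (g * γ) (inv_mem hγ)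

/-- The unimodular lattice `g ℤ^d` attached to the point `g SL(d, ℤ)` of `X`. -/
def LatticeSpace.lattice {d : ℕ} (x : LatticeSpace d) : Submodule ℤ (Fin d → ℝ) :=
  Quotient.liftOn' x latticeOf (by
    intro g h hgh
    have hmem : g⁻¹ * h ∈ SLZ d := QuotientGroup.leftRel_apply.1 hgh
    simpa using (latticeOf_mul g hmem).symm)

/-! ### Primitive tuples and the Siegel transform -/

/-- A `k`-tuple of vectors is primitive in the (full rank) lattice `Λ ⊂ ℝ^d` if it is extendable
to a basis of `Λ`: its entries are distinct members of some `ℤ`-basis of `Λ`. -/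
def IsPrimitiveTuple {d k : ℕ} (Λ : Submodule ℤ (Fin d → ℝ)) (v : Fin k → Fin d → ℝ) : Prop :=
  ∃ (b : Module.Basis (Fin d) ℤ Λ) (e : Fin k ↪ Fin d), ∀ i, ((b (e i) : Λ) : Fin d → ℝ) = v i

/-- The set `P^k(Λ)` of primitive `k`-tuples of `Λ`. -/
def primitiveTuples {d : ℕ} (k : ℕ) (Λ : Submodule ℤ (Fin d → ℝ)) : Set (Fin k → Fin d → ℝ) :=
  {v | IsPrimitiveTuple Λ v}

/-- The transform `Λ ↦ ∑ f(v₁, …, v_k)`, the sum being over the primitive `k`-tuples of `Λ`. -/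
def siegelTransform {d k : ℕ} (f : (Fin k → Fin d → ℝ) → ℝ) (x : LatticeSpace d) : ℝ :=
  ∑' v : primitiveTuples k x.lattice, f v

/-! ### Zeta values -/

/-- The real number `ζ(s) = ∑_{n ≥ 1} n^{-s}` (used for `s ≥ 2`). -/
def zetaVal (s : ℕ) : ℝ := ∑' n : ℕ, 1 / ((n : ℝ) + 1) ^ s

/-- For `s ≥ 2` this is the value of the Riemann zeta function. -/
theorem zetaVal_eq_riemannZeta {s : ℕ} (hs : 2 ≤ s) : (zetaVal s : ℂ) = riemannZeta s := by
  have h1 : 1 < (s : ℂ).re := by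
    rw [Complex.natCast_re]
    exact_mod_cast hs
  rw [zeta_eq_tsum_one_div_nat_add_one_cpow h1, zetaVal, Complex.ofReal_tsum]
  congr 1
  funext n
  push_cast
  rw [Complex.cpow_natCast]

/-- `c_{d,k} = 1 / (ζ(d) ζ(d-1) ⋯ ζ(d-k+1))`. -/
def siegelConst (d k : ℕ) : ℝ := (∏ j ∈ Finset.Icc (d - k + 1) d, zetaVal j)⁻¹

/-! ### The stabilizer of `(e₁, …, e_k)` and its induced Haar measure -/

/-- The tuple `(e₁, …, e_k)` of the first `k` standard basis vectors of `ℝ^d` (for `k ≤ d`). -/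
def stdTuple (d k : ℕ) : Fin k → Fin d → ℝ := fun i r => if (r : ℕ) = (i : ℕ) then 1 else 0

/-- `G_k`, the subgroup of `SL(d, ℝ)` fixing each of `e₁, …, e_k`. -/
def stabG (d k : ℕ) : Subgroup (SLR d) := MulAction.stabilizer (SLR d) (stdTuple d k)

/-- `Γ_k = G_k ∩ SL(d, ℤ)`, as a subgroup of `G_k`. -/
def stabΓ (d k : ℕ) : Subgroup (stabG d k) := (SLZ d).subgroupOf (stabG d k)

/-- The integral of `φ` over the fibre of `g ↦ (g e₁, …, g e_k)` above `v`: it is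
`∫ φ (g h) dνk(h)` for any `g` with `(g e₁, …, g e_k) = v`. For a left invariant `νk` this does not
depend on `g`, so that the supremum only selects the common value (and gives `0` if there is no such
`g`, that is, if `v` is linearly dependent, when `k < d`). -/
def fibreIntegral {d k : ℕ} (νk : Measure (stabG d k)) (φ : SLR d → ℝ≥0∞)
    (v : Fin k → Fin d → ℝ) : ℝ≥0∞ :=
  ⨆ (g : SLR d) (_ : g • stdTuple d k = v), ∫⁻ h : stabG d k, φ (g * h) ∂νk

/-- `νk` is the Haar measure on `G_k` induced by the Haar measure `ν` on `G = SL(d, ℝ)` and by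
Lebesgue measure on `G / G_k ≅ {linearly independent k-tuples} ⊂ (ℝ^d)^k`, through the quotient
integral formula `∫_G φ dν = ∫_{G/G_k} ∫_{G_k} φ(g h) dνk(h) dv`, `v = (g e₁, …, g e_k)`. -/
def IsInducedHaar {d k : ℕ} (ν : Measure (SLR d)) (νk : Measure (stabG d k)) : Prop :=
  νk.IsHaarMeasure ∧
    ∀ φ : SLR d → ℝ≥0∞, Measurable φ →
      ∫⁻ g, φ g ∂ν = ∫⁻ v : Fin k → Fin d → ℝ, fibreIntegral νk φ v

/-! ### The Haar measure of `SL(d, ℝ)` in Iwasawa coordinates -/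

/-- `K = SO(d)` as a subgroup of `SL(d, ℝ)`. -/
def SOd (d : ℕ) : Subgroup (SLR d) where
  carrier := {g | (g : Matrix (Fin d) (Fin d) ℝ) ∈ orthogonalGroup (Fin d) ℝ}
  mul_mem' {a b} ha hb := by
    change ((a * b : SLR d) : Matrix (Fin d) (Fin d) ℝ) ∈ orthogonalGroup (Fin d) ℝ
    rw [Matrix.SpecialLinearGroup.coe_mul]
    exact Submonoid.mul_mem _ ha hb
  one_mem' := by
    change ((1 : SLR d) : Matrix (Fin d) (Fin d) ℝ) ∈ orthogonalGroup (Fin d) ℝ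
    rw [Matrix.SpecialLinearGroup.coe_one]
    exact Submonoid.one_mem _
  inv_mem' {g} hg := by
    have h1 : (g : Matrix (Fin d) (Fin d) ℝ) * star (g : Matrix (Fin d) (Fin d) ℝ) = 1 :=
      (mem_orthogonalGroup_iff (Fin d) ℝ).1 hg
    have h2 : ((g⁻¹ * g : SLR d) : Matrix (Fin d) (Fin d) ℝ) = 1 := by
      rw [inv_mul_cancel, Matrix.SpecialLinearGroup.coe_one]
    rw [Matrix.SpecialLinearGroup.coe_mul] at h2
    change ((g⁻¹ : SLR d) : Matrix (Fin d) (Fin d) ℝ) ∈ orthogonalGroup (Fin d) ℝ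
    rw [left_inv_eq_right_inv h2 h1]
    exact Unitary.star_mem hg

/-- Logarithmic coordinates on the positive diagonal group: `t = (log a₁, …, log a_{d-1})` gives
`a_i = exp t_i` for `i < d`, and `a_d = (a₁ ⋯ a_{d-1})⁻¹`. -/
def diagEntry {d : ℕ} (t : Fin (d - 1) → ℝ) (i : Fin d) : ℝ :=
  if h : (i : ℕ) < d - 1 then Real.exp (t ⟨i, h⟩) else Real.exp (-∑ j, t j)

theorem prod_diagEntry {d : ℕ} (t : Fin (d - 1) → ℝ) : ∏ i, diagEntry t i = 1 := by
  cases d with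
  | zero => simp
  | succ m =>
    rw [Fin.prod_univ_castSucc]
    have h1 : ∀ i : Fin m, diagEntry (d := m + 1) t i.castSucc = Real.exp (t i) := by
      intro i
      have hi : (i.castSucc : ℕ) < m + 1 - 1 := by simp
      rw [diagEntry, dif_pos hi]
      rfl
    have h2 : diagEntry (d := m + 1) t (Fin.last m) = Real.exp (-∑ j, t j) := by
      rw [diagEntry, dif_neg (by simp)]
    rw [h2, Finset.prod_congr rfl fun i _ => h1 i, ← Real.exp_sum, ← Real.exp_add]
    exact Real.exp_eq_one_iff _ |>.2 (add_neg_cancel _)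

/-- The element `diag(a₁, …, a_d)` of `A`. -/
def diagElt {d : ℕ} (t : Fin (d - 1) → ℝ) : SLR d :=
  ⟨Matrix.diagonal (diagEntry t), by rw [Matrix.det_diagonal, prod_diagEntry]⟩

/-- The positions `(i, j)` with `i < j`. -/
abbrev UpperIndex (d : ℕ) : Type := {p : Fin d × Fin d // p.1 < p.2}

/-- The upper triangular unipotent matrix with entries `u` above the diagonal. -/
def unipMatrix {d : ℕ} (u : UpperIndex d → ℝ) : Matrix (Fin d) (Fin d) ℝ :=
  fun i j => if h : i < j then u ⟨(i, j), h⟩ else if i = j then 1 else 0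

/-- The element of `N` with entries `u` above the diagonal. -/
def unipElt {d : ℕ} (u : UpperIndex d → ℝ) : SLR d :=
  ⟨unipMatrix u, by
    have h : (unipMatrix u).BlockTriangular id := by
      intro i j hij
      have hji : j < i := hij
      simp [unipMatrix, hji.not_gt, hji.ne']
    rw [Matrix.det_of_isUpperTriangular h]
    simp [unipMatrix]⟩

/-- `ρ(a) = ∏_{i<j} a_i / a_j`. -/
def rhoWeight {d : ℕ} (t : Fin (d - 1) → ℝ) : ℝ :=
  ∏ p : UpperIndex d, diagEntry t p.1.1 / diagEntry t p.1.2

/-- The measure `ρ(a) dk da dn` on `SL(d, ℝ)`, transported by `(k, a, n) ↦ k a n`, where `dk = κ`,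
`da = ∏_{i<d} da_i / a_i` (Lebesgue measure in the logarithmic coordinates `t`), and
`dn = ∏_{i<j} dn_{ij}`. -/
def iwasawaMeasure {d : ℕ} (κ : Measure (SOd d)) : Measure (SLR d) :=
  Measure.map
    (fun p : SOd d × (Fin (d - 1) → ℝ) × (UpperIndex d → ℝ) =>
      (p.1 : SLR d) * diagElt p.2.1 * unipElt p.2.2)
    (κ.prod
      (((volume : Measure (Fin (d - 1) → ℝ)).withDensity
        fun t => ENNReal.ofReal (rhoWeight t)).prod (volume : Measure (UpperIndex d → ℝ))))

/-- `Vol(S^i)`, the surface measure of the unit sphere of `ℝ^{i+1}`. -/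
def sphereVol (i : ℕ) : ℝ≥0∞ :=
  (volume : Measure (EuclideanSpace ℝ (Fin (i + 1)))).toSphere Set.univ

/-! ### Volumes of quotients -/

/-- The volume of `H / Δ` for the measure induced by `ν` on the quotient: the `ν`-measure of a
fundamental domain for the action of `Δ` on `H` by right translations. -/
def quotientVol {H : Type*} [Group H] [MeasurableSpace H] (Δ : Subgroup H) (ν : Measure H) : ℝ≥0∞ :=
  covolume Δ.op H ν

end

/-!
The proof compares the constants in the mean value formulas for primitive tuples of different
lengths, and computes the last of them in Iwasawa coordinates. Throughout, `G = SL(d, ℝ)`,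
`Γ = SL(d, ℤ)`, and `G_k` is the stabilizer of the tuple `(e₁, …, e_k)`.

**Unfolding.** For `k < d` the primitive `k`-tuples of `g ℤ^d` are the `g w` with `w` in the orbit
`Γ (e₁, …, e_k)` (`mem_primitiveTuples_latticeOf_iff`). Weil's formula
(`exists_lintegral_orbitFibre_eq`) gives the induced Haar measure `νk` on `G_k`, and unfolding
(`setLIntegral_tsum_orbit_eq`) gives, for a fundamental domain `F` of `G / Γ`,
`∫_F ∑_w f (g w) dν = W_k ∫ f` with `W_k = vol(G_k / Γ_k)`; for `k = 0` this is `vol(G / Γ)`.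

**Consecutive constants.** `W_k = ζ(d - k) W_{k+1}` for `k + 1 < d`
(`IsTupleMean.eq_zetaVal_mul`). An integer vector outside the span of a primitive `k`-tuple `w` is
in exactly one way `n z + ∑ r_i w_i` with `n ≥ 1`, `0 ≤ r_i < n` and `(w, z)` primitive, by division
with remainder (`existsUnique_division`). Summing the `(k + 1)`-formula over `n` and `r` therefore
shows that `∑_w f (g w) ∑_z q (g z)`, with `z` running over the vectors outside the span of `w`, has
integral `ζ(d - k) W_{k+1} ∫ f ∫ q`. If `q` is the normalized indicator function of a ball whose
radius tends to infinity, the inner sum tends to the constant `∫ q`, and dominated convergence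
gives `W_k`. The dominating function comes from comparing the number of lattice points in a large
ball with that in the unit ball (`tsum_offSpan_indicator_le`).

**The last constant.** `W_{d-1}` is computed for the measure `ρ(a) dk da dn`. The latter is a Haar
measure, because `(k, s) ↦ k s⁻¹` is a bijection from `K × AN` to the unimodular group `G`, and
`ρ(a) da dn` is a right Haar measure on `AN` (`exists_smul_iwasawaMeasure_eq`). The group `Γ_{d-1}`
is a copy of `ℤ^{d-1}` in the last column of `N`, so the elements `k a n` for which the last column
of `n` lies in the unit cube form a fundamental domain. Integrating a Gaussian over it, once in
Iwasawa coordinates and once by the quotient integral formula, yields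
`W_{d-1} ∏ Vol(S^i) = κ(K)` (`quotientVol_stabΓ_smul_iwasawaMeasure`). In particular `W_{d-1}` is
finite for every Haar measure on `G`, hence so is `vol(G / Γ) = ζ(2) ⋯ ζ(d) W_{d-1}`.

**The space of lattices.** Weil's formula for the action of `G` on `G / Γ` shows that an invariant
probability measure is a multiple of the image of `ν|_F` (`exists_eq_smul_map_restrict`); this gives
uniqueness and carries the mean value formula over to `G / Γ`.
-/


open scoped Pointwise

noncomputable section

/-! ### Invariant integration on homogeneous spaces -/

section Homogeneous

variable {G Y : Type*} [Group G] [MulAction G Y]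

/-- The integral of `φ` over the fibre of the orbit map `g ↦ g • y₀` above `y`, with respect to a
left invariant measure `ρ` on the stabilizer `H` of `y₀`. The supremum selects the common value of
the integrals `∫ φ (g h) dρ(h)`, and is `0` off the orbit. -/
def orbitFibre {H : Subgroup G} [MeasurableSpace H] (y₀ : Y) (ρ : Measure H) (φ : G → ℝ≥0∞)
    (y : Y) : ℝ≥0∞ :=
  ⨆ (g : G) (_ : g • y₀ = y), ∫⁻ h : H, φ (g * h) ∂ρ

theorem orbitFibre_of_notMem_orbit {H : Subgroup G} [MeasurableSpace H] {y₀ : Y} (ρ : Measure H)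
    (φ : G → ℝ≥0∞) {y : Y} (hy : y ∉ MulAction.orbit G y₀) : orbitFibre y₀ ρ φ y = 0 := by
  unfold orbitFibre
  refine le_antisymm (iSup₂_le fun g hg => (hy ⟨g, hg⟩).elim) zero_le

variable [TopologicalSpace G] [IsTopologicalGroup G] [MeasurableSpace G] [BorelSpace G]

theorem orbitFibre_smul {H : Subgroup G} {y₀ : Y} (hH : ∀ g, g ∈ H ↔ g • y₀ = y₀) (ρ : Measure H)
    [ρ.IsMulLeftInvariant] (φ : G → ℝ≥0∞) (g : G) :
    orbitFibre y₀ ρ φ (g • y₀) = ∫⁻ h : H, φ (g * h) ∂ρ := by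
  unfold orbitFibre
  refine le_antisymm (iSup₂_le fun g' hg' => ?_) (le_iSup₂_of_le g rfl le_rfl)
  have hmem : g⁻¹ * g' ∈ H := by rw [hH, mul_smul, hg', inv_smul_smul]
  rw [← lintegral_mul_left_eq_self (μ := ρ) (fun h : H => φ (g * h)) ⟨g⁻¹ * g', hmem⟩]
  refine le_of_eq (lintegral_congr fun h => ?_)
  simp [mul_assoc]

theorem orbitFibre_translate {H : Subgroup G} {y₀ : Y} (hH : ∀ g, g ∈ H ↔ g • y₀ = y₀)
    (ρ : Measure H) [ρ.IsMulLeftInvariant] (φ : G → ℝ≥0∞) (x : G) (y : Y) :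
    orbitFibre y₀ ρ (fun g => φ (x * g)) y = orbitFibre y₀ ρ φ (x • y) := by
  by_cases hy : y ∈ MulAction.orbit G y₀
  · obtain ⟨g, rfl⟩ := hy
    simp only
    rw [orbitFibre_smul hH, smul_smul, orbitFibre_smul hH]
    simp only [mul_assoc]
  · rw [orbitFibre_of_notMem_orbit _ _ hy, orbitFibre_of_notMem_orbit]
    rintro ⟨g, hg⟩
    exact hy ⟨x⁻¹ * g, by simp only [mul_smul]; simp only at hg; rw [hg, inv_smul_smul]⟩

variable [LocallyCompactSpace G] [SecondCountableTopology G] [MeasurableSpace Y]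

/-- Weil's integration formula: a `G`-invariant measure on an orbit together with a Haar measure on
the stabilizer integrates to a Haar measure on `G`. -/
theorem exists_lintegral_orbitFibre_eq [MeasurableConstSMul G Y] {H : Subgroup G} {y₀ : Y}
    (hH : ∀ g, g ∈ H ↔ g • y₀ = y₀) (hHc : IsClosed (H : Set G)) (ν : Measure G) [ν.IsHaarMeasure]
    (ρ : Measure H) [ρ.IsHaarMeasure] (lam : Measure Y) [SMulInvariantMeasure G Y lam]
    (hmeas : ∀ φ : G → ℝ≥0∞, Measurable φ → Measurable (orbitFibre y₀ ρ φ))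
    (horb : ∀ᵐ y ∂lam, y ∈ MulAction.orbit G y₀)
    (hfin : ∀ C : Set G, IsCompact C → lam ((fun g : G => g • y₀) '' C) ≠ ∞)
    (h0 : lam ≠ 0) :
    ∃ c : ℝ≥0∞, c ≠ 0 ∧ c ≠ ∞ ∧ ∀ φ : G → ℝ≥0∞, Measurable φ →
      ∫⁻ y, orbitFibre y₀ ρ φ y ∂lam = c * ∫⁻ g, φ g ∂ν := by
  classical
  -- `m y` is the measure `ρ` carried to the fibre of the orbit map above `y`; the measures `m y`
  -- average to a left invariant measure `ν'` on `G`
  let m : Y → Measure G := fun y =>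
    if hy : ∃ g : G, g • y₀ = y then
      Measure.map (fun h : H => (Classical.choose hy : G) * h) ρ else 0
  have hmφ : ∀ φ : G → ℝ≥0∞, Measurable φ → ∀ y, ∫⁻ g, φ g ∂(m y) = orbitFibre y₀ ρ φ y := by
    intro φ hφ y
    by_cases hy : ∃ g : G, g • y₀ = y
    · simp only [m, dif_pos hy]
      have hmm : Measurable fun h : H => (Classical.choose hy : G) * h :=
        (measurable_const_mul _).comp measurable_subtype_coe
      rw [lintegral_map hφ hmm, ← orbitFibre_smul hH ρ φ, Classical.choose_spec hy]
    · simp only [m, dif_neg hy]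
      rw [lintegral_zero_measure, orbitFibre_of_notMem_orbit _ _ hy]
  have hm : Measurable m := by
    refine Measure.measurable_of_measurable_coe _ fun s hs => ?_
    convert hmeas (s.indicator 1) (measurable_one.indicator hs) using 2 with y
    rw [← hmφ _ (measurable_one.indicator hs), lintegral_indicator_one hs]
  let ν' : Measure G := Measure.bind lam m
  have hν' : ∀ φ : G → ℝ≥0∞, Measurable φ →
      ∫⁻ g, φ g ∂ν' = ∫⁻ y, orbitFibre y₀ ρ φ y ∂lam := by
    intro φ hφ
    rw [Measure.lintegral_bind hm.aemeasurable hφ.aemeasurable]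
    exact lintegral_congr (hmφ φ hφ)
  have hinv : ν'.IsMulLeftInvariant := by
    refine ⟨fun x => ?_⟩
    ext s hs
    have hs1 : Measurable (s.indicator (1 : G → ℝ≥0∞)) := measurable_one.indicator hs
    rw [← lintegral_indicator_one hs, ← lintegral_indicator_one hs,
      lintegral_map hs1 (measurable_const_mul x), hν' _ hs1,
      hν' (fun g => s.indicator 1 (x * g)) (hs1.comp (measurable_const_mul x)),
      ← (measurePreserving_smul x lam).lintegral_comp (hmeas _ hs1)]
    exact lintegral_congr fun y => orbitFibre_translate hH ρ _ x y
  -- a translate of `ρ` gives a compact set `C` at most the mass of `H ∩ C⁻¹ C`, and none if its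
  -- fibre is outside the image of `C`
  have hfinite : ∀ C : Set G, IsCompact C → MeasurableSet C → ν' C < ∞ := by
    intro C hC hCm
    have hCC : IsCompact (C⁻¹ * C) := hC.inv.mul hC
    have hρ : ρ ((fun h : H => (h : G)) ⁻¹' (C⁻¹ * C)) < ∞ :=
      (hHc.isClosedEmbedding_subtypeVal.isCompact_preimage hCC).measure_lt_top
    rw [← lintegral_indicator_one hCm, hν' _ (measurable_one.indicator hCm)]
    set S := toMeasurable lam ((fun g : G => g • y₀) '' C)
    have hle : ∀ y, orbitFibre y₀ ρ (C.indicator 1) y ≤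
        S.indicator (fun _ => ρ ((fun h : H => (h : G)) ⁻¹' (C⁻¹ * C))) y := by
      intro y
      refine iSup₂_le fun g hg => ?_
      by_cases hy : ∃ h : H, g * h ∈ C
      · obtain ⟨h₀, hh₀⟩ := hy
        have hyS : y ∈ S := by
          refine subset_toMeasurable _ _ ⟨g * h₀, hh₀, ?_⟩
          simp only [mul_smul]
          rw [(hH _).1 h₀.2, hg]
        rw [Set.indicator_of_mem hyS,
          ← lintegral_mul_left_eq_self (μ := ρ) (fun h : H => C.indicator 1 (g * h)) h₀]
        refine (lintegral_mono (g := ((fun h : H => (h : G)) ⁻¹' (C⁻¹ * C)).indicator 1) ?_).trans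
          (lintegral_indicator_one_le _)
        intro h
        by_cases hh : g * (h₀ * h : H) ∈ C
        · have : h ∈ (fun h : H => (h : G)) ⁻¹' (C⁻¹ * C) := by
            refine Set.mem_mul.2 ⟨(g * h₀)⁻¹, Set.inv_mem_inv.2 hh₀, g * (h₀ * h : H), hh, ?_⟩
            simp [mul_assoc]
          beta_reduce
          rw [Set.indicator_of_mem this, Set.indicator_of_mem hh]
          exact le_rfl
        · beta_reduce
          rw [Set.indicator_of_notMem hh]
          exact zero_le
      · push Not at hy
        simp [Set.indicator_of_notMem (hy _)]
    refine (lintegral_mono hle).trans_lt ?_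
    rw [lintegral_indicator_const (measurableSet_toMeasurable _ _), measure_toMeasurable]
    exact ENNReal.mul_lt_top hρ (hfin C hC).lt_top
  have : IsFiniteMeasureOnCompacts ν' := ⟨fun C hC => (measure_mono subset_closure).trans_lt
    (hfinite _ hC.closure isClosed_closure.measurableSet)⟩
  have key := Measure.isMulLeftInvariant_eq_smul ν' ν
  refine ⟨(ν'.haarScalarFactor ν : ℝ≥0∞), ?_, ENNReal.coe_ne_top, fun φ hφ => ?_⟩
  · intro hc
    have hz : ν' = 0 := by
      rw [key, ENNReal.coe_eq_zero.1 hc, zero_smul]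
    have h1 := hν' (fun _ => 1) measurable_const
    rw [hz, lintegral_zero_measure] at h1
    have h2 := (lintegral_eq_zero_iff (hmeas _ measurable_const)).1 h1.symm
    apply h0
    rw [← Measure.measure_univ_eq_zero]
    refine measure_mono_null (fun y _ => ?_) (ae_iff.1 (h2.and horb))
    rintro ⟨hy1, g, rfl⟩
    simp only [Pi.zero_apply] at hy1
    rw [orbitFibre_smul hH, lintegral_one, Measure.measure_univ_eq_zero] at hy1
    exact NeZero.ne ρ hy1
  · rw [← hν' φ hφ]
    conv_lhs => rw [key]
    rw [lintegral_smul_measure]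
    rfl

/-- In Weil's formula the Haar measure on the stabilizer inherits right invariance from `G`. -/
theorem isMulRightInvariant_of_lintegral_orbitFibre_eq [MeasurableConstSMul G Y] {H : Subgroup G}
    {y₀ : Y} (hH : ∀ g, g ∈ H ↔ g • y₀ = y₀) (hHc : IsClosed (H : Set G)) (ν : Measure G)
    [ν.IsHaarMeasure] [ν.IsMulRightInvariant] (ρ : Measure H) [ρ.IsHaarMeasure] (lam : Measure Y)
    (hW : ∀ φ : G → ℝ≥0∞, Measurable φ → ∫⁻ g, φ g ∂ν = ∫⁻ y, orbitFibre y₀ ρ φ y ∂lam) :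
    ρ.IsMulRightInvariant := by
  have : LocallyCompactSpace H := hHc.isClosedEmbedding_subtypeVal.locallyCompactSpace
  have : SecondCountableTopology H :=
    TopologicalSpace.Subtype.secondCountableTopology (H : Set G)
  refine ⟨fun h₀ => ?_⟩
  have key := Measure.isMulLeftInvariant_eq_smul (Measure.map (· * h₀) ρ) ρ
  set c := (Measure.map (· * h₀) ρ).haarScalarFactor ρ
  obtain ⟨C⟩ : Nonempty (TopologicalSpace.PositiveCompacts G) := inferInstance
  set s := closure (C : Set G)
  have hs : MeasurableSet s := isClosed_closure.measurableSet
  have hsm : Measurable (s.indicator (1 : G → ℝ≥0∞)) := measurable_one.indicator hs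
  have hs0 : ν s ≠ 0 := (Measure.measure_pos_of_nonempty_interior ν
    (C.interior_nonempty.mono (interior_mono subset_closure))).ne'
  have hs1 : ν s ≠ ∞ := C.isCompact.closure.measure_lt_top.ne
  have hfib : ∀ y, orbitFibre y₀ ρ (fun g => s.indicator 1 (g * h₀)) y =
      c * orbitFibre y₀ ρ (s.indicator 1) y := by
    intro y
    by_cases hy : y ∈ MulAction.orbit G y₀
    · obtain ⟨g, rfl⟩ := hy
      simp only
      rw [orbitFibre_smul hH, orbitFibre_smul hH]
      have hm : Measurable fun h : H => s.indicator (1 : G → ℝ≥0∞) (g * h) :=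
        hsm.comp ((measurable_const_mul _).comp measurable_subtype_coe)
      have h1 : ∫⁻ h : H, s.indicator (1 : G → ℝ≥0∞) (g * h) ∂(Measure.map (· * h₀) ρ) =
          c * ∫⁻ h : H, s.indicator (1 : G → ℝ≥0∞) (g * h) ∂ρ := by
        rw [key, lintegral_smul_measure]
        rfl
      rw [← h1, lintegral_map hm (measurable_mul_const h₀)]
      simp [mul_assoc]
    · rw [orbitFibre_of_notMem_orbit _ _ hy, orbitFibre_of_notMem_orbit _ _ hy, mul_zero]
  have h2 := hW (fun g => s.indicator 1 (g * h₀)) (hsm.comp (measurable_mul_const _))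
  simp_rw [hfib] at h2
  rw [lintegral_const_mul' _ _ ENNReal.coe_ne_top, ← hW _ hsm,
    lintegral_mul_right_eq_self (fun g => s.indicator (1 : G → ℝ≥0∞) g),
    lintegral_indicator_one hs] at h2
  have hc : (c : ℝ≥0∞) = 1 := by
    have : (1 : ℝ≥0∞) * ν s = c * ν s := by rw [one_mul]; exact h2
    exact ((ENNReal.mul_left_inj hs0 hs1).1 this).symm
  rw [key, ENNReal.coe_eq_one.1 hc, one_smul]

end Homogeneous

/-! ### Fundamental domains of discrete subgroups -/

section FundamentalDomain

variable {G : Type*} [Group G] [TopologicalSpace G] [IsTopologicalGroup G]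
  [SecondCountableTopology G] [MeasurableSpace G] [BorelSpace G]

/-- A discrete subgroup of a second countable group has a Borel set meeting each of its left cosets
in exactly one point. -/
theorem exists_measurableSet_existsUnique_mul_mem (Γ : Subgroup G) [DiscreteTopology Γ] :
    ∃ D : Set G, MeasurableSet D ∧ ∀ g : G, ∃! γ : Γ, g * γ ∈ D := by
  have : Countable Γ := TopologicalSpace.separableSpace_iff_countable.1 inferInstance
  -- a cover of `G` by countably many open sets `E n` on which the quotient map is injective
  obtain ⟨U, hU, hUΓ⟩ : ∃ U : Set G, IsOpen U ∧ ((↑) : Γ → G) ⁻¹' U = {1} :=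
    isOpen_induced_iff.1 (isOpen_discrete ({1} : Set Γ))
  have hU1 : (1 : G) ∈ U := by
    have : (1 : Γ) ∈ ((↑) : Γ → G) ⁻¹' U := by rw [hUΓ]; rfl
    exact this
  obtain ⟨V, hVo, hV1, hVU⟩ : ∃ V : Set G, IsOpen V ∧ (1 : G) ∈ V ∧
      ∀ x ∈ V, ∀ y ∈ V, x⁻¹ * y ∈ U := by
    have hc : ContinuousAt (fun p : G × G => p.1⁻¹ * p.2) (1, 1) :=
      (continuous_fst.inv.mul continuous_snd).continuousAt
    have := hc.preimage_mem_nhds (t := U) (by simpa using hU.mem_nhds hU1)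
    rw [nhds_prod_eq, Filter.mem_prod_same_iff] at this
    obtain ⟨t, ht, htU⟩ := this
    obtain ⟨V, hVt, hVo, hV1⟩ := mem_nhds_iff.1 ht
    exact ⟨V, hVo, hV1, fun x hx y hy => htU (Set.mk_mem_prod (hVt hx) (hVt hy))⟩
  obtain ⟨T, hTc, hT⟩ := TopologicalSpace.countable_cover_nhds (α := G)
    (f := fun x => (fun y => x⁻¹ * y) ⁻¹' V) fun x =>
      (hVo.preimage (continuous_const_mul _)).mem_nhds (by simpa using hV1)
  have hTne : T.Nonempty := by
    by_contra h
    rw [Set.not_nonempty_iff_eq_empty] at h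
    simp only [h, Set.mem_empty_iff_false, Set.iUnion_false, Set.iUnion_empty] at hT
    exact (Set.empty_ne_univ hT).elim
  obtain ⟨x, hx⟩ := hTc.exists_eq_range hTne
  set E : ℕ → Set G := fun n => (fun y => (x n)⁻¹ * y) ⁻¹' V
  have hEo : ∀ n, IsOpen (E n) := fun n => hVo.preimage (continuous_const_mul _)
  have hEcov : ∀ g, ∃ n, g ∈ E n := by
    intro g
    have : g ∈ ⋃ y ∈ T, (fun z => y⁻¹ * z) ⁻¹' V := by rw [hT]; trivial
    rw [hx] at this
    simpa [E] using this
  have hEinj : ∀ n (g : G) (γ γ' : Γ), g * γ ∈ E n → g * γ' ∈ E n → γ = γ' := by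
    intro n g γ γ' h h'
    have h1 := hVU _ h _ h'
    have h2 : γ⁻¹ * γ' ∈ ((↑) : Γ → G) ⁻¹' U := by
      simpa [mul_assoc] using h1
    rw [hUΓ, Set.mem_singleton_iff] at h2
    exact (inv_mul_eq_one.1 h2)
  have hex : ∀ g : G, ∃ n, ∃ γ : Γ, g * γ ∈ E n := fun g => by
    obtain ⟨n, hn⟩ := hEcov g
    exact ⟨n, 1, by simpa using hn⟩
  have hEm : ∀ n (γ : Γ), MeasurableSet {g : G | g * γ ∈ E n} := fun n γ =>
    ((hEo n).preimage (continuous_mul_const _)).measurableSet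
  -- of each coset keep the representative in the first `E n` that it meets
  refine ⟨⋃ n, E n \ ⋃ m < n, ⋃ γ : Γ, {g : G | g * γ ∈ E m}, ?_, fun g => ?_⟩
  · exact MeasurableSet.iUnion fun n => (hEo n).measurableSet.diff
      (MeasurableSet.iUnion fun m => MeasurableSet.iUnion fun _ => MeasurableSet.iUnion fun γ =>
        hEm m γ)
  · classical
    have hmem : ∀ γ : Γ, (g * γ ∈ ⋃ n, E n \ ⋃ m < n, ⋃ γ : Γ, {g : G | g * γ ∈ E m}) ↔
        g * γ ∈ E (Nat.find (hex g)) := by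
      intro γ
      simp only [Set.mem_iUnion, Set.mem_sdiff, Set.mem_ofPred_eq, not_exists]
      constructor
      · rintro ⟨n, hn, hlt⟩
        have : Nat.find (hex g) = n := by
          rw [Nat.find_eq_iff]
          refine ⟨⟨γ, hn⟩, fun m hm => ?_⟩
          rintro ⟨γ', hγ'⟩
          refine hlt m hm (γ⁻¹ * γ') ?_
          simpa [mul_assoc] using hγ'
        rwa [this]
      · intro h
        refine ⟨_, h, fun m hm γ' hγ' => Nat.find_min (hex g) hm ⟨γ * γ', ?_⟩⟩
        simpa [mul_assoc] using hγ'
    obtain ⟨γ, hγ⟩ := Nat.find_spec (hex g)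
    refine ⟨γ, (hmem γ).2 hγ, fun γ' hγ' => hEinj _ g _ _ ((hmem γ').1 hγ') hγ⟩

omit [TopologicalSpace G] [IsTopologicalGroup G] [SecondCountableTopology G] [BorelSpace G] in
theorem isFundamentalDomain_op_of_existsUnique {Γ : Subgroup G} {D : Set G} (hD : MeasurableSet D)
    (hΓ : ∀ g : G, ∃! γ : Γ, g * γ ∈ D) (ν : Measure G) : IsFundamentalDomain Γ.op D ν := by
  refine IsFundamentalDomain.mk' hD.nullMeasurableSet fun g => ?_
  obtain ⟨γ, hγ, huniq⟩ := hΓ g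
  refine ⟨Γ.equivOp γ, hγ, fun γ' hγ' => ?_⟩
  rw [← Γ.equivOp.apply_symm_apply γ']
  congr 1
  exact huniq _ hγ'

omit [SecondCountableTopology G] in
theorem quotientVol_eq_of_existsUnique {Γ : Subgroup G} [Countable Γ] {D : Set G}
    (hD : MeasurableSet D) (hΓ : ∀ g : G, ∃! γ : Γ, g * γ ∈ D) (ν : Measure G)
    [ν.IsMulRightInvariant] : quotientVol Γ ν = ν D :=
  have : Countable Γ.op := Γ.equivOp.symm.injective.countable
  (isFundamentalDomain_op_of_existsUnique hD hΓ ν).covolume_eq_volume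

omit [SecondCountableTopology G] in
/-- Integrals over `G` as integrals over a fundamental domain. -/
theorem lintegral_eq_setLIntegral_tsum {Γ : Subgroup G} [Countable Γ] {D : Set G}
    (hD : MeasurableSet D) (hΓ : ∀ g : G, ∃! γ : Γ, g * γ ∈ D) (ν : Measure G)
    [ν.IsMulRightInvariant] {φ : G → ℝ≥0∞} (hφ : Measurable φ) :
    ∫⁻ g, φ g ∂ν = ∫⁻ g in D, ∑' γ : Γ, φ (g * γ) ∂ν := by
  have : Countable Γ.op := Γ.equivOp.symm.injective.countable
  have hφ' : ∀ γ : Γ, AEMeasurable (fun g => φ (g * γ)) (ν.restrict D) := fun γ =>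
    (hφ.comp (measurable_mul_const _)).aemeasurable
  rw [lintegral_tsum hφ',
    (isFundamentalDomain_op_of_existsUnique hD hΓ ν).lintegral_eq_tsum'' φ,
    ← Γ.equivOp.tsum_eq]
  rfl

end FundamentalDomain

/-! ### Unfolding -/

section Unfolding

variable {G Y : Type*} [Group G] [MulAction G Y] [TopologicalSpace G] [IsTopologicalGroup G]
  [MeasurableSpace G] [BorelSpace G] [SecondCountableTopology G] [MeasurableSpace Y]

/-- If `D` meets every left coset of `Γ ∩ H` in exactly one point, then `g ↦ 1_D(g) f(g y₀)`
integrates to the integral of `f` over `Y` times the volume of `H / (H ∩ Γ)`, since each fibre of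
the orbit map meets `D` in a fundamental domain of `H / (H ∩ Γ)`. -/
theorem lintegral_orbit_mul_indicator_eq [MeasurableSMul G Y] {H Γ : Subgroup G}
    [DiscreteTopology Γ] {y₀ : Y} (hH : ∀ g, g ∈ H ↔ g • y₀ = y₀) {ν : Measure G}
    {ρ : Measure H} [ρ.IsMulLeftInvariant] [ρ.IsMulRightInvariant] {lam : Measure Y}
    (hW : ∀ φ : G → ℝ≥0∞, Measurable φ → ∫⁻ g, φ g ∂ν = ∫⁻ y, orbitFibre y₀ ρ φ y ∂lam)
    (horb : ∀ᵐ y ∂lam, y ∈ MulAction.orbit G y₀) {D : Set G} (hD : MeasurableSet D)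
    (hDΓ : ∀ g : G, ∃! γ : (Γ ⊓ H : Subgroup G), g * γ ∈ D) {f : Y → ℝ≥0∞} (hf : Measurable f) :
    ∫⁻ g, f (g • y₀) * D.indicator 1 g ∂ν =
      quotientVol (Γ.subgroupOf H) ρ * ∫⁻ y, f y ∂lam := by
  have hcΓ : Countable Γ := TopologicalSpace.separableSpace_iff_countable.1 inferInstance
  have hcH : Countable (Γ.subgroupOf H) :=
    Function.Injective.countable (f := fun γ : Γ.subgroupOf H => (⟨γ, γ.2⟩ : Γ))
      fun a b h => Subtype.ext (Subtype.ext (congrArg (fun x : Γ => (x : G)) h))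
  have hfibre : ∀ g : G, ρ ((fun h : H => g * h) ⁻¹' D) = quotientVol (Γ.subgroupOf H) ρ := by
    intro g
    refine (quotientVol_eq_of_existsUnique
      (((measurable_const_mul g).comp measurable_subtype_coe) hD) (fun h => ?_) ρ).symm
    obtain ⟨γ, hγ, hu⟩ := hDΓ (g * h)
    refine ⟨⟨⟨γ, γ.2.2⟩, γ.2.1⟩, ?_, fun γ' hγ' => ?_⟩
    · simpa [mul_assoc] using hγ
    · have := hu ⟨γ', γ'.2, γ'.1.2⟩ (by simpa [mul_assoc] using hγ')
      exact Subtype.ext (Subtype.ext (congrArg (fun x : (Γ ⊓ H : Subgroup G) => (x : G)) this))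
  have hfm : Measurable fun g : G => f (g • y₀) := hf.comp (measurable_smul_const y₀)
  have hDm : Measurable (D.indicator (1 : G → ℝ≥0∞)) := measurable_one.indicator hD
  have hprod : Measurable fun g : G => f (g • y₀) * D.indicator 1 g := hfm.mul hDm
  rw [hW _ hprod, mul_comm, ← lintegral_mul_const _ hf]
  refine lintegral_congr_ae (horb.mono ?_)
  rintro y ⟨g, rfl⟩
  simp only
  have hgD : MeasurableSet ((fun h : H => g * h) ⁻¹' D) :=
    ((measurable_const_mul g).comp measurable_subtype_coe) hD
  rw [orbitFibre_smul hH, ← hfibre g, ← lintegral_indicator_one hgD, ← lintegral_const_mul]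
  · refine lintegral_congr fun h => ?_
    rw [mul_smul, (hH _).1 h.2]
    rfl
  · exact measurable_one.indicator hgD

/-- Unfolding: integrating over `G / Γ` the sum of `f` over the translated orbit `g Γ y₀` gives the
integral of `f` over `Y`, up to the volume of `H / (H ∩ Γ)`, where `H` is the stabilizer of `y₀`. -/
theorem setLIntegral_tsum_orbit_eq [MeasurableSMul G Y] {H Γ : Subgroup G} [DiscreteTopology Γ]
    {y₀ : Y} (hH : ∀ g, g ∈ H ↔ g • y₀ = y₀) {ν : Measure G} [ν.IsMulRightInvariant]
    {ρ : Measure H} [ρ.IsMulLeftInvariant] [ρ.IsMulRightInvariant] {lam : Measure Y}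
    (hW : ∀ φ : G → ℝ≥0∞, Measurable φ → ∫⁻ g, φ g ∂ν = ∫⁻ y, orbitFibre y₀ ρ φ y ∂lam)
    (horb : ∀ᵐ y ∂lam, y ∈ MulAction.orbit G y₀) {F : Set G} (hF : MeasurableSet F)
    (hFΓ : ∀ g : G, ∃! γ : Γ, g * γ ∈ F) {f : Y → ℝ≥0∞} (hf : Measurable f) :
    ∫⁻ g in F, ∑' y : MulAction.orbit Γ y₀, f (g • (y : Y)) ∂ν =
      quotientVol (Γ.subgroupOf H) ρ * ∫⁻ y, f y ∂lam := by
  have hcΓ : Countable Γ := TopologicalSpace.separableSpace_iff_countable.1 inferInstance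
  have hdΓH : DiscreteTopology (Γ ⊓ H : Subgroup G) :=
    DiscreteTopology.of_subset (s := (Γ : Set G)) inferInstance inf_le_left
  obtain ⟨D, hD, hDΓ⟩ := exists_measurableSet_existsUnique_mul_mem (Γ ⊓ H)
  have hprod : Measurable fun g : G => f (g • y₀) * D.indicator 1 g :=
    (hf.comp (measurable_smul_const y₀)).mul (measurable_one.indicator hD)
  rw [← lintegral_orbit_mul_indicator_eq hH hW horb hD hDΓ hf,
    lintegral_eq_setLIntegral_tsum hF hFΓ ν hprod]
  refine lintegral_congr fun g => ?_
  -- group the sum over `Γ` according to the image of `y₀`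
  let π : Γ → MulAction.orbit Γ y₀ := fun γ => ⟨γ • y₀, γ, rfl⟩
  rw [← (Equiv.sigmaFiberEquiv π).tsum_eq, ENNReal.tsum_sigma']
  refine tsum_congr ?_
  rintro ⟨y, γ₀, rfl⟩
  have h2 : ∀ γ : {γ : Γ // π γ = ⟨γ₀ • y₀, γ₀, rfl⟩},
      f ((g * (γ : Γ)) • y₀) = f (g • γ₀ • y₀) := by
    rintro ⟨γ, hγ⟩
    rw [mul_smul]
    congr 2
    exact congrArg Subtype.val hγ
  simp only [Equiv.sigmaFiberEquiv, Equiv.coe_fn_mk]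
  simp_rw [h2]
  rw [ENNReal.tsum_mul_left]
  have h3 : ∑' γ : {γ : Γ // π γ = ⟨γ₀ • y₀, γ₀, rfl⟩},
      D.indicator (1 : G → ℝ≥0∞) (g * (γ : Γ)) = 1 := by
    obtain ⟨γ, hγ, hu⟩ := hDΓ (g * γ₀)
    have hγ1 : π (γ₀ * ⟨γ, γ.2.1⟩) = ⟨γ₀ • y₀, γ₀, rfl⟩ := by
      refine Subtype.ext ?_
      change (γ₀ * ⟨γ, γ.2.1⟩ : Γ) • y₀ = γ₀ • y₀
      rw [mul_smul]
      congr 1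
      exact (hH _).1 γ.2.2
    rw [tsum_eq_single ⟨γ₀ * ⟨γ, γ.2.1⟩, hγ1⟩]
    · rw [Set.indicator_of_mem]
      · rfl
      · simpa [mul_assoc] using hγ
    · rintro ⟨γ', hγ'⟩ hne
      refine Set.indicator_of_notMem (fun hmem => hne (Subtype.ext ?_)) _
      have hst : (γ₀⁻¹ * γ' : Γ) • y₀ = y₀ := by
        have : γ' • y₀ = γ₀ • y₀ := congrArg Subtype.val hγ'
        rw [mul_smul, this, inv_smul_smul]
      have := hu ⟨(γ₀⁻¹ * γ' : Γ), (γ₀⁻¹ * γ').2, (hH _).2 hst⟩ (by simpa [mul_assoc] using hmem)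
      have h4 : γ = ((γ₀⁻¹ * γ' : Γ) : G) := (congrArg Subtype.val this).symm
      refine Subtype.ext ?_
      simp [h4]
  rw [h3, mul_one]

end Unfolding

/-! ### Topology and Haar measure of `SL(d, ℝ)` -/

section SpecialLinear

variable {d : ℕ}

theorem SLR.smul_eq_mulVec (g : SLR d) (v : Fin d → ℝ) :
    g • v = (g : Matrix (Fin d) (Fin d) ℝ) *ᵥ v := rfl

theorem SLR.isClosedEmbedding_coe :
    Topology.IsClosedEmbedding (fun g : SLR d => (g : Matrix (Fin d) (Fin d) ℝ)) :=
  (isClosed_eq (continuous_id.matrix_det) continuous_const :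
    IsClosed {A : Matrix (Fin d) (Fin d) ℝ | A.det = 1}).isClosedEmbedding_subtypeVal

instance SLR.instLocallyCompactSpace : LocallyCompactSpace (SLR d) := by
  have : LocallyCompactSpace (Matrix (Fin d) (Fin d) ℝ) :=
    inferInstanceAs (LocallyCompactSpace (Fin d → Fin d → ℝ))
  exact SLR.isClosedEmbedding_coe.locallyCompactSpace

instance SLR.instSecondCountableTopology : SecondCountableTopology (SLR d) := by
  have : SecondCountableTopology (Matrix (Fin d) (Fin d) ℝ) :=
    inferInstanceAs (SecondCountableTopology (Fin d → Fin d → ℝ))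
  exact SLR.isClosedEmbedding_coe.isEmbedding.secondCountableTopology

instance SLR.instPolishSpace : PolishSpace (SLR d) := by
  have : PolishSpace (Matrix (Fin d) (Fin d) ℝ) :=
    inferInstanceAs (PolishSpace (Fin d → Fin d → ℝ))
  exact SLR.isClosedEmbedding_coe.polishSpace

instance SLR.instContinuousSMul : ContinuousSMul (SLR d) (Fin d → ℝ) :=
  ⟨by
    have h : Continuous fun p : SLR d × (Fin d → ℝ) =>
        (p.1 : Matrix (Fin d) (Fin d) ℝ) *ᵥ p.2 :=
      (SLR.isClosedEmbedding_coe.continuous.comp continuous_fst).matrix_mulVec continuous_snd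
    exact h⟩

instance SLR.smulInvariantMeasure_volume :
    SMulInvariantMeasure (SLR d) (Fin d → ℝ) volume := by
  refine ⟨fun g s hs => ?_⟩
  have h := Real.map_matrix_volume_pi_eq_smul_volume_pi
    (M := (g : Matrix (Fin d) (Fin d) ℝ)) (by simp)
  have hm : Measurable (toLin' (g : Matrix (Fin d) (Fin d) ℝ)) :=
    (LinearMap.continuous_of_finiteDimensional _).measurable
  have h2 : Measure.map (toLin' (g : Matrix (Fin d) (Fin d) ℝ)) volume s = volume s := by
    rw [h]
    simp
  rwa [Measure.map_apply hm hs] at h2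

instance SLR.smulInvariantMeasure_volume_tuple {k : ℕ} :
    SMulInvariantMeasure (SLR d) (Fin k → Fin d → ℝ) volume := by
  refine ⟨fun g s hs => ?_⟩
  exact (volume_preserving_pi fun _ : Fin k => measurePreserving_smul g
    (volume : Measure (Fin d → ℝ))).measure_preimage hs.nullMeasurableSet

theorem SLR.inv_transpose (g : SLR d) : g⁻¹.transpose = g.transpose⁻¹ :=
  Subtype.ext (by simp [adjugate_transpose])

/-- The automorphism `g ↦ (gᵀ)⁻¹` of `SL(d, ℝ)`. -/
def SLR.invTranspose : SLR d ≃* SLR d where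
  toFun g := g⁻¹.transpose
  invFun g := g⁻¹.transpose
  left_inv g := by
    simp only [SLR.inv_transpose, inv_inv]
    rfl
  right_inv g := by
    simp only [SLR.inv_transpose, inv_inv]
    rfl
  map_mul' g h := by
    rw [_root_.mul_inv_rev]
    exact Subtype.ext (transpose_mul _ _)

theorem SLR.continuous_invTranspose : Continuous (SLR.invTranspose (d := d)) := by
  refine SLR.isClosedEmbedding_coe.isEmbedding.continuous_iff.2 ?_
  exact (SLR.isClosedEmbedding_coe.continuous.comp continuous_inv).matrix_transpose

open Measure in
theorem modularCharacter_invTranspose (g : SLR d) :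
    modularCharacter (SLR.invTranspose g) = modularCharacter g := by
  let σ := SLR.invTranspose (d := d)
  let ν : Measure (SLR d) := haar
  have : (map σ ν).IsHaarMeasure := σ.isHaarMeasure_map ν
    SLR.continuous_invTranspose SLR.continuous_invTranspose
  have h1 := map_right_mul_eq_modularCharacterFun_smul ν g
  have h2 := map_right_mul_eq_modularCharacterFun_smul (map σ ν) (σ g)
  have hσ : Measurable σ := SLR.continuous_invTranspose.measurable
  have h3 : map (· * σ g) (map σ ν) = modularCharacterFun g • map σ ν := by
    rw [map_map (measurable_mul_const _) hσ, ← Measure.map_smul, ← h1,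
      map_map hσ (measurable_mul_const _)]
    congr 1
    funext x
    exact (map_mul σ x g).symm
  have h4 := modularCharacterFun_eq_haarScalarFactor (map σ ν) (σ g)
  simp only [h3, haarScalarFactor_smul, haarScalarFactor_self, smul_eq_mul, mul_one] at h4
  exact h4

open Measure in
/-- A diagonal matrix is inverted by `g ↦ (gᵀ)⁻¹`, which preserves the modular character. -/
theorem modularCharacter_diag2n {i j : Fin d} (hij : i ≠ j) {c : ℝ} (hc : c ≠ 0) :
    modularCharacter (SpecialLinearGroup.diag2n hij c hc) = 1 := by
  set h : SLR d := SpecialLinearGroup.diag2n hij c hc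
  have h1 : SLR.invTranspose h = h⁻¹ := by
    change h⁻¹.transpose = h⁻¹
    rw [SLR.inv_transpose]
    congr 1
    exact Subtype.ext (by simp [h, SpecialLinearGroup.diag2n_coe])
  have h2 := modularCharacter_invTranspose h
  rw [h1] at h2
  have h3 : modularCharacter h ^ 2 = 1 := by
    rw [pow_two]
    nth_rewrite 1 [← h2]
    rw [← map_mul, inv_mul_cancel, map_one]
  exact (pow_eq_one_iff_of_nonneg zero_le two_ne_zero).1 h3

open Measure in
theorem modularCharacter_transvection {i j : Fin d} (hij : i ≠ j) (c : ℝ) :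
    modularCharacter (SpecialLinearGroup.transvection hij c : SLR d) = 1 := by
  set a : SLR d := SpecialLinearGroup.diag2n hij 2 two_ne_zero
  set t : SLR d := SpecialLinearGroup.transvection hij c
  -- conjugation by `a` raises the transvection to its fourth power
  have h1 : a * t = t * t * (t * t) * a := by
    simp only [t, ← SpecialLinearGroup.transvection_add]
    refine Subtype.ext ?_
    change diagonal _ * ((1 : Matrix (Fin d) (Fin d) ℝ) + single i j c) =
      ((1 : Matrix (Fin d) (Fin d) ℝ) + single i j (c + c + (c + c))) * diagonal _
    ext p q
    rw [diagonal_mul, mul_diagonal, Matrix.add_apply, Matrix.add_apply]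
    by_cases hpq : i = p ∧ j = q
    · obtain ⟨rfl, rfl⟩ := hpq
      simp [hij, hij.symm]
      ring
    · rw [single_apply_of_ne (h := hpq), single_apply_of_ne (h := hpq)]
      by_cases hpq' : p = q
      · simp [hpq', mul_comm]
      · simp [hpq']
  have h2 := congrArg modularCharacter h1
  simp only [map_mul, modularCharacter_diag2n, a, one_mul, mul_one] at h2
  have h3 : modularCharacter t ^ 3 = 1 := by
    have h0 : modularCharacter t ≠ 0 := (modularCharacterFun_pos t).ne'
    have h4 : modularCharacter t * modularCharacter t ^ 3 = modularCharacter t * 1 := by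
      rw [mul_one]
      nth_rewrite 3 [h2]
      ring
    exact mul_left_cancel₀ h0 h4
  exact (pow_eq_one_iff_of_nonneg zero_le three_ne_zero).1 h3

/-- `SL(d, ℝ)` is unimodular: it is generated by diagonal matrices and transvections, on which the
modular character is trivial. -/
theorem SLR.isMulRightInvariant (hd : 2 ≤ d) (ν : Measure (SLR d)) [ν.IsHaarMeasure] :
    ν.IsMulRightInvariant := by
  have : Nontrivial (Fin d) := Fin.nontrivial_iff_two_le.2 hd
  refine ⟨fun g => ?_⟩
  have hg : Measure.modularCharacter g = 1 :=
    SpecialLinearGroup.diagonal_transvection_induction'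
      (P := fun g : SLR d => Measure.modularCharacter g = 1) g
      (fun i j hij c hc => modularCharacter_diag2n hij hc)
      (fun i j hij c => modularCharacter_transvection hij c)
      (fun A B hA hB => by rw [map_mul, hA, hB, one_mul])
  have h1 := Measure.map_right_mul_eq_modularCharacterFun_smul ν g
  have h2 : Measure.modularCharacterFun g = 1 := hg
  rw [h1, h2, one_smul]

/-! ### The lattice `SL(d, ℤ)` -/

instance SLZ.instDiscreteTopology : DiscreteTopology (SLZ d) := by
  -- an integral matrix whose entries differ by less than `1` from those of the identity is equal to it
  refine discreteTopology_of_isOpen_singleton_one ?_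
  have hopen : IsOpen {γ : SLZ d | ∀ i j : Fin d,
      |((γ : SLR d) : Matrix (Fin d) (Fin d) ℝ) i j - (1 : Matrix (Fin d) (Fin d) ℝ) i j| < 1} := by
    simp only [Set.ofPred_forall]
    refine isOpen_iInter_of_finite fun i => isOpen_iInter_of_finite fun j => ?_
    refine isOpen_lt (Continuous.abs (Continuous.sub ?_ continuous_const)) continuous_const
    exact (SLR.isClosedEmbedding_coe.continuous.comp continuous_subtype_val).matrix_elem i j
  convert hopen using 1
  ext γ
  simp only [Set.mem_singleton_iff, Set.mem_ofPred_eq]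
  constructor
  · rintro rfl i j
    simp
  · intro h
    obtain ⟨_, m, rfl⟩ := γ
    refine Subtype.ext (Subtype.ext ?_)
    ext i j
    have h1 := h i j
    change |((m : Matrix (Fin d) (Fin d) ℤ) i j : ℝ) - (1 : Matrix (Fin d) (Fin d) ℝ) i j| < 1
      at h1
    change ((m : Matrix (Fin d) (Fin d) ℤ) i j : ℝ) = (1 : Matrix (Fin d) (Fin d) ℝ) i j
    have h2 : (1 : Matrix (Fin d) (Fin d) ℝ) i j = ((1 : Matrix (Fin d) (Fin d) ℤ) i j : ℝ) := by
      by_cases hij : i = j <;> simp [hij, Matrix.one_apply]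
    rw [h2] at h1 ⊢
    rw [← Int.cast_sub, ← Int.cast_abs] at h1
    have h3 : |(m : Matrix (Fin d) (Fin d) ℤ) i j - (1 : Matrix (Fin d) (Fin d) ℤ) i j| < 1 := by
      exact_mod_cast h1
    rw [Int.abs_lt_one_iff, sub_eq_zero] at h3
    rw [h3]

instance SLZ.instCountable : Countable (SLZ d) :=
  TopologicalSpace.separableSpace_iff_countable.1 inferInstance

end SpecialLinear

/-! ### The orbit of the standard tuple -/

section Tuples

variable {d k : ℕ}

theorem lintegral_tuple_snoc {F : (Fin (k + 1) → Fin d → ℝ) → ℝ≥0∞} (hF : Measurable F) :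
    ∫⁻ u, F u = ∫⁻ v : Fin k → Fin d → ℝ, ∫⁻ z : Fin d → ℝ, F (Fin.snoc v z) := by
  have h := (volume_preserving_piFinSuccAbove (fun _ : Fin (k + 1) => Fin d → ℝ)
    (Fin.last k)).symm
  have h1 : ∀ p : (Fin d → ℝ) × (Fin k → Fin d → ℝ),
      (MeasurableEquiv.piFinSuccAbove (fun _ : Fin (k + 1) => Fin d → ℝ) (Fin.last k)).symm p =
        (Fin.snoc p.2 p.1 : Fin (k + 1) → Fin d → ℝ) := fun p =>
    Fin.insertNth_last' p.1 p.2
  rw [← h.lintegral_comp hF, Measure.volume_eq_prod, lintegral_prod_symm']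
  · simp_rw [h1]
  · exact hF.comp h.measurable

/-- By induction on the number of vectors: the last one almost surely avoids the span of the
others. -/
theorem ae_linearIndependent (hkd : k ≤ d) :
    ∀ᵐ v : Fin k → Fin d → ℝ, LinearIndependent ℝ v := by
  induction k with
  | zero => exact Filter.Eventually.of_forall fun v => linearIndependent_empty_type
  | succ k ih =>
    have hU : MeasurableSet {v : Fin (k + 1) → Fin d → ℝ | ¬ LinearIndependent ℝ v} :=
      (isOpen_setOfPred_linearIndependent.measurableSet).compl
    rw [ae_iff, ← lintegral_indicator_one hU, lintegral_tuple_snoc (measurable_one.indicator hU),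
      lintegral_eq_zero_of_ae_eq_zero]
    refine (ih (by omega)).mono fun v hv => ?_
    refine lintegral_eq_zero_of_ae_eq_zero ?_
    have hspan : Submodule.span ℝ (Set.range v) ≠ ⊤ := by
      intro h
      have h1 := finrank_span_eq_card hv
      rw [h, finrank_top, Module.finrank_fin_fun, Fintype.card_fin] at h1
      omega
    have h0 := Measure.addHaar_submodule (volume : Measure (Fin d → ℝ)) _ hspan
    refine (measure_eq_zero_iff_ae_notMem.1 h0).mono fun z hz => ?_
    refine Set.indicator_of_notMem ?_ _
    simp only [Set.mem_ofPred_eq, not_not]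
    exact linearIndependent_finSnoc.2 ⟨hv, hz⟩

theorem smul_stdTuple_apply {g : SLR d} (hkd : k ≤ d) (i : Fin k) (r : Fin d) :
    (g • stdTuple d k) i r = (g : Matrix (Fin d) (Fin d) ℝ) r (Fin.castLE hkd i) := by
  have h : stdTuple d k i = Pi.single (Fin.castLE hkd i) 1 := by
    funext s
    simp only [stdTuple, Pi.single_apply, Fin.ext_iff, Fin.val_castLE]
  rw [Pi.smul_apply, SLR.smul_eq_mulVec, h, mulVec_single_one]
  rfl

/-- A family of fewer than `d` members of a basis of `R^d` consists of the first columns of a matrix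
of determinant one. -/
theorem exists_specialLinear_of_basis {R : Type*} [CommRing R] (hkd : k < d)
    (b : Module.Basis (Fin d) R (Fin d → R)) (e : Fin k ↪ Fin d) :
    ∃ g : SpecialLinearGroup (Fin d) R, ∀ (i : Fin k) (r : Fin d),
      (g : Matrix (Fin d) (Fin d) R) r (Fin.castLE hkd.le i) = b (e i) r := by
  classical
  let e₁ := Equiv.ofInjective (Fin.castLE hkd.le : Fin k → Fin d) (Fin.castLE_injective hkd.le)
  let e₂ := Equiv.ofInjective e e.injective
  let σ : Equiv.Perm (Fin d) := (e₁.symm.trans e₂).extendSubtype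
  have hσ : ∀ i, σ (Fin.castLE hkd.le i) = e i := by
    intro i
    have h := (e₁.symm.trans e₂).extendSubtype_apply_of_mem (Fin.castLE hkd.le i) ⟨i, rfl⟩
    refine h.trans ?_
    have h1 : e₁.symm ⟨Fin.castLE hkd.le i, ⟨i, rfl⟩⟩ = i := by
      rw [Equiv.symm_apply_eq]
      rfl
    simp only [Equiv.trans_apply]
    rw [h1]
    rfl
  let c := b.reindex σ.symm
  have hu : IsUnit ((Pi.basisFun R (Fin d)).toMatrix c).det := (Pi.basisFun R (Fin d)).isUnit_det c
  set M := (Pi.basisFun R (Fin d)).toMatrix c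
  obtain ⟨u, hu⟩ := hu
  -- as `k < d`, the last column is free to be rescaled so that the determinant becomes `1`
  let l : Fin d := ⟨d - 1, by omega⟩
  refine ⟨⟨M.updateCol l ((↑u⁻¹ : R) • fun r => M r l), ?_⟩, fun i r => ?_⟩
  · have h : (M.updateCol l fun r => M r l) = M := updateCol_eq_self M l
    rw [det_updateCol_smul, h, ← hu, Units.inv_mul]
  · have hne : Fin.castLE hkd.le i ≠ l := by
      intro h
      have h2 : (i : ℕ) = d - 1 := congrArg Fin.val h
      omega
    change M.updateCol l _ r (Fin.castLE hkd.le i) = _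
    rw [updateCol_ne hne]
    simp [M, c, Module.Basis.toMatrix_apply, hσ]

theorem mem_orbit_stdTuple_iff (hkd : k < d) (v : Fin k → Fin d → ℝ) :
    v ∈ MulAction.orbit (SLR d) (stdTuple d k) ↔ LinearIndependent ℝ v := by
  constructor
  · rintro ⟨g, rfl⟩
    have h1 : LinearIndependent ℝ fun j : Fin d => (g : Matrix (Fin d) (Fin d) ℝ).col j :=
      linearIndependent_cols_of_det_ne_zero (by simp)
    convert h1.comp (Fin.castLE hkd.le) (Fin.castLE_injective hkd.le) using 1
    funext i r
    exact smul_stdTuple_apply hkd.le i r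
  · intro hv
    let b := Module.Basis.extend hv.linearIndepOn_id
    let e : Fin k ↪ hv.linearIndepOn_id.extend (Set.subset_univ (Set.range v)) :=
      ⟨fun i => ⟨v i, Module.Basis.subset_extend hv.linearIndepOn_id ⟨i, rfl⟩⟩,
        fun i j h => hv.injective (congrArg Subtype.val h)⟩
    have hb : ∀ i, b (e i) = v i := fun i => Module.Basis.extend_apply_self _ _
    let E := b.indexEquiv (Pi.basisFun ℝ (Fin d))
    obtain ⟨g, hg⟩ := exists_specialLinear_of_basis hkd (b.reindex E) (e.trans E.toEmbedding)
    refine ⟨g, ?_⟩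
    funext i r
    simp only
    rw [smul_stdTuple_apply hkd.le, hg]
    simp [hb]

theorem mem_stabG_iff (g : SLR d) : g ∈ stabG d k ↔ g • stdTuple d k = stdTuple d k := Iff.rfl

theorem isClosed_stabG : IsClosed (stabG d k : Set (SLR d)) :=
  isClosed_eq (continuous_id.smul continuous_const) continuous_const

theorem measurable_orbitFibre_stdTuple (hkd : k < d) (ρ : Measure (stabG d k))
    [ρ.IsMulLeftInvariant] [SFinite ρ] {φ : SLR d → ℝ≥0∞} (hφ : Measurable φ) :
    Measurable (orbitFibre (stdTuple d k) ρ φ) := by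
  have hO : MeasurableSet (MulAction.orbit (SLR d) (stdTuple d k)) := by
    have : MulAction.orbit (SLR d) (stdTuple d k) = {v | LinearIndependent ℝ v} :=
      Set.ext fun v => mem_orbit_stdTuple_iff hkd v
    rw [this]
    exact isOpen_setOfPred_linearIndependent.measurableSet
  let π : SLR d → MulAction.orbit (SLR d) (stdTuple d k) := fun g => ⟨g • stdTuple d k, g, rfl⟩
  have hπ : Measurable π := (measurable_smul_const (stdTuple d k)).subtype_mk
  have hπs : Function.Surjective π := by
    rintro ⟨_, g, rfl⟩
    exact ⟨g, rfl⟩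
  refine measurable_of_restrict_of_restrict_compl hO ?_ ?_
  · refine (hπ.measurable_comp_iff_of_surjective hπs).1 ?_
    have h1 : (Set.domRestrict (MulAction.orbit (SLR d) (stdTuple d k))
        (orbitFibre (stdTuple d k) ρ φ)) ∘ π = fun g => ∫⁻ h : stabG d k, φ (g * h) ∂ρ := by
      funext g
      exact orbitFibre_smul mem_stabG_iff ρ φ g
    rw [h1]
    refine Measurable.lintegral_prod_right' (f := fun p : SLR d × stabG d k => φ (p.1 * p.2)) ?_
    exact hφ.comp (measurable_fst.mul (measurable_subtype_coe.comp measurable_snd))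
  · have : (Set.domRestrict (MulAction.orbit (SLR d) (stdTuple d k))ᶜ
        (orbitFibre (stdTuple d k) ρ φ)) = fun _ => 0 := by
      funext y
      exact orbitFibre_of_notMem_orbit ρ φ y.2
    rw [this]
    exact measurable_const

/-! ### The Haar measure induced on the stabilizer -/

/-- Weil's formula for the orbit of the standard tuple: `fibreIntegral` is `orbitFibre` for this
orbit, which has full Lebesgue measure. -/
theorem exists_lintegral_fibreIntegral_eq (hkd : k < d) (ν : Measure (SLR d)) [ν.IsHaarMeasure]
    (ρ : Measure (stabG d k)) [ρ.IsHaarMeasure] :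
    ∃ c : ℝ≥0∞, c ≠ 0 ∧ c ≠ ∞ ∧ ∀ φ : SLR d → ℝ≥0∞, Measurable φ →
      ∫⁻ v, fibreIntegral ρ φ v = c * ∫⁻ g, φ g ∂ν := by
  have : LocallyCompactSpace (stabG d k) :=
    isClosed_stabG.isClosedEmbedding_subtypeVal.locallyCompactSpace
  have : SecondCountableTopology (stabG d k) :=
    TopologicalSpace.Subtype.secondCountableTopology (stabG d k : Set (SLR d))
  refine exists_lintegral_orbitFibre_eq (y₀ := stdTuple d k) mem_stabG_iff isClosed_stabG ν ρ volume
    (fun φ hφ => measurable_orbitFibre_stdTuple hkd ρ hφ) ?_ ?_ (NeZero.ne _)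
  · exact (ae_linearIndependent hkd.le).mono fun v hv => (mem_orbit_stdTuple_iff hkd v).2 hv
  · intro C hC
    exact (hC.image (continuous_id.smul continuous_const)).measure_lt_top.ne

theorem fibreIntegral_smul_measure (c : ℝ≥0∞) (ρ : Measure (stabG d k)) (φ : SLR d → ℝ≥0∞)
    (v : Fin k → Fin d → ℝ) : fibreIntegral (c • ρ) φ v = c * fibreIntegral ρ φ v := by
  simp only [fibreIntegral, lintegral_smul_measure, smul_eq_mul, ENNReal.mul_iSup]

theorem exists_measurableSet_measure_ne_zero_ne_top {G : Type*} [Group G] [TopologicalSpace G]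
    [IsTopologicalGroup G] [LocallyCompactSpace G] [MeasurableSpace G] [BorelSpace G]
    (ν : Measure G) [ν.IsHaarMeasure] :
    ∃ s : Set G, MeasurableSet s ∧ ν s ≠ 0 ∧ ν s ≠ ∞ := by
  obtain ⟨C⟩ : Nonempty (TopologicalSpace.PositiveCompacts G) := inferInstance
  exact ⟨closure C, isClosed_closure.measurableSet, (Measure.measure_pos_of_nonempty_interior ν
    (C.interior_nonempty.mono (interior_mono subset_closure))).ne',
    C.isCompact.closure.measure_lt_top.ne⟩

theorem existsUnique_isInducedHaar (hkd : k < d) (ν : Measure (SLR d)) [ν.IsHaarMeasure] :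
    ∃! νk : Measure (stabG d k), IsInducedHaar ν νk := by
  have : LocallyCompactSpace (stabG d k) :=
    isClosed_stabG.isClosedEmbedding_subtypeVal.locallyCompactSpace
  have : SecondCountableTopology (stabG d k) :=
    TopologicalSpace.Subtype.secondCountableTopology (stabG d k : Set (SLR d))
  refine existsUnique_of_exists_of_unique ?_ ?_
  · obtain ⟨c, hc0, hc, h⟩ := exists_lintegral_fibreIntegral_eq hkd ν
      (Measure.haar : Measure (stabG d k))
    refine ⟨c⁻¹ • Measure.haar, Measure.IsHaarMeasure.smul _ (ENNReal.inv_ne_zero.2 hc)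
      (ENNReal.inv_ne_top.2 hc0), fun φ hφ => ?_⟩
    simp_rw [fibreIntegral_smul_measure]
    rw [lintegral_const_mul' _ _ (ENNReal.inv_ne_top.2 hc0), h φ hφ, ← mul_assoc,
      ENNReal.inv_mul_cancel hc0 hc, one_mul]
  · rintro ρ₁ ρ₂ ⟨h1, h1'⟩ ⟨h2, h2'⟩
    have key := Measure.isMulLeftInvariant_eq_smul ρ₁ ρ₂
    set c := ρ₁.haarScalarFactor ρ₂
    obtain ⟨s, hs, hs0, hs1⟩ := exists_measurableSet_measure_ne_zero_ne_top ν
    have hsm : Measurable (s.indicator (1 : SLR d → ℝ≥0∞)) := measurable_one.indicator hs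
    have e1 := h1' _ hsm
    have key' : ρ₁ = (c : ℝ≥0∞) • ρ₂ := key
    rw [key'] at e1
    simp_rw [fibreIntegral_smul_measure] at e1
    rw [lintegral_const_mul' _ _ ENNReal.coe_ne_top, ← h2' _ hsm, lintegral_indicator_one hs] at e1
    have hc : (c : ℝ≥0∞) = 1 := by
      have : (1 : ℝ≥0∞) * ν s = c * ν s := by rw [one_mul]; exact e1
      exact ((ENNReal.mul_left_inj hs0 hs1).1 this).symm
    rw [key', hc, one_smul]

theorem IsInducedHaar.isMulRightInvariant (hd : 2 ≤ d) {ν : Measure (SLR d)}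
    [ν.IsHaarMeasure] {νk : Measure (stabG d k)} (h : IsInducedHaar ν νk) :
    νk.IsMulRightInvariant :=
  have := h.1
  have := SLR.isMulRightInvariant hd ν
  isMulRightInvariant_of_lintegral_orbitFibre_eq mem_stabG_iff isClosed_stabG ν νk volume h.2

theorem IsInducedHaar.lintegral_mul_indicator (hd : 2 ≤ d) (hkd : k < d) {ν : Measure (SLR d)}
    [ν.IsHaarMeasure] {νk : Measure (stabG d k)} (h : IsInducedHaar ν νk) {D : Set (SLR d)}
    (hD : MeasurableSet D) (hDΓ : ∀ g : SLR d, ∃! γ : (SLZ d ⊓ stabG d k : Subgroup (SLR d)), g * γ ∈ D)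
    {f : (Fin k → Fin d → ℝ) → ℝ≥0∞} (hf : Measurable f) :
    ∫⁻ g, f (g • stdTuple d k) * D.indicator 1 g ∂ν =
      quotientVol (stabΓ d k) νk * ∫⁻ v, f v := by
  have := h.1
  have := h.isMulRightInvariant hd
  exact lintegral_orbit_mul_indicator_eq mem_stabG_iff h.2
    ((ae_linearIndependent hkd.le).mono fun v hv => (mem_orbit_stdTuple_iff hkd v).2 hv) hD hDΓ hf

/-- Unfolding for the orbit of the standard tuple under `SL(d, ℤ)`. -/
theorem IsInducedHaar.setLIntegral_tsum_orbit (hd : 2 ≤ d) (hkd : k < d) {ν : Measure (SLR d)}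
    [ν.IsHaarMeasure] {νk : Measure (stabG d k)} (h : IsInducedHaar ν νk) {F : Set (SLR d)}
    (hF : MeasurableSet F) (hFΓ : ∀ g : SLR d, ∃! γ : SLZ d, g * γ ∈ F)
    {f : (Fin k → Fin d → ℝ) → ℝ≥0∞} (hf : Measurable f) :
    ∫⁻ g in F, ∑' w : MulAction.orbit (SLZ d) (stdTuple d k), f (g • (w : Fin k → Fin d → ℝ)) ∂ν =
      quotientVol (stabΓ d k) νk * ∫⁻ v, f v := by
  have := h.1
  have := h.isMulRightInvariant hd
  have := SLR.isMulRightInvariant hd ν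
  exact setLIntegral_tsum_orbit_eq mem_stabG_iff h.2
    ((ae_linearIndependent hkd.le).mono fun v hv => (mem_orbit_stdTuple_iff hkd v).2 hv) hF hFΓ hf

end Tuples

/-! ### Primitive tuples as an orbit of `SL(d, ℤ)` -/

section Arithmetic

variable {d k : ℕ}

/-- The inclusion `ℤ^d → ℝ^d`. -/
def castVec (z : Fin d → ℤ) : Fin d → ℝ := fun i => (z i : ℝ)

/-- The homomorphism `SL(d, ℤ) → SL(d, ℝ)`. -/
abbrev toSLR (m : SpecialLinearGroup (Fin d) ℤ) : SLR d :=
  SpecialLinearGroup.map (Int.castRingHom ℝ) m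

theorem castVec_injective : Function.Injective (castVec (d := d)) := fun _ _ h =>
  funext fun i => Int.cast_injective (congrFun h i)

theorem castVec_add (z z' : Fin d → ℤ) : castVec (z + z') = castVec z + castVec z' := by
  funext i
  simp [castVec]

theorem castVec_sub (z z' : Fin d → ℤ) : castVec (z - z') = castVec z - castVec z' := by
  funext i
  simp [castVec]

theorem toSLR_smul_castVec (m : SpecialLinearGroup (Fin d) ℤ) (z : Fin d → ℤ) :
    toSLR m • castVec z = castVec ((m : Matrix (Fin d) (Fin d) ℤ) *ᵥ z) := by
  funext i
  exact (RingHom.map_mulVec (Int.castRingHom ℝ) (m : Matrix (Fin d) (Fin d) ℤ) z i).symm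

/-- The orbit `SL(d, ℤ) (e₁, …, e_k)`; for `k < d` these are the primitive tuples of `ℤ^d`. -/
abbrev primOrbit (d k : ℕ) : Set (Fin k → Fin d → ℝ) := MulAction.orbit (SLZ d) (stdTuple d k)

theorem mem_primOrbit_iff {w : Fin k → Fin d → ℝ} :
    w ∈ primOrbit d k ↔ ∃ m : SpecialLinearGroup (Fin d) ℤ, toSLR m • stdTuple d k = w := by
  constructor
  · rintro ⟨⟨_, m, rfl⟩, rfl⟩
    exact ⟨m, rfl⟩
  · rintro ⟨m, rfl⟩
    exact ⟨⟨toSLR m, m, rfl⟩, rfl⟩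

theorem toSLR_smul_mem_primOrbit_iff (m : SpecialLinearGroup (Fin d) ℤ) {w : Fin k → Fin d → ℝ} :
    toSLR m • w ∈ primOrbit d k ↔ w ∈ primOrbit d k := by
  rw [mem_primOrbit_iff, mem_primOrbit_iff]
  constructor
  · rintro ⟨m', h⟩
    refine ⟨m⁻¹ * m', ?_⟩
    rw [toSLR, map_mul, mul_smul, h, map_inv, inv_smul_smul]
  · rintro ⟨m', rfl⟩
    exact ⟨m * m', by rw [toSLR, map_mul, mul_smul]⟩

theorem linearIndependent_int_col (g : SLR d) :
    LinearIndependent ℤ (g : Matrix (Fin d) (Fin d) ℝ).col := by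
  have h : LinearIndependent ℝ (g : Matrix (Fin d) (Fin d) ℝ).col :=
    linearIndependent_cols_of_det_ne_zero (by simp)
  exact h.restrict_scalars' ℤ

/-- The columns of `g` as a `ℤ`-basis of the lattice `g ℤ^d`. -/
def colBasis (g : SLR d) : Module.Basis (Fin d) ℤ (latticeOf g) :=
  Module.Basis.span (linearIndependent_int_col g)

theorem colBasis_apply (g : SLR d) (j : Fin d) :
    ((colBasis g j : latticeOf g) : Fin d → ℝ) = (g : Matrix (Fin d) (Fin d) ℝ).col j :=
  congrArg Subtype.val (Module.Basis.span_apply (linearIndependent_int_col g) j)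

theorem smul_castVec_eq_sum (g : SLR d) (z : Fin d → ℤ) :
    g • castVec z = ∑ j, z j • (g : Matrix (Fin d) (Fin d) ℝ).col j := by
  funext i
  rw [SLR.smul_eq_mulVec, mulVec, dotProduct, Finset.sum_apply]
  refine Finset.sum_congr rfl fun j _ => ?_
  simp [castVec, mul_comm]

/-- The primitive `k`-tuples of `g ℤ^d` are the images under `g` of the tuples in the orbit of the
standard tuple. The assumption `k < d` allows a basis extending the tuple to be chosen with
determinant `1`. -/
theorem mem_primitiveTuples_latticeOf_iff (hkd : k < d) (g : SLR d) (v : Fin k → Fin d → ℝ) :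
    v ∈ primitiveTuples k (latticeOf g) ↔ ∃ w ∈ primOrbit d k, g • w = v := by
  constructor
  · rintro ⟨b, e, hb⟩
    obtain ⟨m, hm⟩ := exists_specialLinear_of_basis hkd (b.map (colBasis g).equivFun) e
    refine ⟨toSLR m • stdTuple d k, mem_primOrbit_iff.2 ⟨m, rfl⟩, ?_⟩
    funext i
    rw [← hb i, Pi.smul_apply]
    have h1 : (toSLR m • stdTuple d k) i = castVec ((colBasis g).equivFun (b (e i))) := by
      funext r
      rw [smul_stdTuple_apply hkd.le]
      simp only [castVec]
      rw [← Module.Basis.map_apply, ← hm]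
      rfl
    rw [h1, smul_castVec_eq_sum]
    conv_rhs => rw [← (colBasis g).sum_equivFun (b (e i))]
    rw [Submodule.coe_sum]
    refine Finset.sum_congr rfl fun j _ => ?_
    rw [Submodule.coe_smul, colBasis_apply]
  · rintro ⟨w, hw, rfl⟩
    obtain ⟨m, rfl⟩ := mem_primOrbit_iff.1 hw
    rw [← latticeOf_mul g (γ := toSLR m) ⟨m, rfl⟩]
    refine ⟨colBasis _, Fin.castLEEmb hkd.le, fun i => ?_⟩
    rw [colBasis_apply]
    funext r
    refine Eq.trans ?_ (congrFun (congrFun (mul_smul g (toSLR m) (stdTuple d k)) i) r)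
    exact (smul_stdTuple_apply (g := g * toSLR m) hkd.le i r).symm

theorem stdTuple_eq_castVec (hkd : k ≤ d) (i : Fin k) :
    stdTuple d k i = castVec (Pi.single (Fin.castLE hkd i) 1) := by
  funext s
  simp only [stdTuple, castVec, Pi.single_apply, Fin.ext_iff, Fin.val_castLE]
  split_ifs <;> simp

/-- A vector `z ∈ ℤ^d` completes `(e₁, …, e_k)` to a primitive tuple iff its coordinates beyond the
`k`-th generate `ℤ`. -/
theorem snoc_stdTuple_mem_primOrbit_iff (hkd : k + 1 < d) (z : Fin d → ℤ) :
    (Fin.snoc (stdTuple d k) (castVec z) : Fin (k + 1) → Fin d → ℝ) ∈ primOrbit d (k + 1) ↔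
      ∃ c : Fin d → ℤ, (∀ j : Fin d, (j : ℕ) < k → c j = 0) ∧ c ⬝ᵥ z = 1 := by
  set l : Fin d := ⟨k, by omega⟩
  constructor
  · intro h
    obtain ⟨m, hm⟩ := mem_primOrbit_iff.1 h
    have hcol : ∀ (j : Fin d) (hj : (j : ℕ) < k), (m : Matrix (Fin d) (Fin d) ℤ).col j =
        Pi.single j 1 := by
      intro j hj
      refine castVec_injective ?_
      have h1 := congrFun hm (Fin.castSucc ⟨j, hj⟩)
      rw [Fin.snoc_castSucc, stdTuple_eq_castVec (by omega)] at h1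
      refine Eq.trans ?_ h1
      funext r
      rw [smul_stdTuple_apply hkd.le]
      rfl
    have hcolk : (m : Matrix (Fin d) (Fin d) ℤ).col l = z := by
      refine castVec_injective ?_
      have h1 := congrFun hm (Fin.last k)
      rw [Fin.snoc_last] at h1
      refine Eq.trans ?_ h1
      funext r
      rw [smul_stdTuple_apply hkd.le]
      rfl
    have hinv : ((m⁻¹ : SpecialLinearGroup (Fin d) ℤ) : Matrix (Fin d) (Fin d) ℤ) *
        (m : Matrix (Fin d) (Fin d) ℤ) = 1 := by
      exact congrArg Subtype.val (inv_mul_cancel m)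
    have hrow : ∀ j, ((m⁻¹ : SpecialLinearGroup (Fin d) ℤ) : Matrix (Fin d) (Fin d) ℤ).row l ⬝ᵥ
        (m : Matrix (Fin d) (Fin d) ℤ).col j = (1 : Matrix (Fin d) (Fin d) ℤ) l j := by
      intro j
      rw [← hinv, mul_apply']
      rfl
    refine ⟨((m⁻¹ : SpecialLinearGroup (Fin d) ℤ) : Matrix (Fin d) (Fin d) ℤ).row l,
      fun j hj => ?_, ?_⟩
    · have h1 := hrow j
      rw [hcol j hj, dotProduct_single, mul_one, one_apply_ne] at h1
      · exact h1
      · intro h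
        have : k = (j : ℕ) := congrArg Fin.val h
        omega
    · have h1 := hrow l
      rwa [hcolk, one_apply_eq] at h1
  · rintro ⟨c, hc0, hc⟩
    let t : Fin (k + 1) → Fin d → ℤ :=
      Fin.snoc (fun i : Fin k => Pi.single (Fin.castLE (by omega) i) 1) z
    have hts : ∀ i : Fin k, t i.castSucc = Pi.single (Fin.castLE (by omega) i) 1 := fun i => by
      simp [t]
    have htl : t (Fin.last k) = z := by simp [t]
    have htv : ∀ i, castVec (t i) =
        (Fin.snoc (stdTuple d k) (castVec z) : Fin (k + 1) → Fin d → ℝ) i := by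
      intro i
      induction i using Fin.lastCases with
      | last => rw [htl, Fin.snoc_last]
      | cast i => rw [hts, Fin.snoc_castSucc, stdTuple_eq_castVec (by omega)]
    -- `c` is a functional that vanishes on `e₁, …, e_k` and is `1` at `z`
    have hcs : ∀ i : Fin k, c ⬝ᵥ t i.castSucc = 0 := fun i => by
      rw [hts, dotProduct_single, hc0 _ (by simp), zero_mul]
    have hsum : ∀ a : Fin (k + 1) → ℤ, c ⬝ᵥ (∑ i, a i • t i) = a (Fin.last k) := by
      intro a
      rw [Fin.sum_univ_castSucc]
      simp only [dotProduct_add, dotProduct_sum, dotProduct_smul, hcs, htl, hc, mul_zero,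
        Finset.sum_const_zero, zero_add, smul_eq_mul, mul_one]
    have hcoord : ∀ (a : Fin (k + 1) → ℤ) (j : Fin d), (∑ i, a i • t i) j =
        (if hj : (j : ℕ) < k then a (Fin.castSucc ⟨j, hj⟩) else 0) + a (Fin.last k) * z j := by
      intro a j
      rw [Fin.sum_univ_castSucc, Pi.add_apply, htl, Pi.smul_apply, smul_eq_mul, Finset.sum_apply]
      congr 1
      split_ifs with hj
      · rw [Finset.sum_eq_single (⟨j, hj⟩ : Fin k)]
        · rw [hts, Pi.smul_apply, smul_eq_mul]
          have : Fin.castLE (by omega) (⟨j, hj⟩ : Fin k) = j := rfl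
          rw [this, Pi.single_eq_same, mul_one]
        · intro i _ hi
          have : j ≠ Fin.castLE (by omega) i := fun h => hi (Fin.ext (by simp [h]))
          simp [hts, this]
        · simp
      · refine Finset.sum_eq_zero fun i _ => ?_
        have : j ≠ Fin.castLE (by omega) i := fun h => hj (by simp [h])
        simp [hts, this]
    have hli : LinearIndependent ℤ t := by
      rw [Fintype.linearIndependent_iff]
      intro a ha i
      have hl : a (Fin.last k) = 0 := by rw [← hsum a, ha, dotProduct_zero]
      induction i using Fin.lastCases with
      | last => exact hl
      | cast i =>
        have h1 := hcoord a (Fin.castLE (by omega) i)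
        rw [ha, hl] at h1
        simpa using h1.symm
    -- the span of `e₁, …, e_k, z` is saturated, so that it has a complement
    have htf : ∀ (n : ℤ) (x : Fin d → ℤ), n ≠ 0 → n • x ∈ Submodule.span ℤ (Set.range t) →
        x ∈ Submodule.span ℤ (Set.range t) := by
      intro n x hn hx
      obtain ⟨a, ha⟩ := (Submodule.mem_span_range_iff_exists_fun ℤ).1 hx
      have hl : a (Fin.last k) = n * (c ⬝ᵥ x) := by
        rw [← hsum a, ha, dotProduct_smul, smul_eq_mul]
      refine (Submodule.mem_span_range_iff_exists_fun ℤ).2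
        ⟨Fin.snoc (fun i : Fin k => x (Fin.castLE (by omega) i) -
          (c ⬝ᵥ x) * z (Fin.castLE (by omega) i)) (c ⬝ᵥ x), ?_⟩
      funext j
      rw [hcoord]
      split_ifs with hj
      · rw [Fin.snoc_castSucc, Fin.snoc_last]
        have : Fin.castLE (by omega) (⟨j, hj⟩ : Fin k) = j := rfl
        rw [this]
        ring
      · rw [Fin.snoc_last, zero_add]
        have h1 := congrFun ha j
        rw [hcoord, dif_neg hj, hl, zero_add, Pi.smul_apply, smul_eq_mul, mul_assoc] at h1
        exact mul_left_cancel₀ hn h1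
    set W := Submodule.span ℤ (Set.range t)
    have : Module.IsTorsionFree ℤ ((Fin d → ℤ) ⧸ W) := by
      refine Module.IsTorsionFree.of_smul_eq_zero fun n x hx => or_iff_not_imp_left.2 fun hn => ?_
      obtain ⟨y, rfl⟩ := W.mkQ_surjective x
      rw [← map_smul, Submodule.mkQ_apply, Submodule.Quotient.mk_eq_zero] at hx
      rw [Submodule.mkQ_apply, Submodule.Quotient.mk_eq_zero]
      exact htf n y hn hx
    have : Module.Free ℤ ((Fin d → ℤ) ⧸ W) := Module.free_of_finite_type_torsion_free'
    let B := Module.Basis.sumQuot (Module.Basis.span hli) (Module.Free.chooseBasis ℤ ((Fin d → ℤ) ⧸ W))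
    let E := B.indexEquiv (Pi.basisFun ℤ (Fin d))
    obtain ⟨m, hm⟩ := exists_specialLinear_of_basis hkd (B.reindex E)
      (Function.Embedding.inl.trans E.toEmbedding)
    refine mem_primOrbit_iff.2 ⟨m, ?_⟩
    funext i
    rw [← htv]
    funext r
    rw [smul_stdTuple_apply hkd.le]
    change (((m : Matrix (Fin d) (Fin d) ℤ) r (Fin.castLE hkd.le i) : ℤ) : ℝ) = _
    rw [hm]
    simp [B, castVec, Module.Basis.span_apply]

theorem castVec_mem_span_stdTuple_iff (hkd : k ≤ d) (z : Fin d → ℤ) :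
    castVec z ∈ Submodule.span ℝ (Set.range (stdTuple d k)) ↔ ∀ j : Fin d, k ≤ (j : ℕ) → z j = 0 := by
  have hcoord : ∀ (a : Fin k → ℝ) (j : Fin d), (∑ i, a i • stdTuple d k i) j =
      if hj : (j : ℕ) < k then a ⟨j, hj⟩ else 0 := by
    intro a j
    rw [Finset.sum_apply]
    split_ifs with hj
    · rw [Finset.sum_eq_single (⟨j, hj⟩ : Fin k)]
      · simp [stdTuple]
      · intro i _ hi
        have : (j : ℕ) ≠ i := fun h => hi (Fin.ext h.symm)
        simp [stdTuple, this]
      · simp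
    · refine Finset.sum_eq_zero fun i _ => ?_
      have : (j : ℕ) ≠ i := fun h => hj (by omega)
      simp [stdTuple, this]
  rw [Submodule.mem_span_range_iff_exists_fun]
  constructor
  · rintro ⟨a, ha⟩ j hj
    have h1 := congrFun ha j
    rw [hcoord, dif_neg (by omega)] at h1
    exact Int.cast_eq_zero.1 h1.symm
  · intro h
    refine ⟨fun i => z (Fin.castLE hkd i), ?_⟩
    funext j
    rw [hcoord]
    split_ifs with hj
    · rfl
    · simp [castVec, h j (by omega)]

theorem sum_smul_stdTuple (r : Fin k → ℤ) :
    ∑ i, (r i : ℝ) • stdTuple d k i =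
      castVec fun j : Fin d => if hj : (j : ℕ) < k then r ⟨j, hj⟩ else 0 := by
  funext j
  rw [Finset.sum_apply]
  simp only [castVec]
  split_ifs with hj
  · rw [Finset.sum_eq_single (⟨j, hj⟩ : Fin k)]
    · simp [stdTuple]
    · intro i _ hi
      have : (j : ℕ) ≠ i := fun h => hi (Fin.ext h.symm)
      simp [stdTuple, this]
    · simp
  · rw [Int.cast_zero]
    refine Finset.sum_eq_zero fun i _ => ?_
    have : (j : ℕ) ≠ i := fun h => hj (by omega)
    simp [stdTuple, this]

/-- Division with remainder: an integral vector not in the span of `e₁, …, e_k` is in exactly one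
way of the form `n z + ∑ r_i e_i` with `n ≥ 1`, `0 ≤ r_i < n` and `z` completing `(e₁, …, e_k)` to a
primitive tuple. -/
theorem existsUnique_division (hkd : k ≤ d) (c₀ : Fin d → ℤ) (hc₀ : ∃ j : Fin d, k ≤ (j : ℕ) ∧ c₀ j ≠ 0) :
    ∃! p : (Σ n : ℕ, Fin k → Fin (n + 1)) × (Fin d → ℤ),
      (∃ c : Fin d → ℤ, (∀ j : Fin d, (j : ℕ) < k → c j = 0) ∧ c ⬝ᵥ p.2 = 1) ∧
      c₀ = ((p.1.1 : ℤ) + 1) • p.2 +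
        fun j : Fin d => if hj : (j : ℕ) < k then ((p.1.2 ⟨j, hj⟩ : ℕ) : ℤ) else 0 := by
  -- the ideal generated by the coordinates beyond the `k`-th
  let I : Ideal ℤ := Submodule.map (Fintype.linearCombination ℤ c₀)
    (⨅ j : {j : Fin d // (j : ℕ) < k}, LinearMap.ker (LinearMap.proj (R := ℤ) (j : Fin d)))
  have hI : ∀ x, x ∈ I ↔ ∃ c : Fin d → ℤ, (∀ j : Fin d, (j : ℕ) < k → c j = 0) ∧ c ⬝ᵥ c₀ = x := by
    intro x
    simp only [I, Submodule.mem_map, Submodule.mem_iInf, LinearMap.mem_ker, LinearMap.proj_apply,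
      Subtype.forall, Fintype.linearCombination_apply, dotProduct, smul_eq_mul]
  -- its positive generator is the `n` of the statement
  obtain ⟨g, hg⟩ := (IsPrincipalIdealRing.principal I).principal
  have hgI : ∀ x, x ∈ I ↔ (g.natAbs : ℤ) ∣ x := by
    intro x
    rw [hg, Ideal.submodule_span_eq, Ideal.mem_span_singleton, Int.natAbs_dvd]
  have hcoordI : ∀ j : Fin d, k ≤ (j : ℕ) → c₀ j ∈ I := by
    intro j hj
    rw [hI]
    refine ⟨Pi.single j 1, fun i hi => ?_, by simp⟩
    rw [Pi.single_eq_of_ne]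
    rintro rfl
    omega
  have hg0 : g.natAbs ≠ 0 := by
    intro h0
    obtain ⟨j, hj, hne⟩ := hc₀
    have := (hgI _).1 (hcoordI j hj)
    rw [h0, Int.natCast_zero, zero_dvd_iff] at this
    exact hne this
  obtain ⟨n, hn⟩ := Nat.exists_eq_succ_of_ne_zero hg0
  have hn' : (g.natAbs : ℤ) = (n : ℤ) + 1 := by rw [hn]; push_cast; ring
  rw [hn'] at hgI
  have hpos : (0 : ℤ) < (n : ℤ) + 1 := by positivity
  refine ⟨(⟨n, fun i => ⟨(c₀ (Fin.castLE hkd i) % ((n : ℤ) + 1)).toNat, ?_⟩⟩,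
    fun j => c₀ j / ((n : ℤ) + 1)), ⟨?_, ?_⟩, ?_⟩
  · have h1 := Int.emod_lt_of_pos (c₀ (Fin.castLE hkd i)) hpos
    have h2 := Int.emod_nonneg (c₀ (Fin.castLE hkd i)) hpos.ne'
    omega
  · obtain ⟨c, hc, hcg⟩ := (hI _).1 ((hgI _).2 (dvd_refl ((n : ℤ) + 1)))
    refine ⟨c, hc, mul_left_cancel₀ hpos.ne' ?_⟩
    rw [mul_one]
    refine Eq.trans ?_ hcg
    rw [dotProduct, Finset.mul_sum, dotProduct]
    refine Finset.sum_congr rfl fun j _ => ?_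
    by_cases hj : (j : ℕ) < k
    · simp [hc j hj]
    · rw [mul_left_comm, Int.mul_ediv_cancel' ((hgI _).1 (hcoordI j (by omega)))]
  · funext j
    simp only [Pi.add_apply, Pi.smul_apply, smul_eq_mul]
    split_ifs with hj
    · rw [Int.toNat_of_nonneg (Int.emod_nonneg _ hpos.ne')]
      exact (Int.mul_ediv_add_emod _ _).symm
    · rw [add_zero, Int.mul_ediv_cancel' ((hgI _).1 (hcoordI j (by omega)))]
  · rintro ⟨⟨m, r⟩, z⟩ ⟨⟨c, hc, hcz⟩, hz⟩
    simp only at hcz hz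
    have hzj : ∀ j : Fin d, k ≤ (j : ℕ) → c₀ j = ((m : ℤ) + 1) * z j := by
      intro j hj
      rw [hz]
      simp [not_lt.2 hj]
    have h1 : (n : ℤ) + 1 ∣ (m : ℤ) + 1 := by
      rw [← hgI, hI]
      refine ⟨c, hc, ?_⟩
      rw [hz, dotProduct_add, dotProduct_smul, hcz, smul_eq_mul, mul_one, add_eq_left]
      refine Finset.sum_eq_zero fun j _ => ?_
      by_cases hj : (j : ℕ) < k
      · rw [hc j hj, zero_mul]
      · beta_reduce
        rw [dif_neg hj, mul_zero]
    have h2 : (m : ℤ) + 1 ∣ (n : ℤ) + 1 := by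
      obtain ⟨c', hc', hcg'⟩ := (hI _).1 ((hgI _).2 (dvd_refl ((n : ℤ) + 1)))
      rw [← hcg']
      refine Finset.dvd_sum fun j _ => ?_
      by_cases hj : (j : ℕ) < k
      · simp [hc' j hj]
      · rw [hzj j (by omega)]
        exact Dvd.intro_left (c' j * z j) (by ring)
    have hmn : m = n := by
      have := Int.dvd_antisymm (by positivity) (by positivity) h2 h1
      omega
    subst hmn
    have hdiv : ∀ j : Fin d, c₀ j / ((m : ℤ) + 1) = z j ∧ ∀ hj : (j : ℕ) < k,
        c₀ j % ((m : ℤ) + 1) = ((r ⟨j, hj⟩ : ℕ) : ℤ) := by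
      intro j
      by_cases hj : (j : ℕ) < k
      · have hr := (r ⟨j, hj⟩).2
        have h3 : c₀ j = ((m : ℤ) + 1) * z j + ((r ⟨j, hj⟩ : ℕ) : ℤ) := by
          rw [hz]
          simp [hj]
        have h4 := (Int.ediv_emod_unique (a := c₀ j) (b := (m : ℤ) + 1) (r := ((r ⟨j, hj⟩ : ℕ) : ℤ))
          (q := z j) hpos).2 ⟨by rw [h3]; ring, by positivity, by omega⟩
        exact ⟨h4.1, fun _ => h4.2⟩
      · refine ⟨?_, fun h => absurd h hj⟩
        rw [hzj j (by omega), Int.mul_ediv_cancel_left _ hpos.ne']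
    refine Prod.ext ?_ (funext fun j => ((hdiv j).1).symm)
    simp only [Sigma.mk.injEq, heq_eq_eq, true_and]
    funext i
    refine Fin.ext ?_
    have h5 : _ = ((r i : ℕ) : ℤ) := (hdiv (Fin.castLE hkd i)).2 i.2
    simp only
    omega

end Arithmetic

/-! ### Sums over lattice vectors outside the span of a primitive tuple -/

section Sums

variable {d k : ℕ}

/-- The vectors `z ∈ ℤ^d` that are linearly independent of the tuple `w`. -/
def offSpan (w : Fin k → Fin d → ℝ) : Set (Fin d → ℤ) :=
  {z | castVec z ∉ Submodule.span ℝ (Set.range w)}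

/-- The vectors `z ∈ ℤ^d` that extend `w` to a primitive tuple. -/
def primExt (w : Fin k → Fin d → ℝ) : Set (Fin d → ℤ) :=
  {z | (Fin.snoc w (castVec z) : Fin (k + 1) → Fin d → ℝ) ∈ primOrbit d (k + 1)}

theorem smul_snoc (g : SLR d) (w : Fin k → Fin d → ℝ) (x : Fin d → ℝ) :
    g • (Fin.snoc w x : Fin (k + 1) → Fin d → ℝ) = Fin.snoc (g • w) (g • x) := by
  funext i
  rw [Pi.smul_apply]
  induction i using Fin.lastCases with
  | last => rw [Fin.snoc_last, Fin.snoc_last]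
  | cast i => rw [Fin.snoc_castSucc, Fin.snoc_castSucc, Pi.smul_apply]

instance SLR.smulCommClass_real : SMulCommClass ℝ (SLR d) (Fin d → ℝ) :=
  SMulCommClass.symm _ _ _

theorem smul_mem_span_smul_iff (g : SLR d) (w : Fin k → Fin d → ℝ) (x : Fin d → ℝ) :
    g • x ∈ Submodule.span ℝ (Set.range (g • w)) ↔ x ∈ Submodule.span ℝ (Set.range w) := by
  have key : ∀ (g : SLR d) (w : Fin k → Fin d → ℝ) (x : Fin d → ℝ),
      x ∈ Submodule.span ℝ (Set.range w) → g • x ∈ Submodule.span ℝ (Set.range (g • w)) := by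
    intro g w x hx
    rw [Submodule.mem_span_range_iff_exists_fun] at hx ⊢
    obtain ⟨c, rfl⟩ := hx
    refine ⟨c, ?_⟩
    rw [Finset.smul_sum]
    refine Finset.sum_congr rfl fun i _ => ?_
    rw [Pi.smul_apply, smul_comm]
  refine ⟨fun h => ?_, key g w x⟩
  have := key g⁻¹ _ _ h
  rwa [inv_smul_smul, inv_smul_smul] at this

/-- The action of `SL(d, ℤ)` on `ℤ^d` as permutations. -/
def mulVecEquiv (m : SpecialLinearGroup (Fin d) ℤ) : (Fin d → ℤ) ≃ (Fin d → ℤ) :=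
  MulAction.toPerm m

theorem castVec_mulVecEquiv (m : SpecialLinearGroup (Fin d) ℤ) (z : Fin d → ℤ) :
    castVec (mulVecEquiv m z) = toSLR m • castVec z := (toSLR_smul_castVec m z).symm

/-- The pairs `(n, r)` with `n ≥ 1` and `0 ≤ r_i < n` are encoded by the type
`Σ n, Fin k → Fin (n + 1)`, with `n + 1` in place of `n`. -/
theorem tsum_offSpan_stdTuple (hkd : k + 1 < d) (Q : (Fin d → ℝ) → ℝ≥0∞) :
    ∑' z : offSpan (stdTuple d k), Q (castVec z) =
      ∑' (p : Σ n : ℕ, Fin k → Fin (n + 1)) (z : primExt (stdTuple d k)),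
        Q (((p.1 : ℝ) + 1) • castVec z + ∑ i, ((p.2 i : ℕ) : ℝ) • stdTuple d k i) := by
  rw [← ENNReal.tsum_prod]
  let Z : (Σ n : ℕ, Fin k → Fin (n + 1)) × (Fin d → ℤ) → Fin d → ℤ := fun p =>
    ((p.1.1 : ℤ) + 1) • p.2 +
        fun j : Fin d => if hj : (j : ℕ) < k then ((p.1.2 ⟨j, hj⟩ : ℕ) : ℤ) else 0
  have hZ : ∀ p, castVec (Z p) =
      ((p.1.1 : ℝ) + 1) • castVec p.2 + ∑ i, ((p.1.2 i : ℕ) : ℝ) • stdTuple d k i := by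
    intro p
    have h1 := sum_smul_stdTuple (d := d) fun i => ((p.1.2 i : ℕ) : ℤ)
    simp only [Int.cast_natCast] at h1
    rw [h1, castVec_add]
    congr 1
    funext j
    simp [castVec]
  have hprim : ∀ z, z ∈ primExt (stdTuple d k) ↔
      ∃ c : Fin d → ℤ, (∀ j : Fin d, (j : ℕ) < k → c j = 0) ∧ c ⬝ᵥ z = 1 := fun z =>
    snoc_stdTuple_mem_primOrbit_iff hkd z
  have hoff : ∀ z, z ∈ offSpan (stdTuple d k) ↔ ∃ j : Fin d, k ≤ (j : ℕ) ∧ z j ≠ 0 := by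
    intro z
    change ¬ _ ↔ _
    rw [castVec_mem_span_stdTuple_iff (by omega)]
    push Not
    rfl
  have hmem : ∀ p : (Σ n : ℕ, Fin k → Fin (n + 1)) × primExt (stdTuple d k),
      Z (p.1, p.2) ∈ offSpan (stdTuple d k) := by
    rintro ⟨p, z, hz⟩
    rw [hoff]
    by_contra! hcon
    obtain ⟨c, hc, hcz⟩ := (hprim z).1 hz
    have h0 : ∀ j, c j * z j = 0 := by
      intro j
      by_cases hj : (j : ℕ) < k
      · rw [hc j hj, zero_mul]
      · have h1 := hcon j (by omega)
        simp only [Z, Pi.add_apply, Pi.smul_apply, dif_neg hj, add_zero, smul_eq_mul] at h1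
        rcases mul_eq_zero.1 h1 with h2 | h2
        · omega
        · rw [h2, mul_zero]
    have : (0 : ℤ) = 1 := by
      rw [← hcz]
      exact (Finset.sum_eq_zero fun j _ => h0 j).symm
    omega
  let Φ : (Σ n : ℕ, Fin k → Fin (n + 1)) × primExt (stdTuple d k) → offSpan (stdTuple d k) :=
    fun p => ⟨Z (p.1, p.2), hmem p⟩
  have hΦ : Function.Bijective Φ := by
    constructor
    · rintro ⟨p, z, hz⟩ ⟨p', z', hz'⟩ h
      have h1 : Z (p, z) = Z (p', z') := congrArg Subtype.val h
      obtain ⟨_, _, hu⟩ := existsUnique_division (k := k) (by omega) (Z (p, z))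
        ((hoff _).1 (hmem ⟨p, z, hz⟩))
      have h2 := (hu (p, z) ⟨(hprim z).1 hz, rfl⟩).trans
        (hu (p', z') ⟨(hprim z').1 hz', h1⟩).symm
      simp only [Prod.mk.injEq] at h2
      obtain ⟨rfl, rfl⟩ := h2
      rfl
    · rintro ⟨y, hy⟩
      obtain ⟨⟨p, z⟩, ⟨h1, h2⟩, _⟩ := existsUnique_division (k := k) (by omega) y ((hoff y).1 hy)
      exact ⟨⟨p, z, (hprim z).2 h1⟩, Subtype.ext h2.symm⟩
  rw [← (Equiv.ofBijective Φ hΦ).tsum_eq]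
  refine tsum_congr fun p => ?_
  rw [← hZ (p.1, p.2)]
  rfl

/-- A sum over the integer vectors outside the span of a primitive tuple `w`, in terms of the
vectors that extend `w` to a primitive tuple. -/
theorem tsum_offSpan (hkd : k + 1 < d) {w : Fin k → Fin d → ℝ} (hw : w ∈ primOrbit d k)
    (Q : (Fin d → ℝ) → ℝ≥0∞) :
    ∑' z : offSpan w, Q (castVec z) =
      ∑' (p : Σ n : ℕ, Fin k → Fin (n + 1)) (z : primExt w),
        Q (((p.1 : ℝ) + 1) • castVec z + ∑ i, ((p.2 i : ℕ) : ℝ) • w i) := by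
  obtain ⟨m, rfl⟩ := mem_primOrbit_iff.1 hw
  have h := tsum_offSpan_stdTuple hkd fun x => Q (toSLR m • x)
  have e1 : ∀ z, z ∈ offSpan (stdTuple d k) ↔ mulVecEquiv m z ∈ offSpan (toSLR m • stdTuple d k) := by
    intro z
    simp only [offSpan, Set.mem_ofPred_eq]
    rw [castVec_mulVecEquiv, smul_mem_span_smul_iff]
  have e2 : ∀ z, z ∈ primExt (stdTuple d k) ↔ mulVecEquiv m z ∈ primExt (toSLR m • stdTuple d k) := by
    intro z
    simp only [primExt, Set.mem_ofPred_eq]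
    rw [castVec_mulVecEquiv, ← smul_snoc, toSLR_smul_mem_primOrbit_iff]
  rw [← ((mulVecEquiv m).subtypeEquiv e1).tsum_eq]
  simp_rw [← ((mulVecEquiv m).subtypeEquiv e2).tsum_eq]
  simp only [Equiv.subtypeEquiv_apply, castVec_mulVecEquiv]
  rw [h]
  refine tsum_congr fun p => tsum_congr fun z => ?_
  congr 1
  rw [smul_add, Finset.smul_sum, smul_comm]
  congr 1
  refine Finset.sum_congr rfl fun i _ => ?_
  rw [Pi.smul_apply, smul_comm]

/-- Sums over primitive `(k+1)`-tuples as iterated sums. -/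
theorem tsum_primOrbit_succ (hkd : k + 1 ≤ d) (Q : (Fin (k + 1) → Fin d → ℝ) → ℝ≥0∞) :
    ∑' u : primOrbit d (k + 1), Q u =
      ∑' (w : primOrbit d k) (z : primExt (w : Fin k → Fin d → ℝ)), Q (Fin.snoc w (castVec z)) := by
  rw [← ENNReal.tsum_sigma' fun p : Σ w : primOrbit d k, primExt (w : Fin k → Fin d → ℝ) =>
    Q (Fin.snoc (p.1 : Fin k → Fin d → ℝ) (castVec p.2))]
  let Φ : (Σ w : primOrbit d k, primExt (w : Fin k → Fin d → ℝ)) → primOrbit d (k + 1) :=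
    fun p => ⟨Fin.snoc p.1 (castVec p.2), p.2.2⟩
  have hΦ : Function.Bijective Φ := by
    constructor
    · rintro ⟨⟨w, hw⟩, z, hz⟩ ⟨⟨w', hw'⟩, z', hz'⟩ h
      have h1 : (Fin.snoc w (castVec z) : Fin (k + 1) → Fin d → ℝ) = Fin.snoc w' (castVec z') :=
        congrArg Subtype.val h
      obtain ⟨h2, h3⟩ := Fin.snoc_inj.1 h1
      have h4 := castVec_injective h3
      subst h2 h4
      rfl
    · rintro ⟨u, hu⟩
      obtain ⟨m, rfl⟩ := mem_primOrbit_iff.1 hu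
      have h1 : (Fin.snoc (toSLR m • stdTuple d k)
          (castVec fun r => (m : Matrix (Fin d) (Fin d) ℤ) r (Fin.castLE hkd (Fin.last k))) :
          Fin (k + 1) → Fin d → ℝ) = toSLR m • stdTuple d (k + 1) := by
        funext i r
        rw [smul_stdTuple_apply hkd]
        induction i using Fin.lastCases with
        | last =>
          rw [Fin.snoc_last]
          rfl
        | cast i =>
          rw [Fin.snoc_castSucc, smul_stdTuple_apply (by omega)]
          rfl
      refine ⟨⟨⟨_, mem_primOrbit_iff.2 ⟨m, rfl⟩⟩,
        fun r => (m : Matrix (Fin d) (Fin d) ℤ) r (Fin.castLE hkd (Fin.last k)), ?_⟩, ?_⟩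
      · simp only [primExt, Set.mem_ofPred_eq]
        rw [h1]
        exact hu
      · exact Subtype.ext h1
  rw [← (Equiv.ofBijective Φ hΦ).tsum_eq]
  rfl

theorem summable_zetaVal {s : ℕ} (hs : 2 ≤ s) : Summable fun n : ℕ => 1 / ((n : ℝ) + 1) ^ s := by
  have h := (summable_nat_add_iff 1).2 (Real.summable_one_div_nat_pow.2 (by omega : 1 < s))
  simpa using h

theorem ofReal_zetaVal {s : ℕ} (hs : 2 ≤ s) :
    ENNReal.ofReal (zetaVal s) = ∑' n : ℕ, (((n : ℝ≥0∞) + 1) ^ s)⁻¹ := by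
  rw [zetaVal, ENNReal.ofReal_tsum_of_nonneg (fun n => by positivity) (summable_zetaVal hs)]
  refine tsum_congr fun n => ?_
  rw [one_div, ENNReal.ofReal_inv_of_pos (by positivity), ENNReal.ofReal_pow (by positivity),
    ENNReal.ofReal_add (by positivity) zero_le_one]
  simp

theorem zetaVal_pos {s : ℕ} (hs : 2 ≤ s) : 0 < zetaVal s :=
  (summable_zetaVal hs).tsum_pos (fun n => by positivity) 0 (by norm_num)

end Sums

/-! ### Comparing consecutive mean values -/

section Mean

variable {d k : ℕ}

/-- The measure `μ` on `SL(d, ℝ)` satisfies the mean value formula for primitive `k`-tuples with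
constant `W`. -/
def IsTupleMean (μ : Measure (SLR d)) (k : ℕ) (W : ℝ≥0∞) : Prop :=
  ∀ f : (Fin k → Fin d → ℝ) → ℝ≥0∞, Measurable f →
    ∫⁻ g, ∑' w : primOrbit d k, f (g • (w : Fin k → Fin d → ℝ)) ∂μ = W * ∫⁻ v, f v

instance : Countable (primOrbit d k) :=
  (Set.countable_range (fun γ : SLZ d => γ • stdTuple d k)).to_subtype

/-- The mean value formula for tuples `(v, x)` with `v` primitive and `x` a lattice vector outside
the span of `v`. -/
theorem IsTupleMean.lintegral_tsum_offSpan (hkd : k + 1 < d) {μ : Measure (SLR d)} {W : ℝ≥0∞}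
    (hW : IsTupleMean μ (k + 1) W) {f : (Fin k → Fin d → ℝ) → ℝ≥0∞} (hf : Measurable f)
    {q : (Fin d → ℝ) → ℝ≥0∞} (hq : Measurable q) :
    ∫⁻ g, ∑' w : primOrbit d k, f (g • (w : Fin k → Fin d → ℝ)) *
        ∑' z : offSpan (w : Fin k → Fin d → ℝ), q (g • castVec z) ∂μ =
      ENNReal.ofReal (zetaVal (d - k)) * W * ((∫⁻ v, f v) * ∫⁻ x, q x) := by
  let Ψ : (Σ n : ℕ, Fin k → Fin (n + 1)) → (Fin (k + 1) → Fin d → ℝ) → ℝ≥0∞ := fun p u =>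
    f (Fin.init u) * q (((p.1 : ℝ) + 1) • u (Fin.last k) +
      ∑ i, ((p.2 i : ℕ) : ℝ) • (Fin.init u : Fin k → Fin d → ℝ) i)
  have hinit : Measurable fun u : Fin (k + 1) → Fin d → ℝ => (Fin.init u : Fin k → Fin d → ℝ) :=
    measurable_pi_iff.2 fun i => measurable_pi_apply _
  have hΨ : ∀ p, Measurable (Ψ p) := by
    intro p
    refine (hf.comp hinit).mul (hq.comp ?_)
    have hl : Measurable fun u : Fin (k + 1) → Fin d → ℝ => u (Fin.last k) :=
      measurable_pi_apply _
    have hi : ∀ i, Measurable fun u : Fin (k + 1) → Fin d → ℝ =>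
        (Fin.init u : Fin k → Fin d → ℝ) i := fun i => (measurable_pi_apply i).comp hinit
    exact (hl.const_smul ((p.1 : ℝ) + 1)).add
      (Finset.measurable_sum _ fun i _ => (hi i).const_smul ((p.2 i : ℕ) : ℝ))
  have h1 : ∀ g : SLR d, ∑' w : primOrbit d k, f (g • (w : Fin k → Fin d → ℝ)) *
        ∑' z : offSpan (w : Fin k → Fin d → ℝ), q (g • castVec z) =
      ∑' p, ∑' u : primOrbit d (k + 1), Ψ p (g • (u : Fin (k + 1) → Fin d → ℝ)) := by
    intro g
    simp_rw [fun p => tsum_primOrbit_succ (by omega : k + 1 ≤ d)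
      fun u => Ψ p (g • (u : Fin (k + 1) → Fin d → ℝ))]
    rw [ENNReal.tsum_comm]
    refine tsum_congr fun w => ?_
    rw [tsum_offSpan hkd w.2 fun x => q (g • x), ← ENNReal.tsum_mul_left]
    refine tsum_congr fun p => ?_
    rw [← ENNReal.tsum_mul_left]
    refine tsum_congr fun z => ?_
    simp only [Ψ, smul_snoc, Fin.init_snoc, Fin.snoc_last]
    rw [smul_add, smul_comm, Finset.smul_sum]
    congr 3
    refine Finset.sum_congr rfl fun i _ => ?_
    rw [Pi.smul_apply, smul_comm]
  -- the substitution `z ↦ (n + 1) z + ∑ r_i v_i` has Jacobian `(n + 1) ^ d`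
  have h2 : ∀ p, ∫⁻ u, Ψ p u = (((p.1 : ℝ≥0∞) + 1) ^ d)⁻¹ * ((∫⁻ v, f v) * ∫⁻ x, q x) := by
    intro p
    rw [lintegral_tuple_snoc (hΨ p)]
    simp only [Ψ, Fin.init_snoc, Fin.snoc_last]
    have h3 : ∀ v : Fin k → Fin d → ℝ, ∫⁻ z : Fin d → ℝ, f v * q (((p.1 : ℝ) + 1) • z +
        ∑ i, ((p.2 i : ℕ) : ℝ) • v i) = f v * ((((p.1 : ℝ≥0∞) + 1) ^ d)⁻¹ * ∫⁻ x, q x) := by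
      intro v
      have hm : Measurable fun x : Fin d → ℝ => q (x + ∑ i, ((p.2 i : ℕ) : ℝ) • v i) :=
        hq.comp (measurable_id.add_const _)
      have hm' : Measurable fun z : Fin d → ℝ =>
          q (((p.1 : ℝ) + 1) • z + ∑ i, ((p.2 i : ℕ) : ℝ) • v i) :=
        hm.comp (measurable_const_smul ((p.1 : ℝ) + 1))
      rw [lintegral_const_mul _ hm']
      congr 1
      have h4 := lintegral_map hm (measurable_const_smul ((p.1 : ℝ) + 1))
        (μ := (volume : Measure (Fin d → ℝ)))
      rw [← h4, Measure.map_addHaar_smul _ (by positivity), lintegral_smul_measure,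
        lintegral_add_right_eq_self (fun x => q x), Module.finrank_fin_fun, smul_eq_mul]
      congr 1
      rw [abs_of_nonneg (by positivity), ENNReal.ofReal_inv_of_pos (by positivity),
        ENNReal.ofReal_pow (by positivity), ENNReal.ofReal_add (by positivity) zero_le_one]
      simp
    simp_rw [h3]
    rw [lintegral_mul_const _ hf]
    ring
  have hum : ∀ p (u : primOrbit d (k + 1)),
      Measurable fun g : SLR d => Ψ p (g • (u : Fin (k + 1) → Fin d → ℝ)) := fun p u =>
    (hΨ p).comp (measurable_smul_const _)
  simp_rw [h1]
  rw [lintegral_tsum fun p => (Measurable.tsum (hum p)).aemeasurable]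
  simp_rw [fun p => hW (Ψ p) (hΨ p), h2]
  rw [ENNReal.tsum_mul_left, ENNReal.tsum_mul_right, ENNReal.tsum_sigma', ofReal_zetaVal (by omega)]
  -- there are `(n + 1) ^ k` choices of `r`
  have h5 : ∀ n : ℕ, ∑' _ : Fin k → Fin (n + 1), (((n : ℝ≥0∞) + 1) ^ d)⁻¹ =
      (((n : ℝ≥0∞) + 1) ^ (d - k))⁻¹ := by
    intro n
    rw [tsum_fintype, Finset.sum_const, Finset.card_univ, Fintype.card_fun, Fintype.card_fin,
      Fintype.card_fin, nsmul_eq_mul]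
    have h6 : ((n : ℝ≥0∞) + 1) ≠ 0 := by simp
    have h7 : ((n : ℝ≥0∞) + 1) ≠ ∞ := by simp
    have h8 : ((n : ℝ≥0∞) + 1) ^ d = ((n : ℝ≥0∞) + 1) ^ k * ((n : ℝ≥0∞) + 1) ^ (d - k) := by
      rw [← pow_add]
      congr 1
      omega
    rw [h8, ENNReal.mul_inv (Or.inl (pow_ne_zero _ h6)) (Or.inl (ENNReal.pow_ne_top h7)), ← mul_assoc]
    push_cast
    rw [ENNReal.mul_inv_cancel (pow_ne_zero _ h6) (ENNReal.pow_ne_top h7), one_mul]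
  simp_rw [h5]
  ring

end Mean

/-! ### Counting lattice points in large balls -/

section Count

open Filter Topology
open scoped Pointwise

variable {d k : ℕ}

theorem finite_norm_smul_castVec_le (g : SLR d) (r : ℝ) :
    {z : Fin d → ℤ | ‖g • castVec z‖ ≤ r}.Finite := by
  obtain ⟨M, hM⟩ := (((isCompact_closedBall (0 : Fin d → ℝ) r).image
    (continuous_const_smul g⁻¹)).isBounded).exists_norm_le
  refine (Set.finite_Icc (fun _ : Fin d => ⌊-M⌋) (fun _ : Fin d => ⌈M⌉)).subset ?_
  intro z hz
  have h1 : ‖castVec z‖ ≤ M := by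
    refine hM _ ⟨g • castVec z, ?_, inv_smul_smul _ _⟩
    rwa [mem_closedBall_zero_iff]
  have h2 : ∀ i, |(z i : ℝ)| ≤ M := fun i => (norm_le_pi_norm (castVec z) i).trans h1
  constructor
  · intro i
    have := (abs_le.1 (h2 i)).1
    exact Int.cast_le.1 ((Int.floor_le (-M)).trans this)
  · intro i
    have := (abs_le.1 (h2 i)).2
    exact Int.cast_le.1 (this.trans (Int.le_ceil M))

theorem castVec_mem_span_basisFun (x : Fin d → ℝ) :
    x ∈ Submodule.span ℤ (Set.range (Pi.basisFun ℝ (Fin d))) ↔ ∃ z, castVec z = x := by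
  rw [(Pi.basisFun ℝ (Fin d)).mem_span_iff_repr_mem ℤ]
  simp only [Pi.basisFun_repr, Set.mem_range]
  constructor
  · intro h
    choose z hz using h
    exact ⟨z, funext hz⟩
  · rintro ⟨z, rfl⟩ i
    exact ⟨z i, rfl⟩

/-- The number of integer vectors outside the span of `w` that `g` maps into a large ball is
asymptotic to the volume of the ball. -/
theorem tendsto_tsum_offSpan (hkd : k < d) (g : SLR d) (w : Fin k → Fin d → ℝ) :
    Tendsto (fun n : ℕ => ((n : ℝ≥0∞) ^ d)⁻¹ * ∑' z : offSpan w,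
      (Metric.closedBall (0 : Fin d → ℝ) n).indicator (1 : (Fin d → ℝ) → ℝ≥0∞) (g • castVec z))
      atTop (𝓝 (2 ^ d)) := by
  set V : Submodule ℝ (Fin d → ℝ) := Submodule.span ℝ (Set.range w) with hV
  have hVtop : V ≠ ⊤ := by
    intro h
    have h1 := finrank_range_le_card (R := ℝ) w
    rw [Set.finrank, ← hV, h, finrank_top, Module.finrank_fin_fun, Fintype.card_fin] at h1
    omega
  have hVcl : IsClosed (V : Set (Fin d → ℝ)) := V.closed_of_finiteDimensional
  -- count the points of the scaled lattice `n⁻¹ ℤ^d` in `T \ V`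
  set T : Set (Fin d → ℝ) := (fun x => g • x) ⁻¹' Metric.closedBall 0 1 with hT
  have hTcl : IsClosed T := Metric.isClosed_closedBall.preimage (continuous_const_smul g)
  have hTb : Bornology.IsBounded T := by
    refine ((isCompact_closedBall (0 : Fin d → ℝ) 1).image (continuous_const_smul g⁻¹)).isBounded.subset ?_
    intro x hx
    exact ⟨g • x, hx, inv_smul_smul _ _⟩
  have hTconv : Convex ℝ T := by
    have := (convex_closedBall (0 : Fin d → ℝ) 1).is_linear_preimage
      (f := fun x => g • x) ⟨smul_add g, fun c x => (smul_comm c g x).symm⟩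
    exact this
  have hfr : volume (frontier (T ∩ (V : Set (Fin d → ℝ))ᶜ)) = 0 := by
    refine measure_mono_null (frontier_inter_subset _ _) (measure_union_null ?_ ?_)
    · exact measure_mono_null Set.inter_subset_left (hTconv.addHaar_frontier _)
    · refine measure_mono_null Set.inter_subset_right ?_
      rw [frontier_compl]
      exact measure_mono_null hVcl.frontier_subset (Measure.addHaar_submodule _ V hVtop)
  have hvol : volume.real (T ∩ (V : Set (Fin d → ℝ))ᶜ) = 2 ^ d := by
    have h1 : volume (T ∩ (V : Set (Fin d → ℝ))ᶜ) = 2 ^ d := by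
      rw [← Set.sdiff_eq, measure_sdiff_null (Measure.addHaar_submodule _ V hVtop), hT,
        measure_preimage_smul, Real.volume_pi_closedBall _ zero_le_one]
      simp
    rw [Measure.real, h1]
    simp
  have key := tendsto_card_div_pow_atTop_volume (T ∩ (V : Set (Fin d → ℝ))ᶜ)
    (hTb.subset Set.inter_subset_left) (hTcl.measurableSet.inter hVcl.measurableSet.compl) hfr
  rw [hvol, Fintype.card_fin] at key
  have key' := ENNReal.tendsto_ofReal key
  have h2d : ENNReal.ofReal (2 ^ d) = 2 ^ d := by
    rw [ENNReal.ofReal_pow (by norm_num)]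
    simp
  rw [h2d] at key'
  refine key'.congr' ?_
  filter_upwards [eventually_gt_atTop 0] with n hn
  have hn0 : (n : ℝ) ≠ 0 := by positivity
  set E : Set (Fin d → ℤ) := {z | z ∈ offSpan w ∧ ‖g • castVec z‖ ≤ n} with hE
  have hEfin : E.Finite := (finite_norm_smul_castVec_le g n).subset fun z hz => hz.2
  have h1 : T ∩ (V : Set (Fin d → ℝ))ᶜ ∩ (n : ℝ)⁻¹ •
      (Submodule.span ℤ (Set.range (Pi.basisFun ℝ (Fin d))) : Set (Fin d → ℝ)) =
      (fun z => (n : ℝ)⁻¹ • castVec z) '' E := by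
    have hiff : ∀ z, (n : ℝ)⁻¹ • castVec z ∈ T ∩ (V : Set (Fin d → ℝ))ᶜ ↔ z ∈ E := by
      intro z
      have e1 : (n : ℝ)⁻¹ • castVec z ∈ V ↔ castVec z ∈ V :=
        Submodule.smul_mem_iff _ (inv_ne_zero hn0)
      have e2 : (n : ℝ)⁻¹ • castVec z ∈ T ↔ ‖g • castVec z‖ ≤ n := by
        rw [hT, Set.mem_preimage, mem_closedBall_zero_iff, ← smul_comm, norm_smul, norm_inv,
          Real.norm_natCast, inv_mul_le_iff₀ (by positivity), mul_one]
      rw [Set.mem_inter_iff, e2, Set.mem_compl_iff, SetLike.mem_coe, e1, and_comm]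
      rfl
    ext x
    constructor
    · rintro ⟨hx, y, hy, rfl⟩
      obtain ⟨z, rfl⟩ := (castVec_mem_span_basisFun y).1 hy
      exact ⟨z, (hiff z).1 hx, rfl⟩
    · rintro ⟨z, hz, rfl⟩
      exact ⟨(hiff z).2 hz, castVec z, (castVec_mem_span_basisFun _).2 ⟨z, rfl⟩, rfl⟩
  have hinj : Function.Injective fun z : Fin d → ℤ => (n : ℝ)⁻¹ • castVec z := fun z z' h =>
    castVec_injective (smul_right_injective _ (inv_ne_zero hn0) h)
  have h2 : ∑' z : offSpan w, (Metric.closedBall (0 : Fin d → ℝ) n).indicator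
      (1 : (Fin d → ℝ) → ℝ≥0∞) (g • castVec z) = (E.ncard : ℝ≥0∞) := by
    rw [tsum_subtype (offSpan w) fun z => (Metric.closedBall (0 : Fin d → ℝ) n).indicator
      (1 : (Fin d → ℝ) → ℝ≥0∞) (g • castVec z)]
    have h3 : ∀ z, (offSpan w).indicator (fun z => (Metric.closedBall (0 : Fin d → ℝ) n).indicator
        (1 : (Fin d → ℝ) → ℝ≥0∞) (g • castVec z)) z = E.indicator 1 z := by
      intro z
      by_cases hz : z ∈ E
      · rw [Set.indicator_of_mem hz, Set.indicator_of_mem hz.1,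
          Set.indicator_of_mem (mem_closedBall_zero_iff.2 hz.2)]
        rfl
      · rw [Set.indicator_of_notMem hz]
        by_cases hz1 : z ∈ offSpan w
        · rw [Set.indicator_of_mem hz1, Set.indicator_of_notMem]
          exact fun h => hz ⟨hz1, mem_closedBall_zero_iff.1 h⟩
        · rw [Set.indicator_of_notMem hz1]
    simp_rw [h3]
    rw [← tsum_subtype E (1 : (Fin d → ℤ) → ℝ≥0∞)]
    simp only [Pi.one_apply]
    rw [ENNReal.tsum_set_one, ← hEfin.cast_ncard_eq]
    simp
  rw [h1, Nat.card_coe_set_eq, Set.ncard_image_of_injective _ hinj, h2,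
    ENNReal.ofReal_div_of_pos (by positivity), ENNReal.ofReal_pow (by positivity), mul_comm]
  simp [div_eq_mul_inv]

/-- Cutting the ball of radius `N` into unit cubes bounds its number of lattice points by that of
the unit ball. -/
theorem tsum_indicator_closedBall_le (g : SLR d) (N : ℕ) :
    ∑' z : Fin d → ℤ, (Metric.closedBall (0 : Fin d → ℝ) N).indicator
        (1 : (Fin d → ℝ) → ℝ≥0∞) (g • castVec z) ≤
      (2 * N + 1) ^ d * ∑' z : Fin d → ℤ, (Metric.closedBall (0 : Fin d → ℝ) 1).indicator
        (1 : (Fin d → ℝ) → ℝ≥0∞) (g • castVec z) := by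
  classical
  have hset : ∀ r : ℝ, ∑' z : Fin d → ℤ, (Metric.closedBall (0 : Fin d → ℝ) r).indicator
      (1 : (Fin d → ℝ) → ℝ≥0∞) (g • castVec z) =
      ∑' _ : {z : Fin d → ℤ | ‖g • castVec z‖ ≤ r}, (1 : ℝ≥0∞) := by
    intro r
    rw [tsum_subtype {z : Fin d → ℤ | ‖g • castVec z‖ ≤ r} fun _ => (1 : ℝ≥0∞)]
    refine tsum_congr fun z => ?_
    by_cases hz : ‖g • castVec z‖ ≤ r
    · rw [Set.indicator_of_mem (mem_closedBall_zero_iff.2 hz),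
        Set.indicator_of_mem (show z ∈ {z : Fin d → ℤ | ‖g • castVec z‖ ≤ r} from hz)]
      rfl
    · rw [Set.indicator_of_notMem (fun h => hz (mem_closedBall_zero_iff.1 h)),
        Set.indicator_of_notMem (show z ∉ {z : Fin d → ℤ | ‖g • castVec z‖ ≤ r} from hz)]
  rw [hset, hset]
  set S : Set (Fin d → ℤ) := {z | ‖g • castVec z‖ ≤ N}
  -- `fl z` is the unit cube that contains `g z`, and `base` picks a lattice point in each cube
  let fl : S → Fin d → Finset.Icc (-(N : ℤ)) N := fun z i => ⟨⌊(g • castVec (z : Fin d → ℤ)) i⌋, by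
    have h1 := abs_le.1 ((norm_le_pi_norm (g • castVec (z : Fin d → ℤ)) i).trans z.2)
    rw [Finset.mem_Icc]
    constructor
    · rw [Int.le_floor]
      push_cast
      exact h1.1
    · exact Int.cast_le.1 ((Int.floor_le _).trans (by exact_mod_cast h1.2))⟩
  let base : (Fin d → Finset.Icc (-(N : ℤ)) N) → Fin d → ℤ := fun p =>
    if h : ∃ z, fl z = p then (h.choose : Fin d → ℤ) else 0
  have hbase : ∀ z : S, ‖g • castVec ((z : Fin d → ℤ) - base (fl z))‖ ≤ 1 := by
    intro z
    have h : ∃ z', fl z' = fl z := ⟨z, rfl⟩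
    have e : base (fl z) = (h.choose : Fin d → ℤ) := dif_pos h
    have e2 := h.choose_spec
    rw [e, castVec_sub, smul_sub, pi_norm_le_iff_of_nonneg zero_le_one]
    intro i
    have e3 : ⌊(g • castVec (h.choose : Fin d → ℤ)) i⌋ = ⌊(g • castVec (z : Fin d → ℤ)) i⌋ :=
      congrArg Subtype.val (congrFun e2 i)
    exact (Int.abs_sub_lt_one_of_floor_eq_floor e3.symm).le
  let Θ : S → (Fin d → Finset.Icc (-(N : ℤ)) N) × {z : Fin d → ℤ | ‖g • castVec z‖ ≤ 1} :=
    fun z => (fl z, ⟨_, hbase z⟩)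
  have hΘ : Function.Injective Θ := by
    intro z z' h
    have h1 : fl z = fl z' := congrArg Prod.fst h
    have h2 : (z : Fin d → ℤ) - base (fl z) = z' - base (fl z') :=
      congrArg (fun p => (p.2 : Fin d → ℤ)) h
    rw [h1] at h2
    exact Subtype.ext (sub_left_injective h2)
  refine (ENNReal.tsum_comp_le_tsum_of_injective hΘ fun _ => 1).trans_eq ?_
  rw [ENNReal.tsum_prod (f := fun _ _ => (1 : ℝ≥0∞)), tsum_fintype, Finset.sum_const,
    Finset.card_univ, Fintype.card_fun, Fintype.card_coe, Int.card_Icc, Fintype.card_fin,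
    nsmul_eq_mul]
  congr 1
  have : ((N : ℤ) + 1 - -(N : ℤ)).toNat = 2 * N + 1 := by omega
  rw [this]
  push_cast
  rfl

/-- If `g • w` is close to the standard tuple, then there are at most `5 ^ k` integer vectors in the
span of `w` that `g` maps into the unit ball. -/
theorem tsum_compl_offSpan_le (hkd : k < d) (g : SLR d) {w : Fin k → Fin d → ℝ}
    (hw : w ∈ primOrbit d k)
    (hg : g • w ∈ Metric.closedBall (stdTuple d k) (1 / (2 * d))) :
    ∑' z : ((offSpan w)ᶜ : Set (Fin d → ℤ)), (Metric.closedBall (0 : Fin d → ℝ) 1).indicator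
      (1 : (Fin d → ℝ) → ℝ≥0∞) (g • castVec z) ≤ 5 ^ k := by
  classical
  have hd : (0 : ℝ) < d := by exact_mod_cast (by omega : 0 < d)
  obtain ⟨m, rfl⟩ := mem_primOrbit_iff.1 hw
  have hrep : ∀ z ∈ (offSpan (toSLR m • stdTuple d k))ᶜ, ∃ r : Fin k → ℤ,
      castVec z = ∑ i, (r i : ℝ) • (toSLR m • stdTuple d k) i := by
    intro z hz
    have h1 : castVec z ∈ Submodule.span ℝ (Set.range (toSLR m • stdTuple d k)) := not_not.1 hz
    obtain ⟨y, rfl⟩ := (mulVecEquiv m).surjective z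
    rw [castVec_mulVecEquiv, smul_mem_span_smul_iff, castVec_mem_span_stdTuple_iff hkd.le] at h1
    refine ⟨fun i => y (Fin.castLE hkd.le i), ?_⟩
    have h2 : castVec y = ∑ i : Fin k, (y (Fin.castLE hkd.le i) : ℝ) • stdTuple d k i := by
      rw [sum_smul_stdTuple]
      funext j
      by_cases hj : (j : ℕ) < k
      · simp [castVec, hj]
      · simp [castVec, hj, h1 j (by omega)]
    rw [castVec_mulVecEquiv, h2, Finset.smul_sum]
    refine Finset.sum_congr rfl fun i _ => ?_
    rw [Pi.smul_apply, smul_comm]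
  choose! r hr using hrep
  have hbound : ∀ z ∈ (offSpan (toSLR m • stdTuple d k))ᶜ, ‖g • castVec z‖ ≤ 1 →
      ∀ i, r z i ∈ Finset.Icc (-2 : ℤ) 2 := by
    intro z hz hz1
    rcases Nat.eq_zero_or_pos k with rfl | hk
    · exact fun i => i.elim0
    have : Nonempty (Fin k) := ⟨⟨0, hk⟩⟩
    obtain ⟨i₀, -, hi₀⟩ := Finset.exists_max_image (Finset.univ : Finset (Fin k))
      (fun i => |(r z i : ℝ)|) Finset.univ_nonempty
    -- the coordinate of `g z` at the largest `r_i` is at least `|r_i| / 2` in absolute value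
    set M := |(r z i₀ : ℝ)| with hM
    have hM2 : M ≤ 2 := by
      have hδ : ∀ i j, |(g • toSLR m • stdTuple d k) i j - stdTuple d k i j| ≤ 1 / (2 * d) := by
        intro i j
        have h1 : ‖g • toSLR m • stdTuple d k - stdTuple d k‖ ≤ 1 / (2 * d) := by
          rwa [← mem_closedBall_iff_norm]
        exact ((norm_le_pi_norm ((g • toSLR m • stdTuple d k - stdTuple d k) i) j).trans
          (norm_le_pi_norm (g • toSLR m • stdTuple d k - stdTuple d k) i)).trans h1
      have hcoord : (g • castVec z) (Fin.castLE hkd.le i₀) = (r z i₀ : ℝ) +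
          ∑ i, (r z i : ℝ) * ((g • toSLR m • stdTuple d k) i (Fin.castLE hkd.le i₀) -
            stdTuple d k i (Fin.castLE hkd.le i₀)) := by
        rw [hr z hz, Finset.smul_sum, Finset.sum_apply]
        simp_rw [mul_sub, Finset.sum_sub_distrib]
        have h2 : ∑ i, (r z i : ℝ) * stdTuple d k i (Fin.castLE hkd.le i₀) = r z i₀ := by
          rw [Finset.sum_eq_single i₀]
          · simp [stdTuple]
          · intro i _ hi
            have : (i₀ : ℕ) ≠ i := fun h => hi (Fin.ext h.symm)
            simp [stdTuple, this]
          · simp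
        rw [h2, add_sub_cancel]
        refine Finset.sum_congr rfl fun i _ => ?_
        rw [← smul_comm]
        rfl
      have h3 : |∑ i, (r z i : ℝ) * ((g • toSLR m • stdTuple d k) i (Fin.castLE hkd.le i₀) -
            stdTuple d k i (Fin.castLE hkd.le i₀))| ≤ M / 2 := by
        refine (Finset.abs_sum_le_sum_abs _ _).trans ?_
        refine (Finset.sum_le_sum fun i _ => (?_ : _ ≤ M * (1 / (2 * d)))).trans ?_
        · rw [abs_mul]
          exact mul_le_mul (hi₀ i (Finset.mem_univ i)) (hδ _ _) (abs_nonneg _) (abs_nonneg _)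
        · rw [Finset.sum_const, Finset.card_univ, Fintype.card_fin, nsmul_eq_mul]
          have hkd' : (k : ℝ) ≤ d := by exact_mod_cast hkd.le
          have : (k : ℝ) * (M * (1 / (2 * d))) = (M / 2) * (k / d) := by field_simp
          rw [this]
          refine mul_le_of_le_one_right (by positivity) ?_
          rwa [div_le_one hd]
      have h4 : |(g • castVec z) (Fin.castLE hkd.le i₀)| ≤ 1 := (norm_le_pi_norm _ _).trans hz1
      rw [hcoord] at h4
      have h5 := abs_sub_abs_le_abs_add (r z i₀ : ℝ)
        (∑ i, (r z i : ℝ) * ((g • toSLR m • stdTuple d k) i (Fin.castLE hkd.le i₀) -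
            stdTuple d k i (Fin.castLE hkd.le i₀)))
      linarith
    intro i
    have h6 : |(r z i : ℝ)| ≤ 2 := (hi₀ i (Finset.mem_univ i)).trans hM2
    have h7 : |r z i| ≤ 2 := by exact_mod_cast h6
    rw [Finset.mem_Icc]
    exact abs_le.1 h7
  set S : Set ((offSpan (toSLR m • stdTuple d k))ᶜ : Set (Fin d → ℤ)) :=
    {z | ‖g • castVec (z : Fin d → ℤ)‖ ≤ 1}
  have h1 : ∀ z : ((offSpan (toSLR m • stdTuple d k))ᶜ : Set (Fin d → ℤ)),
      (Metric.closedBall (0 : Fin d → ℝ) 1).indicator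
      (1 : (Fin d → ℝ) → ℝ≥0∞) (g • castVec z) = S.indicator (fun _ => 1) z := by
    intro z
    by_cases hz : ‖g • castVec (z : Fin d → ℤ)‖ ≤ 1
    · rw [Set.indicator_of_mem (mem_closedBall_zero_iff.2 hz), Set.indicator_of_mem (show z ∈ S from hz)]
      rfl
    · rw [Set.indicator_of_notMem (fun h => hz (mem_closedBall_zero_iff.1 h)),
        Set.indicator_of_notMem (show z ∉ S from hz)]
  simp_rw [h1]
  rw [← tsum_subtype S fun _ => (1 : ℝ≥0∞)]
  let Θ : S → Fin k → Finset.Icc (-2 : ℤ) 2 := fun z i => ⟨r z i, hbound z z.1.2 z.2 i⟩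
  have hΘ : Function.Injective Θ := by
    intro z z' h
    have e : r z = r z' := funext fun i => congrArg Subtype.val (congrFun h i)
    refine Subtype.ext (Subtype.ext (castVec_injective ?_))
    rw [hr _ z.1.2, hr _ z'.1.2, e]
  refine (ENNReal.tsum_comp_le_tsum_of_injective hΘ fun _ => 1).trans_eq ?_
  rw [tsum_fintype, Finset.sum_const, Finset.card_univ, Fintype.card_fun,
    Fintype.card_coe, Int.card_Icc, Fintype.card_fin, nsmul_eq_mul]
  have : ((2 : ℤ) + 1 - -2).toNat = 5 := rfl
  rw [this]
  simp

/-- Domination, uniform in the radius, of the lattice point counts outside the span of `w`. -/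
theorem tsum_offSpan_indicator_le (hkd : k < d) (g : SLR d) {w : Fin k → Fin d → ℝ}
    (hw : w ∈ primOrbit d k)
    (hg : g • w ∈ Metric.closedBall (stdTuple d k) (1 / (2 * d))) {N : ℕ} (hN : 0 < N) :
    ((N : ℝ≥0∞) ^ d)⁻¹ * ∑' z : offSpan w,
      (Metric.closedBall (0 : Fin d → ℝ) N).indicator (1 : (Fin d → ℝ) → ℝ≥0∞) (g • castVec z) ≤
    3 ^ d * (∑' z : offSpan w, (Metric.closedBall (0 : Fin d → ℝ) 1).indicator
      (1 : (Fin d → ℝ) → ℝ≥0∞) (g • castVec z) + 5 ^ k) := by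
  have h1 := ENNReal.tsum_comp_le_tsum_of_injective
    (Subtype.val_injective (p := fun z => z ∈ offSpan w))
    fun z => (Metric.closedBall (0 : Fin d → ℝ) N).indicator (1 : (Fin d → ℝ) → ℝ≥0∞) (g • castVec z)
  have h2 := tsum_indicator_closedBall_le g N
  rw [← ENNReal.summable.tsum_add_tsum_compl (s := offSpan w) ENNReal.summable (f := fun z =>
    (Metric.closedBall (0 : Fin d → ℝ) 1).indicator (1 : (Fin d → ℝ) → ℝ≥0∞) (g • castVec z))] at h2
  have h3 := (h1.trans h2).trans (mul_le_mul' le_rfl (add_le_add le_rfl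
    (tsum_compl_offSpan_le hkd g hw hg)))
  have h4 : (2 * (N : ℝ≥0∞) + 1) ^ d ≤ (N : ℝ≥0∞) ^ d * 3 ^ d := by
    rw [← mul_pow]
    refine pow_le_pow_left' ?_ _
    have : 2 * N + 1 ≤ N * 3 := by omega
    exact_mod_cast this
  have hN0 : (N : ℝ≥0∞) ^ d ≠ 0 := pow_ne_zero _ (by simpa using hN.ne')
  rw [ENNReal.inv_mul_le_iff hN0 (ENNReal.pow_ne_top (ENNReal.natCast_ne_top N)), ← mul_assoc]
  exact h3.trans (mul_le_mul' h4 le_rfl)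

end Count

/-! ### The ratio of consecutive constants -/

section Comparison

open Filter Topology

variable {d k : ℕ}

/-- The constants in the mean value formulas for primitive `k`-tuples and primitive
`(k + 1)`-tuples differ by the factor `ζ(d - k)`: every integer vector outside the span of a
primitive `k`-tuple `w` determines a primitive `(k + 1)`-tuple extending `w`, and the number of such
vectors in a large ball is asymptotic to the volume of the ball. -/
theorem IsTupleMean.eq_zetaVal_mul (hkd : k + 1 < d) {μ : Measure (SLR d)} {W W' : ℝ≥0∞}
    (hW : IsTupleMean μ k W) (hW' : IsTupleMean μ (k + 1) W') (hfin : W' ≠ ∞) :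
    W = ENNReal.ofReal (zetaVal (d - k)) * W' := by
  have hd : (0 : ℝ) < d := by exact_mod_cast (by omega : 0 < d)
  -- `f` is the indicator function of a small ball around the standard tuple; the radius is the one
  -- required for the domination of the lattice point counts
  set B : Set (Fin k → Fin d → ℝ) := Metric.closedBall (stdTuple d k) (1 / (2 * d)) with hB
  have hBm : MeasurableSet B := Metric.isClosed_closedBall.measurableSet
  set b := volume B with hb
  have hb0 : b ≠ 0 := (Metric.measure_closedBall_pos _ _ (by positivity)).ne'
  have hbt : b ≠ ∞ := measure_closedBall_lt_top.ne
  set f : (Fin k → Fin d → ℝ) → ℝ≥0∞ := B.indicator 1 with hf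
  have hfm : Measurable f := measurable_one.indicator hBm
  have hfi : ∫⁻ v, f v = b := lintegral_indicator_one hBm
  let q : ℕ → (Fin d → ℝ) → ℝ≥0∞ := fun n x =>
    (((n + 1 : ℕ) : ℝ≥0∞) ^ d)⁻¹ * (Metric.closedBall (0 : Fin d → ℝ) ((n + 1 : ℕ) : ℝ)).indicator 1 x
  have hind : ∀ r : ℝ, Measurable ((Metric.closedBall (0 : Fin d → ℝ) r).indicator
      (1 : (Fin d → ℝ) → ℝ≥0∞)) := fun r =>
    measurable_one.indicator Metric.isClosed_closedBall.measurableSet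
  have hqm : ∀ n, Measurable (q n) := fun n => (hind _).const_mul _
  have hqi : ∀ n, ∫⁻ x, q n x = 2 ^ d := by
    intro n
    have h0 : ((n + 1 : ℕ) : ℝ≥0∞) ^ d ≠ 0 := pow_ne_zero _ (by simp)
    have ht : ((n + 1 : ℕ) : ℝ≥0∞) ^ d ≠ ∞ := ENNReal.pow_ne_top (ENNReal.natCast_ne_top _)
    simp only [q]
    rw [lintegral_const_mul _ (hind _), lintegral_indicator_one Metric.isClosed_closedBall.measurableSet,
      Real.volume_pi_closedBall _ (by positivity), Fintype.card_fin, mul_pow,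
      ENNReal.ofReal_mul (by positivity), ENNReal.ofReal_pow (by positivity), ENNReal.ofReal_pow (by positivity),
      ENNReal.ofReal_natCast, mul_left_comm, ENNReal.inv_mul_cancel h0 ht]
    simp
  set C := ENNReal.ofReal (zetaVal (d - k)) * W' with hC
  have hCt : C ≠ ∞ := ENNReal.mul_ne_top ENNReal.ofReal_ne_top hfin
  let F : ℕ → SLR d × primOrbit d k → ℝ≥0∞ := fun n p =>
    f (p.1 • (p.2 : Fin k → Fin d → ℝ)) *
      ∑' z : offSpan (p.2 : Fin k → Fin d → ℝ), q n (p.1 • castVec z)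
  let F' : SLR d × primOrbit d k → ℝ≥0∞ := fun p => f (p.1 • (p.2 : Fin k → Fin d → ℝ))
  have hF'm : Measurable F' := measurable_from_prod_countable_left fun w =>
    hfm.comp (measurable_smul_const (w : Fin k → Fin d → ℝ))
  have hFm : ∀ n, Measurable (F n) := by
    refine fun n => measurable_from_prod_countable_left fun w => ?_
    have h1 : Measurable fun g : SLR d => ∑' z : offSpan (w : Fin k → Fin d → ℝ),
        q n (g • castVec z) := by
      have h0 : ∀ z : offSpan (w : Fin k → Fin d → ℝ),
          Measurable fun g : SLR d => q n (g • castVec z) := fun z =>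
        (hqm n).comp (measurable_smul_const (castVec (z : Fin d → ℤ)))
      exact Measurable.tsum h0
    exact (hfm.comp (measurable_smul_const (w : Fin k → Fin d → ℝ))).mul h1
  set m := μ.prod (Measure.count : Measure (primOrbit d k)) with hm
  have hFi : ∀ n, ∫⁻ p, F n p ∂m = C * (b * 2 ^ d) := by
    intro n
    rw [hm, lintegral_prod _ (hFm n).aemeasurable]
    simp_rw [lintegral_count]
    rw [← hqi n, ← hfi]
    exact hW'.lintegral_tsum_offSpan hkd hfm (hqm n)
  have hF'i : ∫⁻ p, F' p ∂m = W * b := by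
    rw [hm, lintegral_prod _ hF'm.aemeasurable]
    simp_rw [lintegral_count]
    rw [← hfi]
    exact hW f hfm
  have hlim : ∀ p, Tendsto (fun n => F n p) atTop (𝓝 (F' p * 2 ^ d)) := by
    rintro ⟨g, w⟩
    refine ENNReal.Tendsto.const_mul ?_ (Or.inl (by simp))
    refine ((tendsto_tsum_offSpan (by omega) g (w : Fin k → Fin d → ℝ)).comp
      (tendsto_add_atTop_nat 1)).congr fun n => ?_
    simp only [Function.comp, q]
    rw [ENNReal.tsum_mul_left]
  have hF'2 : ∫⁻ p, F' p * 2 ^ d ∂m = W * b * 2 ^ d := by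
    rw [lintegral_mul_const _ hF'm, hF'i]
  -- finiteness of `W`, by Fatou's lemma; it makes the dominating function integrable
  have hW_fin : W * b ≠ ∞ := by
    have h1 := lintegral_liminf_le (μ := m) (u := atTop) hFm
    simp_rw [fun p => (hlim p).liminf_eq, hFi, liminf_const] at h1
    rw [hF'2] at h1
    intro h
    rw [h, ENNReal.top_mul (by simp)] at h1
    exact (ENNReal.mul_ne_top hCt (ENNReal.mul_ne_top hbt (by simp))) (top_le_iff.1 h1)
  have hdom : ∀ n p, F n p ≤ 3 ^ d * (F 0 p + F' p * 5 ^ k) := by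
    rintro n ⟨g, w⟩
    by_cases hg : g • (w : Fin k → Fin d → ℝ) ∈ B
    · have h1 := tsum_offSpan_indicator_le (by omega) g w.2 hg n.succ_pos
      simp only [F, F', q]
      rw [hf, Set.indicator_of_mem hg, Pi.one_apply, one_mul, one_mul, one_mul, ENNReal.tsum_mul_left]
      simpa using h1
    · simp only [F, F', hf]
      rw [Set.indicator_of_notMem hg]
      simp
  have hbound : ∫⁻ p, 3 ^ d * (F 0 p + F' p * 5 ^ k) ∂m ≠ ∞ := by
    have h1 : Measurable fun p => F 0 p + F' p * 5 ^ k := (hFm 0).add (hF'm.mul_const _)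
    rw [lintegral_const_mul _ h1, lintegral_add_left (hFm 0), hFi,
      lintegral_mul_const _ hF'm, hF'i]
    refine ENNReal.mul_ne_top (by simp) (ENNReal.add_ne_top.2 ⟨?_, ?_⟩)
    · exact ENNReal.mul_ne_top hCt (ENNReal.mul_ne_top hbt (by simp))
    · exact ENNReal.mul_ne_top hW_fin (by simp)
  have hconv := tendsto_lintegral_of_dominated_convergence (μ := m) _ hFm
    (fun n => Eventually.of_forall (hdom n)) hbound (Eventually.of_forall hlim)
  simp_rw [hFi, hF'2] at hconv
  have heq := tendsto_nhds_unique hconv tendsto_const_nhds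
  rw [← mul_assoc] at heq
  have h2d : (2 : ℝ≥0∞) ^ d ≠ 0 := by simp
  have h2t : (2 : ℝ≥0∞) ^ d ≠ ∞ := by simp
  exact (ENNReal.mul_left_inj hb0 hbt).1 ((ENNReal.mul_left_inj h2d h2t).1 heq)

/-- The constant for `k`-tuples, in terms of that for `(d - 1)`-tuples. -/
theorem IsTupleMean.eq_prod_zetaVal_mul {μ : Measure (SLR d)} {W : ℕ → ℝ≥0∞}
    (hW : ∀ k < d, IsTupleMean μ k (W k)) (hfin : W (d - 1) ≠ ∞) {k : ℕ} (hkd : k < d) :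
    W k = ENNReal.ofReal (∏ j ∈ Finset.Icc 2 (d - k), zetaVal j) * W (d - 1) := by
  obtain ⟨i, hi⟩ : ∃ i, k + i + 1 = d := ⟨d - k - 1, by omega⟩
  induction i generalizing k with
  | zero =>
    have h1 : d - k = 1 := by omega
    have h2 : k = d - 1 := by omega
    rw [h1, h2]
    simp
  | succ i ih =>
    have h1 := ih (k := k + 1) (by omega) (by omega)
    have h2 : W (k + 1) ≠ ∞ := by
      rw [h1]
      exact ENNReal.mul_ne_top ENNReal.ofReal_ne_top hfin
    rw [(hW k hkd).eq_zetaVal_mul (by omega) (hW (k + 1) (by omega)) h2, h1, ← mul_assoc]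
    have h3 : d - k = (d - (k + 1)) + 1 := by omega
    rw [h3, Finset.prod_Icc_succ_top (by omega), mul_comm (∏ j ∈ _, _), ENNReal.ofReal_mul]
    exact (zetaVal_pos (by omega)).le

end Comparison

/-! ### The Iwasawa decomposition -/

section Iwasawa

variable {d : ℕ}

theorem Matrix.IsUpperTriangular.mul_apply_diag {M N : Matrix (Fin d) (Fin d) ℝ}
    (hM : M.IsUpperTriangular) (hN : N.IsUpperTriangular) (i : Fin d) :
    (M * N) i i = M i i * N i i := by
  rw [Matrix.mul_apply, Finset.sum_eq_single i]
  · intro j _ hj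
    rcases lt_or_gt_of_ne hj with h | h
    · rw [hM h, zero_mul]
    · rw [hN h, mul_zero]
  · simp

/-- The group `AN` of upper triangular matrices of determinant one with positive diagonal. -/
def upperTri (d : ℕ) : Subgroup (SLR d) where
  carrier := {g | (g : Matrix (Fin d) (Fin d) ℝ).IsUpperTriangular ∧ ∀ i, 0 < g i i}
  mul_mem' {a b} ha hb := by
    refine ⟨ha.1.mul hb.1, fun i => ?_⟩
    have h := ha.1.mul_apply_diag hb.1 i
    exact (mul_pos (ha.2 i) (hb.2 i)).trans_eq h.symm
  one_mem' := by
    refine ⟨Matrix.blockTriangular_one, fun i => ?_⟩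
    simp
  inv_mem' {g} hg := by
    have h1 : (g⁻¹ : SLR d).1 = (g : Matrix (Fin d) (Fin d) ℝ)⁻¹ := by
      refine (Matrix.inv_eq_right_inv ?_).symm
      have := congrArg Subtype.val (mul_inv_cancel g)
      exact this
    have h2 : ((g⁻¹ : SLR d) : Matrix (Fin d) (Fin d) ℝ).IsUpperTriangular := by
      have : Invertible (g : Matrix (Fin d) (Fin d) ℝ) :=
        Matrix.invertibleOfIsUnitDet _ (by simp)
      change (g⁻¹ : SLR d).1.IsUpperTriangular
      rw [h1]
      exact Matrix.blockTriangular_inv_of_blockTriangular hg.1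
    refine ⟨h2, fun i => ?_⟩
    have h3 := hg.1.mul_apply_diag h2 i
    have h4 : (g : Matrix (Fin d) (Fin d) ℝ) * (g⁻¹ : SLR d) = 1 :=
      congrArg Subtype.val (mul_inv_cancel g)
    rw [h4, Matrix.one_apply_eq] at h3
    exact (pos_iff_pos_of_mul_pos (h3 ▸ one_pos)).1 (hg.2 i)

theorem mem_upperTri {g : SLR d} :
    g ∈ upperTri d ↔ (g : Matrix (Fin d) (Fin d) ℝ).IsUpperTriangular ∧ ∀ i, 0 < g i i := Iff.rfl

theorem prod_diag_of_mem_upperTri {g : SLR d} (hg : (g : Matrix (Fin d) (Fin d) ℝ).IsUpperTriangular) :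
    ∏ i, g i i = 1 := by
  have h := Matrix.det_of_isUpperTriangular hg
  rw [g.2] at h
  exact h.symm

theorem SLR.continuous_apply (i j : Fin d) : Continuous fun g : SLR d => g i j :=
  (continuous_apply_apply (ρ := fun _ _ => ℝ) i j).comp continuous_subtype_val

theorem isClosed_upperTri : IsClosed (upperTri d : Set (SLR d)) := by
  have h : (upperTri d : Set (SLR d)) =
      (⋂ (i : Fin d) (j : Fin d) (_ : j < i), {g : SLR d | g i j = 0}) ∩
        ⋂ i, {g : SLR d | 0 ≤ g i i} := by
    ext g
    simp only [SetLike.mem_coe, mem_upperTri, Set.mem_inter_iff, Set.mem_iInter, Set.mem_ofPred_eq]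
    constructor
    · exact fun h => ⟨fun i j hij => h.1 hij, fun i => (h.2 i).le⟩
    · rintro ⟨h1, h2⟩
      have h3 : (g : Matrix (Fin d) (Fin d) ℝ).IsUpperTriangular := fun i j hij => h1 i j hij
      refine ⟨h3, fun i => lt_of_le_of_ne (h2 i) fun h0 => ?_⟩
      have h4 := prod_diag_of_mem_upperTri h3
      rw [Finset.prod_eq_zero (f := fun i => g i i) (Finset.mem_univ i) h0.symm] at h4
      exact zero_ne_one h4
  rw [h]
  refine IsClosed.inter ?_ (isClosed_iInter fun i =>
    isClosed_le continuous_const (SLR.continuous_apply i i))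
  exact isClosed_iInter fun i => isClosed_iInter fun j => isClosed_iInter fun _ =>
    isClosed_eq (SLR.continuous_apply i j) continuous_const

theorem isClosed_SOd : IsClosed (SOd d : Set (SLR d)) := by
  have h : (SOd d : Set (SLR d)) = {g : SLR d | (g : Matrix (Fin d) (Fin d) ℝ) *
      star (g : Matrix (Fin d) (Fin d) ℝ) = 1} :=
    Set.ext fun g => mem_orthogonalGroup_iff (Fin d) ℝ
  rw [h]
  exact isClosed_eq (continuous_subtype_val.mul continuous_subtype_val.star) continuous_const

theorem transpose_mul_self_of_mem_SOd {k : SLR d} (hk : k ∈ SOd d) :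
    (k : Matrix (Fin d) (Fin d) ℝ)ᵀ * (k : Matrix (Fin d) (Fin d) ℝ) = 1 :=
  (mem_orthogonalGroup_iff' (Fin d) ℝ).1 hk

theorem isCompact_SOd : IsCompact (SOd d : Set (SLR d)) := by
  have h : (SOd d : Set (SLR d)) ⊆ (fun g : SLR d => (g : Matrix (Fin d) (Fin d) ℝ)) ⁻¹'
      (Set.univ.pi fun _ => Set.univ.pi fun _ => Set.Icc (-1 : ℝ) 1) := by
    intro g hg i _ j _
    have h1 := congrFun (congrFun (transpose_mul_self_of_mem_SOd hg) j) j
    rw [Matrix.mul_apply, Matrix.one_apply_eq] at h1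
    simp only [Matrix.transpose_apply] at h1
    have h2 : g i j * g i j ≤ 1 :=
      (Finset.single_le_sum (f := fun i => g i j * g i j)
        (fun i _ => mul_self_nonneg _) (Finset.mem_univ i)).trans_eq h1
    exact abs_le.1 (abs_le_one_iff_mul_self_le_one.2 h2)
  refine IsCompact.of_isClosed_subset ?_ isClosed_SOd h
  exact SLR.isClosedEmbedding_coe.isCompact_preimage
    (isCompact_univ_pi fun _ => isCompact_univ_pi fun _ => isCompact_Icc)

theorem eq_one_of_mem_SOd_of_mem_upperTri {g : SLR d} (h1 : g ∈ SOd d) (h2 : g ∈ upperTri d) :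
    g = 1 := by
  have h3 : ∀ i j, (g⁻¹ : SLR d) i j = g j i := by
    intro i j
    have h4 : ((g⁻¹ : SLR d) : Matrix (Fin d) (Fin d) ℝ) = (g : Matrix (Fin d) (Fin d) ℝ)ᵀ := by
      refine (left_inv_eq_right_inv (transpose_mul_self_of_mem_SOd h1) ?_).symm
      exact congrArg Subtype.val (mul_inv_cancel g)
    exact congrFun (congrFun h4 i) j
  have h5 := inv_mem h2
  have hoff : ∀ i j, i ≠ j → g i j = 0 := by
    intro i j hij
    rcases lt_or_gt_of_ne hij with h | h
    · rw [← h3]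
      exact h5.1 h
    · exact h2.1 h
  have hdiag : ∀ i, g i i = 1 := by
    intro i
    have h6 := congrFun (congrFun (transpose_mul_self_of_mem_SOd h1) i) i
    rw [Matrix.mul_apply, Matrix.one_apply_eq, Finset.sum_eq_single i] at h6
    · simp only [Matrix.transpose_apply] at h6
      have h7 := h2.2 i
      nlinarith
    · intro j _ hj
      simp only [Matrix.transpose_apply]
      rw [hoff j i hj, mul_zero]
    · simp
  refine Subtype.ext ?_
  ext i j
  by_cases hij : i = j
  · subst hij
    rw [hdiag]
    simp
  · rw [hoff i j hij]
    simp [hij]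

/-- The Gram–Schmidt process gives the surjectivity of `K × AN → G`. -/
theorem exists_mul_eq_of_SLR (g : SLR d) : ∃ k ∈ SOd d, ∃ s ∈ upperTri d, k * s = g := by
  classical
  let f : Fin d → EuclideanSpace ℝ (Fin d) := fun j => WithLp.toLp 2 fun i => g i j
  have hfd : Module.finrank ℝ (EuclideanSpace ℝ (Fin d)) = Fintype.card (Fin d) := by simp
  have hli : LinearIndependent ℝ f := by
    have h1 : LinearIndependent ℝ fun j : Fin d => (g : Matrix (Fin d) (Fin d) ℝ).col j :=
      linearIndependent_cols_of_det_ne_zero (by simp)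
    exact h1.map' (WithLp.linearEquiv 2 ℝ (Fin d → ℝ)).symm.toLinearMap (LinearEquiv.ker _)
  let b := InnerProductSpace.gramSchmidtOrthonormalBasis hfd f
  let q : Matrix (Fin d) (Fin d) ℝ := fun i j => b j i
  let r : Matrix (Fin d) (Fin d) ℝ := fun i j => inner ℝ (b i) (f j)
  have hqr : q * r = (g : Matrix (Fin d) (Fin d) ℝ) := by
    ext i j
    have h1 := b.sum_repr' (f j)
    have h2 := congrArg (fun x : EuclideanSpace ℝ (Fin d) => x i) h1
    rw [Matrix.mul_apply]
    refine Eq.trans ?_ h2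
    simp only [WithLp.ofLp_sum, Finset.sum_apply, PiLp.smul_apply, smul_eq_mul]
    exact Finset.sum_congr rfl fun l _ => mul_comm _ _
  have hqq : qᵀ * q = 1 := by
    ext i j
    rw [Matrix.mul_apply]
    have h1 := orthonormal_iff_ite.1 b.orthonormal i j
    rw [PiLp.inner_apply] at h1
    rw [Matrix.one_apply, ← h1]
    refine Finset.sum_congr rfl fun l _ => ?_
    change b i l * b j l = inner ℝ (b i l) (b j l)
    simp [mul_comm]
  have hr1 : r.IsUpperTriangular := fun i j hij =>
    InnerProductSpace.gramSchmidtOrthonormalBasis_inv_triangular hfd f hij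
  have hr2 : ∀ i, 0 < r i i := by
    intro i
    have h0 := InnerProductSpace.gramSchmidt_ne_zero (𝕜 := ℝ) i hli
    have h1 : InnerProductSpace.gramSchmidtNormed ℝ f i ≠ 0 := by
      rw [← norm_ne_zero_iff, InnerProductSpace.gramSchmidtNormed_unit_length i hli]
      exact one_ne_zero
    have h2 : inner ℝ (InnerProductSpace.gramSchmidt ℝ f i) (f i) =
        ‖InnerProductSpace.gramSchmidt ℝ f i‖ ^ 2 := by
      conv_lhs => rw [InnerProductSpace.gramSchmidt_def'' ℝ f i]
      rw [inner_add_right, inner_sum, real_inner_self_eq_norm_sq, Finset.sum_eq_zero, add_zero]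
      intro l hl
      rw [inner_smul_right, InnerProductSpace.gramSchmidt_orthogonal ℝ f (Finset.mem_Iio.1 hl).ne',
        mul_zero]
    change 0 < inner ℝ (b i) (f i)
    rw [InnerProductSpace.gramSchmidtOrthonormalBasis_apply hfd h1,
      InnerProductSpace.gramSchmidtNormed, inner_smul_left, h2]
    have h3 : 0 < ‖InnerProductSpace.gramSchmidt ℝ f i‖ := norm_pos_iff.2 h0
    simp only [RCLike.ofReal_real_eq_id, id, conj_trivial]
    positivity
  have hdr : 0 < r.det := by
    rw [Matrix.det_of_isUpperTriangular hr1]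
    exact Finset.prod_pos fun i _ => hr2 i
  have hdqr : q.det * r.det = 1 := by
    rw [← Matrix.det_mul, hqr]
    exact g.2
  have hdqq : q.det * q.det = 1 := by
    have := congrArg Matrix.det hqq
    rwa [Matrix.det_mul, Matrix.det_transpose, Matrix.det_one] at this
  have hdq : q.det = 1 := by
    have h1 : 0 < q.det := (pos_iff_pos_of_mul_pos (hdqr ▸ one_pos)).2 hdr
    nlinarith
  have hdr1 : r.det = 1 := by rwa [hdq, one_mul] at hdqr
  refine ⟨⟨q, hdq⟩, (mem_orthogonalGroup_iff' (Fin d) ℝ).2 hqq, ⟨r, hdr1⟩, ⟨hr1, hr2⟩, Subtype.ext hqr⟩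

end Iwasawa

/-! ### Haar measure on the group of upper triangular matrices -/

section UpperTri

variable {d : ℕ}

theorem diagEntry_pos (t : Fin (d - 1) → ℝ) (i : Fin d) : 0 < diagEntry t i := by
  unfold diagEntry
  split_ifs <;> positivity

theorem diagEntry_add (t t' : Fin (d - 1) → ℝ) (i : Fin d) :
    diagEntry (t + t') i = diagEntry t i * diagEntry t' i := by
  unfold diagEntry
  split_ifs
  · rw [Pi.add_apply, Real.exp_add]
  · rw [← Real.exp_add]
    congr 1
    simp only [Pi.add_apply, Finset.sum_add_distrib]
    ring

theorem diagEntry_log {x : Fin d → ℝ} (hx : ∀ i, 0 < x i) (h1 : ∏ i, x i = 1) :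
    diagEntry (fun i : Fin (d - 1) => Real.log (x ⟨i, by omega⟩)) = x := by
  cases d with
  | zero => exact funext fun i => i.elim0
  | succ m =>
    funext i
    unfold diagEntry
    split_ifs with h
    · exact Real.exp_log (hx _)
    · have hi : i = Fin.last m := Fin.ext (by simp only [Fin.val_last]; omega)
      rw [Fin.prod_univ_castSucc] at h1
      have h2 : ∑ j : Fin (m + 1 - 1), Real.log (x ⟨j, by omega⟩) =
          Real.log (∏ j : Fin m, x j.castSucc) :=
        (Real.log_prod fun j _ => (hx _).ne').symm
      have h3 : 0 < ∏ j : Fin m, x j.castSucc := Finset.prod_pos fun j _ => hx _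
      rw [h2, Real.exp_neg, Real.exp_log h3, hi]
      field_simp
      linarith

theorem continuous_diagEntry (i : Fin d) : Continuous fun t : Fin (d - 1) → ℝ => diagEntry t i := by
  unfold diagEntry
  split_ifs <;> fun_prop

theorem continuous_diagElt : Continuous (diagElt : (Fin (d - 1) → ℝ) → SLR d) := by
  refine Continuous.subtype_mk (continuous_matrix fun i j => ?_) _
  by_cases h : i = j
  · subst h
    simpa using continuous_diagEntry i
  · simpa [Matrix.diagonal_apply_ne _ h] using continuous_const

theorem continuous_unipElt : Continuous (unipElt : (UpperIndex d → ℝ) → SLR d) := by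
  refine Continuous.subtype_mk (continuous_matrix fun i j => ?_) _
  unfold unipMatrix
  split_ifs <;> fun_prop

theorem unipMatrix_isUpperTriangular (u : UpperIndex d → ℝ) : (unipMatrix u).IsUpperTriangular := by
  intro i j hij
  have hji : j < i := hij
  simp [unipMatrix, hji.not_gt, hji.ne']

theorem unipMatrix_diag (u : UpperIndex d → ℝ) (i : Fin d) : unipMatrix u i i = 1 := by
  simp [unipMatrix]

theorem unipMatrix_upper (u : UpperIndex d → ℝ) (p : UpperIndex d) :
    unipMatrix u p.1.1 p.1.2 = u p := by
  rw [unipMatrix, dif_pos p.2]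

theorem diagElt_mul_unipElt_apply (t : Fin (d - 1) → ℝ) (u : UpperIndex d → ℝ) (i j : Fin d) :
    (diagElt t * unipElt u) i j = diagEntry t i * unipMatrix u i j := by
  change (Matrix.diagonal (diagEntry t) * unipMatrix u) i j = _
  rw [Matrix.diagonal_mul]

theorem diagElt_mul_unipElt_mem (t : Fin (d - 1) → ℝ) (u : UpperIndex d → ℝ) :
    diagElt t * unipElt u ∈ upperTri d := by
  refine ⟨fun i j hij => ?_, fun i => ?_⟩
  · rw [diagElt_mul_unipElt_apply, unipMatrix_isUpperTriangular u hij, mul_zero]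
  · rw [diagElt_mul_unipElt_apply, unipMatrix_diag, mul_one]
    exact diagEntry_pos t i

/-- The parametrization `(t, u) ↦ a n` of the group `AN`. -/
def anElt (p : (Fin (d - 1) → ℝ) × (UpperIndex d → ℝ)) : upperTri d :=
  ⟨diagElt p.1 * unipElt p.2, diagElt_mul_unipElt_mem p.1 p.2⟩

theorem anElt_apply (p : (Fin (d - 1) → ℝ) × (UpperIndex d → ℝ)) (i j : Fin d) :
    (anElt p : SLR d) i j = diagEntry p.1 i * unipMatrix p.2 i j :=
  diagElt_mul_unipElt_apply p.1 p.2 i j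

theorem continuous_anElt : Continuous (anElt (d := d)) :=
  ((continuous_diagElt.comp continuous_fst).mul (continuous_unipElt.comp continuous_snd)).subtype_mk _

/-- The coordinates `(t, u)` of an element of `AN`. -/
def anCoord (s : upperTri d) : (Fin (d - 1) → ℝ) × (UpperIndex d → ℝ) :=
  (fun i => Real.log ((s : SLR d) ⟨i, by omega⟩ ⟨i, by omega⟩),
    fun p => (s : SLR d) p.1.1 p.1.2 / (s : SLR d) p.1.1 p.1.1)

theorem continuous_anCoord : Continuous (anCoord (d := d)) := by
  have h : ∀ i j, Continuous fun s : upperTri d => (s : SLR d) i j := fun i j =>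
    (SLR.continuous_apply i j).comp continuous_subtype_val
  refine Continuous.prodMk (continuous_pi fun i => ?_) (continuous_pi fun p => ?_)
  · exact (h _ _).log fun s => (s.2.2 _).ne'
  · exact (h _ _).div (h _ _) fun s => (s.2.2 _).ne'

theorem diagEntry_anCoord (s : upperTri d) :
    diagEntry (anCoord s).1 = fun i => (s : SLR d) i i :=
  diagEntry_log s.2.2 (prod_diag_of_mem_upperTri s.2.1)

theorem anCoord_anElt (p : (Fin (d - 1) → ℝ) × (UpperIndex d → ℝ)) : anCoord (anElt p) = p := by
  refine Prod.ext (funext fun i => ?_) (funext fun q => ?_)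
  · simp only [anCoord]
    rw [anElt_apply, unipMatrix_diag, mul_one, diagEntry, dif_pos i.2, Real.log_exp]
  · simp only [anCoord]
    rw [anElt_apply, anElt_apply, unipMatrix_diag, mul_one, unipMatrix_upper,
      mul_div_cancel_left₀ _ (diagEntry_pos _ _).ne']

theorem rhoWeight_pos (t : Fin (d - 1) → ℝ) : 0 < rhoWeight t :=
  Finset.prod_pos fun _ _ => div_pos (diagEntry_pos _ _) (diagEntry_pos _ _)

theorem rhoWeight_add (t t' : Fin (d - 1) → ℝ) :
    rhoWeight (t + t') = rhoWeight t * rhoWeight t' := by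
  rw [rhoWeight, rhoWeight, rhoWeight, ← Finset.prod_mul_distrib]
  refine Finset.prod_congr rfl fun p _ => ?_
  rw [diagEntry_add, diagEntry_add, mul_div_mul_comm]

theorem continuous_rhoWeight : Continuous (rhoWeight (d := d)) :=
  continuous_finsetProd _ fun _ _ =>
    (continuous_diagEntry _).div (continuous_diagEntry _) fun t => (diagEntry_pos t _).ne'

/-- The measure `ρ(a) da` in logarithmic coordinates. -/
def rhoMeasure (d : ℕ) : Measure (Fin (d - 1) → ℝ) :=
  (volume : Measure (Fin (d - 1) → ℝ)).withDensity fun t => ENNReal.ofReal (rhoWeight t)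

instance : SFinite (rhoMeasure d) := by
  unfold rhoMeasure
  infer_instance

theorem measurable_ofReal_rhoWeight :
    Measurable fun t : Fin (d - 1) → ℝ => ENNReal.ofReal (rhoWeight t) :=
  continuous_rhoWeight.measurable.ennreal_ofReal

theorem map_add_rhoMeasure (t' : Fin (d - 1) → ℝ) :
    (rhoMeasure d).map (· + t') = ENNReal.ofReal (rhoWeight t')⁻¹ • rhoMeasure d := by
  refine Measure.ext_of_lintegral _ fun f hf => ?_
  have hm : Measurable fun t : Fin (d - 1) → ℝ => f (t + t') := hf.comp (measurable_add_const t')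
  have hm' : Measurable fun t : Fin (d - 1) → ℝ => ENNReal.ofReal (rhoWeight t) * f t :=
    measurable_ofReal_rhoWeight.mul hf
  have h1 : ∫⁻ t, f (t + t') ∂rhoMeasure d =
      ∫⁻ t : Fin (d - 1) → ℝ, ENNReal.ofReal (rhoWeight t) * f (t + t') :=
    lintegral_withDensity_eq_lintegral_mul _ measurable_ofReal_rhoWeight hm
  have h2 : ∫⁻ t, f t ∂rhoMeasure d = ∫⁻ t : Fin (d - 1) → ℝ, ENNReal.ofReal (rhoWeight t) * f t :=
    lintegral_withDensity_eq_lintegral_mul _ measurable_ofReal_rhoWeight hf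
  have h3 := lintegral_const_mul (μ := (volume : Measure (Fin (d - 1) → ℝ)))
    (ENNReal.ofReal (rhoWeight t')⁻¹) hm'
  rw [lintegral_map hf (measurable_add_const t'), lintegral_smul_measure, h1, h2, smul_eq_mul, ← h3,
    ← lintegral_add_right_eq_self (fun t => ENNReal.ofReal (rhoWeight t')⁻¹ *
      (ENNReal.ofReal (rhoWeight t) * f t)) t']
  refine lintegral_congr fun t => ?_
  rw [rhoWeight_add, ← mul_assoc, ← ENNReal.ofReal_mul (inv_nonneg.2 (rhoWeight_pos t').le)]
  congr 2
  have := (rhoWeight_pos t').ne'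
  field_simp

/-- The linear part of right multiplication by `s ∈ AN` on the coordinates of `N`. -/
def rightMulMatrix (s : upperTri d) : Matrix (UpperIndex d) (UpperIndex d) ℝ := fun p q =>
  if q.1.1 = p.1.1 then (s : SLR d) q.1.2 p.1.2 / (s : SLR d) p.1.1 p.1.1 else 0

/-- The matrix is triangular when the positions are ordered by their columns, with diagonal entries
`s_jj / s_ii`. -/
theorem det_rightMulMatrix (s : upperTri d) :
    (rightMulMatrix s).det = (rhoWeight (anCoord s).1)⁻¹ := by
  have hM : (rightMulMatrix s).BlockTriangular fun p : UpperIndex d =>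
      OrderDual.toDual p.1.2 := by
    intro p q hpq
    have h : p.1.2 < q.1.2 := hpq
    simp only [rightMulMatrix]
    split_ifs with h1
    · rw [s.2.1 h, zero_div]
    · rfl
  rw [hM.det_fintype]
  have hblock : ∀ a : (Fin d)ᵒᵈ, ((rightMulMatrix s).toSquareBlock
      (fun p : UpperIndex d => OrderDual.toDual p.1.2) a).det =
      ∏ p : {p : UpperIndex d // OrderDual.toDual p.1.2 = a},
        (s : SLR d) p.1.1.2 p.1.1.2 / (s : SLR d) p.1.1.1 p.1.1.1 := by
    intro a
    rw [← Matrix.det_diagonal]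
    congr 1
    ext p q
    have h2 : p.1.1.2 = q.1.1.2 := OrderDual.toDual.injective (p.2.trans q.2.symm)
    rw [Matrix.toSquareBlock_def, Matrix.of_apply, rightMulMatrix]
    by_cases hpq : p = q
    · subst hpq
      rw [Matrix.diagonal_apply_eq, if_pos rfl]
    · rw [Matrix.diagonal_apply_ne _ hpq, if_neg]
      intro h
      exact hpq (Subtype.ext (Subtype.ext (Prod.ext h.symm h2)))
  simp_rw [hblock]
  rw [Fintype.prod_fiberwise (fun p : UpperIndex d => OrderDual.toDual p.1.2)
    fun p : UpperIndex d => (s : SLR d) p.1.2 p.1.2 / (s : SLR d) p.1.1 p.1.1, rhoWeight,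
    ← Finset.prod_inv_distrib, diagEntry_anCoord]
  exact Finset.prod_congr rfl fun p _ => (inv_div _ _).symm

/-- The entries above the diagonal of the product of a unipotent matrix with `s ∈ AN`. -/
theorem sum_unipMatrix_mul (u : UpperIndex d → ℝ) (s : upperTri d) (p : UpperIndex d) :
    ∑ l, unipMatrix u p.1.1 l * (s : SLR d) l p.1.2 =
      (s : SLR d) p.1.1 p.1.1 *
        (Matrix.toLin' (rightMulMatrix s) u p + (s : SLR d) p.1.1 p.1.2 / (s : SLR d) p.1.1 p.1.1) := by
  have h0 := (s.2.2 p.1.1).ne'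
  have h1 : (s : SLR d) p.1.1 p.1.1 * Matrix.toLin' (rightMulMatrix s) u p =
      ∑ q : UpperIndex d, if q.1.1 = p.1.1 then
        unipMatrix u q.1.1 q.1.2 * (s : SLR d) q.1.2 p.1.2 else 0 := by
    rw [Matrix.toLin'_apply, Matrix.mulVec, dotProduct, Finset.mul_sum]
    refine Finset.sum_congr rfl fun q _ => ?_
    rw [rightMulMatrix, unipMatrix_upper]
    split_ifs
    · field_simp
    · simp
  rw [mul_add, mul_div_cancel₀ _ h0, h1,
    ← Finset.sum_subtype (Finset.univ.filter fun x : Fin d × Fin d => x.1 < x.2) (by simp)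
      (fun x : Fin d × Fin d => if x.1 = p.1.1 then
        unipMatrix u x.1 x.2 * (s : SLR d) x.2 p.1.2 else 0), Finset.sum_filter,
    Fintype.sum_prod_type]
  have h3 : (∑ i : Fin d, ∑ l : Fin d, if i < l then
      if i = p.1.1 then unipMatrix u i l * (s : SLR d) l p.1.2 else 0 else 0) =
      ∑ l : Fin d, if p.1.1 < l then unipMatrix u p.1.1 l * (s : SLR d) l p.1.2 else 0 := by
    rw [Finset.sum_eq_single p.1.1]
    · simp
    · intro i _ hi
      refine Finset.sum_eq_zero fun l _ => ?_
      simp [hi]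
    · simp
  rw [h3]
  have h2 : ∀ l, unipMatrix u p.1.1 l * (s : SLR d) l p.1.2 =
      (if p.1.1 < l then unipMatrix u p.1.1 l * (s : SLR d) l p.1.2 else 0) +
        if l = p.1.1 then (s : SLR d) l p.1.2 else 0 := by
    intro l
    rcases lt_trichotomy p.1.1 l with h | h | h
    · rw [if_pos h, if_neg h.ne', add_zero]
    · rw [← h, if_neg (lt_irrefl _), if_pos rfl, unipMatrix_diag, one_mul, zero_add]
    · rw [if_neg h.not_gt, if_neg h.ne, unipMatrix_isUpperTriangular u h, zero_mul, add_zero]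
  rw [Finset.sum_congr rfl fun l _ => h2 l, Finset.sum_add_distrib]
  simp

/-- Right multiplication by `s ∈ AN` in coordinates. -/
theorem anElt_mul (p : (Fin (d - 1) → ℝ) × (UpperIndex d → ℝ)) (s : upperTri d) :
    anElt p * s = anElt (p.1 + (anCoord s).1,
      Matrix.toLin' (rightMulMatrix s) p.2 + (anCoord s).2) := by
  refine Subtype.ext (Subtype.ext ?_)
  ext i j
  have hL : ((anElt p * s : upperTri d) : SLR d) i j =
      diagEntry p.1 i * ∑ l, unipMatrix p.2 i l * (s : SLR d) l j := by
    have h1 : ((anElt p * s : upperTri d) : SLR d) i j =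
        ∑ l, (anElt p : SLR d) i l * (s : SLR d) l j := by
      change (((anElt p : SLR d) : Matrix (Fin d) (Fin d) ℝ) *
        ((s : SLR d) : Matrix (Fin d) (Fin d) ℝ)) i j = _
      rw [Matrix.mul_apply]
    rw [h1, Finset.mul_sum]
    refine Finset.sum_congr rfl fun l _ => ?_
    rw [anElt_apply, mul_assoc]
  rcases lt_trichotomy i j with h | h | h
  · refine hL.trans ?_
    have h2 := sum_unipMatrix_mul p.2 s ⟨(i, j), h⟩
    simp only at h2
    rw [h2]
    refine Eq.trans ?_ (anElt_apply _ i j).symm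
    rw [diagEntry_add, diagEntry_anCoord, unipMatrix, dif_pos h, mul_assoc]
    rfl
  · subst h
    refine ((anElt p).2.1.mul_apply_diag s.2.1 i).trans ?_
    refine Eq.trans ?_ (anElt_apply _ i i).symm
    rw [diagEntry_add, diagEntry_anCoord, unipMatrix_diag, mul_one, anElt_apply, unipMatrix_diag,
      mul_one]
  · exact ((anElt p * s).2.1 h).trans ((anElt _).2.1 h).symm

/-- The right Haar measure `ρ(a) da dn` on `AN`. -/
def anMeasure (d : ℕ) : Measure (upperTri d) :=
  Measure.map anElt ((rhoMeasure d).prod (volume : Measure (UpperIndex d → ℝ)))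

theorem measurable_anElt : Measurable (anElt (d := d)) := continuous_anElt.measurable

/-- Right multiplication by `s = a n` multiplies `dn` by `ρ(a)` and `ρ(a) da` by `ρ(a)⁻¹`. -/
instance : (anMeasure d).IsMulRightInvariant := by
  refine ⟨fun s => ?_⟩
  have hdet : (rightMulMatrix s).det ≠ 0 := by
    rw [det_rightMulMatrix]
    exact inv_ne_zero (rhoWeight_pos _).ne'
  set A : (UpperIndex d → ℝ) → UpperIndex d → ℝ := fun u =>
    Matrix.toLin' (rightMulMatrix s) u + (anCoord s).2 with hA
  have hAm : Measurable A :=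
    ((Matrix.toLin' (rightMulMatrix s)).continuous_of_finiteDimensional.measurable).add_const _
  have h1 : (volume : Measure (UpperIndex d → ℝ)).map A =
      ENNReal.ofReal (rhoWeight (anCoord s).1) • volume := by
    have h2 : A = (· + (anCoord s).2) ∘ Matrix.toLin' (rightMulMatrix s) := rfl
    rw [h2, ← Measure.map_map (measurable_add_const _)
      (Matrix.toLin' (rightMulMatrix s)).continuous_of_finiteDimensional.measurable,
      Real.map_matrix_volume_pi_eq_smul_volume_pi hdet, Measure.map_smul, map_add_right_eq_self,
      det_rightMulMatrix, inv_inv, abs_of_pos (rhoWeight_pos _)]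
  have h3 : (fun x : upperTri d => x * s) ∘ anElt =
      anElt ∘ Prod.map (· + (anCoord s).1) A := funext fun p => anElt_mul p s
  rw [anMeasure, Measure.map_map (measurable_mul_const s) measurable_anElt, h3,
    ← Measure.map_map measurable_anElt ((measurable_add_const _).prodMap hAm),
    ← Measure.map_prod_map _ _ (measurable_add_const _) hAm, h1, map_add_rhoMeasure,
    Measure.prod_smul_left, Measure.prod_smul_right, smul_smul,
    ← ENNReal.ofReal_mul (inv_nonneg.2 (rhoWeight_pos _).le), inv_mul_cancel₀ (rhoWeight_pos _).ne']
  simp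

instance : LocallyCompactSpace (upperTri d) :=
  isClosed_upperTri.isClosedEmbedding_subtypeVal.locallyCompactSpace

instance : SecondCountableTopology (upperTri d) :=
  TopologicalSpace.Subtype.secondCountableTopology (upperTri d : Set (SLR d))

instance : IsFiniteMeasureOnCompacts (anMeasure d) := by
  refine ⟨fun C hC => ?_⟩
  have h1 : anElt ⁻¹' C ⊆ anCoord '' C := fun p hp => ⟨anElt p, hp, anCoord_anElt p⟩
  have hC' : IsCompact (anCoord '' C) := hC.image continuous_anCoord
  have : IsLocallyFiniteMeasure (rhoMeasure d) :=
    IsLocallyFiniteMeasure.withDensity_ofReal continuous_rhoWeight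
  rw [anMeasure, Measure.map_apply measurable_anElt hC.isClosed.measurableSet]
  exact (measure_mono h1).trans_lt hC'.measure_lt_top

theorem anMeasure_ne_zero : anMeasure d ≠ 0 := by
  rw [anMeasure, Ne, Measure.map_eq_zero_iff measurable_anElt.aemeasurable,
    ← Measure.measure_univ_eq_zero, ← Set.univ_prod_univ, Measure.prod_prod, mul_eq_zero,
    Measure.measure_univ_eq_zero, Measure.measure_univ_eq_zero, not_or]
  refine ⟨fun h => ?_, NeZero.ne _⟩
  rw [rhoMeasure, withDensity_eq_zero_iff measurable_ofReal_rhoWeight.aemeasurable] at h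
  obtain ⟨t, ht⟩ := h.exists
  exact (ENNReal.ofReal_pos.2 (rhoWeight_pos t)).ne' ht

instance : (anMeasure d).inv.IsHaarMeasure := by
  have : IsFiniteMeasureOnCompacts (anMeasure d).inv := by
    refine ⟨fun C hC => ?_⟩
    rw [Measure.inv_apply]
    exact hC.inv.measure_lt_top
  have key := Measure.isMulLeftInvariant_eq_smul (anMeasure d).inv (Measure.haar : Measure (upperTri d))
  set c := (anMeasure d).inv.haarScalarFactor (Measure.haar : Measure (upperTri d))
  have hc : c ≠ 0 := by
    intro hc
    rw [hc, zero_smul] at key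
    refine anMeasure_ne_zero (d := d) ?_
    rw [← Measure.inv_inv (anMeasure d), key]
    simp [Measure.inv]
  rw [key]
  exact Measure.IsHaarMeasure.nnreal_smul _ hc

end UpperTri

/-! ### The Haar measure in Iwasawa coordinates -/

section IwasawaHaar

variable {d : ℕ}

/-- The action of `K × AN` on `G` by `(k, s) • g = k g s⁻¹`. -/
instance iwasawaAction (d : ℕ) : MulAction (SOd d × upperTri d) (SLR d) where
  smul m g := m.1 * g * (m.2 : SLR d)⁻¹
  one_smul g := by
    change ((1 : SOd d) : SLR d) * g * ((1 : upperTri d) : SLR d)⁻¹ = g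
    simp
  mul_smul m n g := by
    change ((m.1 * n.1 : SOd d) : SLR d) * g * ((m.2 * n.2 : upperTri d) : SLR d)⁻¹ =
      m.1 * (n.1 * g * (n.2 : SLR d)⁻¹) * (m.2 : SLR d)⁻¹
    simp [mul_assoc]

theorem iwasawaAction_smul_def (m : SOd d × upperTri d) (g : SLR d) :
    m • g = (m.1 : SLR d) * g * (m.2 : SLR d)⁻¹ := rfl

instance : LocallyCompactSpace (SOd d) :=
  isClosed_SOd.isClosedEmbedding_subtypeVal.locallyCompactSpace

instance : CompactSpace (SOd d) := isCompact_iff_compactSpace.1 isCompact_SOd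

instance : SecondCountableTopology (SOd d) :=
  TopologicalSpace.Subtype.secondCountableTopology (SOd d : Set (SLR d))

instance : PolishSpace (SOd d) := isClosed_SOd.polishSpace

instance : PolishSpace (upperTri d) := isClosed_upperTri.polishSpace

/-- The measure `ρ(a) dk da dn` as an iterated integral. -/
theorem lintegral_iwasawaMeasure (κ : Measure (SOd d)) [SFinite κ] {f : SLR d → ℝ≥0∞}
    (hf : Measurable f) :
    ∫⁻ g, f g ∂(iwasawaMeasure κ) = ∫⁻ k : SOd d, ∫⁻ t, (∫⁻ u : UpperIndex d → ℝ,
      f (k * diagElt t * unipElt u)) ∂(rhoMeasure d) ∂κ := by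
  have hm : Measurable fun p : SOd d × (Fin (d - 1) → ℝ) × (UpperIndex d → ℝ) =>
      (p.1 : SLR d) * diagElt p.2.1 * unipElt p.2.2 := by
    refine Continuous.measurable ?_
    exact ((continuous_subtype_val.comp continuous_fst).mul
      (continuous_diagElt.comp (continuous_fst.comp continuous_snd))).mul
      (continuous_unipElt.comp (continuous_snd.comp continuous_snd))
  have hfm : Measurable fun p : SOd d × (Fin (d - 1) → ℝ) × (UpperIndex d → ℝ) =>
      f ((p.1 : SLR d) * diagElt p.2.1 * unipElt p.2.2) := hf.comp hm
  change ∫⁻ g, f g ∂(Measure.map _ (κ.prod ((rhoMeasure d).prod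
    (volume : Measure (UpperIndex d → ℝ))))) = _
  rw [lintegral_map hf hm, lintegral_prod _ hfm.aemeasurable]
  refine lintegral_congr fun k => ?_
  have h2 : Measurable fun p : (Fin (d - 1) → ℝ) × (UpperIndex d → ℝ) =>
      f ((k : SLR d) * diagElt p.1 * unipElt p.2) := by
    refine hf.comp (Continuous.measurable ?_)
    exact (continuous_const.mul (continuous_diagElt.comp continuous_fst)).mul
      (continuous_unipElt.comp continuous_snd)
  exact lintegral_prod _ h2.aemeasurable

theorem lintegral_iwasawaMeasure_eq_anMeasure (κ : Measure (SOd d)) [SFinite κ]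
    {f : SLR d → ℝ≥0∞} (hf : Measurable f) :
    ∫⁻ g, f g ∂(iwasawaMeasure κ) = ∫⁻ k : SOd d, ∫⁻ s : upperTri d, f (k * s) ∂(anMeasure d) ∂κ := by
  rw [lintegral_iwasawaMeasure κ hf]
  refine lintegral_congr fun k => ?_
  have h1 : Measurable fun s : upperTri d => f (k * s) :=
    hf.comp ((measurable_const_mul _).comp measurable_subtype_coe)
  have h2 : Measurable fun p : (Fin (d - 1) → ℝ) × (UpperIndex d → ℝ) =>
      f (k * (anElt p : SLR d)) := h1.comp measurable_anElt
  rw [anMeasure, lintegral_map h1 measurable_anElt, lintegral_prod _ h2.aemeasurable]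
  refine lintegral_congr fun t => lintegral_congr fun u => ?_
  rw [mul_assoc]
  rfl

/-- A Haar measure on `G` is a multiple of the measure `ρ(a) dk da dn`: since `(k, s) ↦ k s⁻¹` is a
bijection from `K × AN` to `G` and `G` is unimodular, Haar measure of `G` pulls back to a Haar
measure of `K × AN`. -/
theorem exists_smul_iwasawaMeasure_eq (hd : 2 ≤ d) (ν : Measure (SLR d)) [ν.IsHaarMeasure]
    (κ : Measure (SOd d)) [κ.IsHaarMeasure] :
    ∃ c : ℝ≥0∞, c ≠ 0 ∧ c ≠ ∞ ∧ ν = c • iwasawaMeasure κ := by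
  have := SLR.isMulRightInvariant hd ν
  have hact : ∀ m : SOd d × upperTri d, Measurable fun g : SLR d => m • g := fun m =>
    (measurable_const_mul _).mul_const _
  have : MeasurableConstSMul (SOd d × upperTri d) (SLR d) := ⟨hact⟩
  have : SMulInvariantMeasure (SOd d × upperTri d) (SLR d) ν := by
    refine ⟨fun m s hs => ?_⟩
    have h1 : (fun g : SLR d => m • g) = (· * (m.2 : SLR d)⁻¹) ∘ ((m.1 : SLR d) * ·) := rfl
    rw [← Measure.map_apply (hact m) hs, h1,
      ← Measure.map_map (measurable_mul_const _) (measurable_const_mul _), map_mul_left_eq_self,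
      map_mul_right_eq_self]
  -- Weil's formula for the action of `K × AN` on `G`, which is simply transitive
  have hH : ∀ m : SOd d × upperTri d, m ∈ (⊥ : Subgroup (SOd d × upperTri d)) ↔
      m • (1 : SLR d) = 1 := by
    intro m
    rw [Subgroup.mem_bot, iwasawaAction_smul_def, mul_one]
    constructor
    · rintro rfl
      simp
    · intro h
      have h1 : (m.1 : SLR d) = m.2 := mul_inv_eq_one.1 h
      have h2 : (m.1 : SLR d) = 1 :=
        eq_one_of_mem_SOd_of_mem_upperTri m.1.2 (h1 ▸ m.2.2)
      exact Prod.ext (Subtype.ext h2) (Subtype.ext (h1 ▸ h2))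
  have hsurj : Function.Surjective fun m : SOd d × upperTri d => m • (1 : SLR d) := by
    intro g
    obtain ⟨k, hk, s, hs, rfl⟩ := exists_mul_eq_of_SLR g
    refine ⟨(⟨k, hk⟩, ⟨s, hs⟩⁻¹), ?_⟩
    simp [iwasawaAction_smul_def]
  have hdisc : DiscreteTopology (⊥ : Subgroup (SOd d × upperTri d)) := inferInstance
  have hbot : IsClosed ((⊥ : Subgroup (SOd d × upperTri d)) : Set (SOd d × upperTri d)) := by
    rw [Subgroup.coe_bot]
    exact isClosed_singleton
  have : LocallyCompactSpace (⊥ : Subgroup (SOd d × upperTri d)) :=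
    hbot.isClosedEmbedding_subtypeVal.locallyCompactSpace
  set ρ : Measure (⊥ : Subgroup (SOd d × upperTri d)) := Measure.haar
  set c' := ρ Set.univ
  have hc'0 : c' ≠ 0 := (Measure.measure_univ_ne_zero).2 (NeZero.ne ρ)
  have hc't : c' ≠ ∞ := (measure_lt_top ρ _).ne
  have hfib : ∀ (φ : SOd d × upperTri d → ℝ≥0∞) (m : SOd d × upperTri d),
      orbitFibre (1 : SLR d) ρ φ (m • (1 : SLR d)) = φ m * c' := by
    intro φ m
    rw [orbitFibre_smul hH, lintegral_unique]
    have : ((default : (⊥ : Subgroup (SOd d × upperTri d))) : SOd d × upperTri d) = 1 := rfl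
    rw [this, mul_one]
  obtain ⟨c, hc0, hct, hc⟩ := exists_lintegral_orbitFibre_eq hH hbot (κ.prod (anMeasure d).inv) ρ ν
    (fun φ hφ => by
      have h1 : Measurable fun m : SOd d × upperTri d => m • (1 : SLR d) := by
        refine Continuous.measurable ?_
        exact (((continuous_subtype_val.comp continuous_fst).mul continuous_const).mul
          (continuous_subtype_val.comp continuous_snd).inv)
      refine (h1.measurable_comp_iff_of_surjective hsurj).1 ?_
      have h2 : orbitFibre (1 : SLR d) ρ φ ∘ (fun m : SOd d × upperTri d => m • (1 : SLR d)) =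
          fun m => φ m * c' := funext (hfib φ)
      rw [h2]
      exact hφ.mul_const _)
    (Filter.Eventually.of_forall fun g => hsurj g)
    (fun C hC => by
      refine (hC.image ?_).measure_lt_top.ne
      exact (((continuous_subtype_val.comp continuous_fst).mul continuous_const).mul
          (continuous_subtype_val.comp continuous_snd).inv))
    (NeZero.ne ν)
  refine ⟨c'⁻¹ * c, mul_ne_zero (ENNReal.inv_ne_zero.2 hc't) hc0,
    ENNReal.mul_ne_top (ENNReal.inv_ne_top.2 hc'0) hct, ?_⟩
  refine Measure.ext_of_lintegral _ fun f hf => ?_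
  have hφm : Measurable fun m : SOd d × upperTri d => f (m • (1 : SLR d)) := by
    refine hf.comp (Continuous.measurable ?_)
    exact (((continuous_subtype_val.comp continuous_fst).mul continuous_const).mul
          (continuous_subtype_val.comp continuous_snd).inv)
  have h1 := hc _ hφm
  have h2 : ∀ g : SLR d, orbitFibre (1 : SLR d) ρ (fun m : SOd d × upperTri d =>
      f (m • (1 : SLR d))) g = f g * c' := by
    intro g
    obtain ⟨m, rfl⟩ := hsurj g
    exact hfib _ m
  simp_rw [h2] at h1
  rw [lintegral_mul_const _ hf, lintegral_prod _ hφm.aemeasurable] at h1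
  have h3 : ∀ k : SOd d, ∫⁻ s : upperTri d, f ((k, s) • (1 : SLR d)) ∂(anMeasure d).inv =
      ∫⁻ s : upperTri d, f (k * s) ∂(anMeasure d) := by
    intro k
    have h4 : Measurable fun s : upperTri d => f ((k, s) • (1 : SLR d)) :=
      hφm.comp measurable_prodMk_left
    rw [Measure.inv, lintegral_map h4 measurable_inv]
    refine lintegral_congr fun s => ?_
    simp [iwasawaAction_smul_def]
  simp_rw [h3] at h1
  rw [← lintegral_iwasawaMeasure_eq_anMeasure κ hf] at h1
  rw [lintegral_smul_measure, smul_eq_mul, mul_assoc, ← h1, mul_comm _ c', ← mul_assoc,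
    ENNReal.inv_mul_cancel hc'0 hc't, one_mul]

theorem isHaarMeasure_iwasawaMeasure (hd : 2 ≤ d) (κ : Measure (SOd d)) [κ.IsHaarMeasure] :
    (iwasawaMeasure κ).IsHaarMeasure := by
  obtain ⟨c, hc0, hct, h⟩ := exists_smul_iwasawaMeasure_eq hd Measure.haar κ
  have h1 : iwasawaMeasure κ = c⁻¹ • (Measure.haar : Measure (SLR d)) := by
    rw [h, smul_smul, ENNReal.inv_mul_cancel hc0 hct, one_smul]
  rw [h1]
  exact Measure.IsHaarMeasure.smul _ (ENNReal.inv_ne_zero.2 hct) (ENNReal.inv_ne_top.2 hc0)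

end IwasawaHaar

/-! ### Gaussian integrals -/

section Gaussian

open Real

theorem lintegral_pi_prod_ofReal {ι E : Type*} [Fintype ι] [MeasureSpace E]
    [SigmaFinite (volume : Measure E)] {f : ι → E → ℝ}
    (hf : ∀ i, Integrable (f i)) (h0 : ∀ i x, 0 ≤ f i x) :
    ∫⁻ x : ι → E, ENNReal.ofReal (∏ i, f i (x i)) = ∏ i, ∫⁻ x, ENNReal.ofReal (f i x) := by
  have h1 : Integrable fun x : ι → E => ∏ i, f i (x i) := Integrable.fintype_prod hf
  rw [← ofReal_integral_eq_lintegral_ofReal h1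
    (Filter.Eventually.of_forall fun x => Finset.prod_nonneg fun i _ => h0 i (x i)),
    integral_fintype_prod_volume_eq_prod,
    ENNReal.ofReal_prod_of_nonneg fun i _ => integral_nonneg (h0 i)]
  exact Finset.prod_congr rfl fun i _ =>
    ofReal_integral_eq_lintegral_ofReal (hf i) (Filter.Eventually.of_forall (h0 i))

theorem integrable_exp_neg_sq_mul {a : ℝ} (ha : 0 < a) :
    Integrable fun x : ℝ => exp (-(a * x) ^ 2) := by
  have h := integrable_exp_neg_mul_sq (b := a ^ 2) (by positivity)
  refine h.congr (Filter.Eventually.of_forall fun x => ?_)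
  simp only
  congr 1
  ring

theorem lintegral_exp_neg_sq_mul {a : ℝ} (ha : 0 < a) :
    ∫⁻ x : ℝ, ENNReal.ofReal (exp (-(a * x) ^ 2)) = ENNReal.ofReal (√π / a) := by
  rw [← ofReal_integral_eq_lintegral_ofReal (integrable_exp_neg_sq_mul ha)
    (Filter.Eventually.of_forall fun x => (exp_pos _).le)]
  congr 1
  have h := integral_gaussian (a ^ 2)
  rw [sqrt_div pi_pos.le, sqrt_sq ha.le] at h
  rw [← h]
  refine integral_congr_ae (Filter.Eventually.of_forall fun x => ?_)
  simp only
  congr 1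
  ring

/-- The Gaussian integral over `ℝ^m` in polar coordinates, the radius being written as `exp t`. -/
theorem sphereVol_mul_lintegral (m : ℕ) :
    sphereVol m * ∫⁻ t : ℝ, ENNReal.ofReal (exp t ^ (m + 1) * exp (-exp t ^ 2)) =
      ENNReal.ofReal (√π) ^ (m + 1) := by
  have hint : IntegrableOn (fun y : ℝ => y ^ m * exp (-y ^ 2)) (Set.Ioi 0) := by
    have h := integrable_rpow_mul_exp_neg_mul_sq (b := 1) one_pos (s := (m : ℝ))
      (by have : (0 : ℝ) ≤ m := Nat.cast_nonneg m
          linarith)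
    refine (h.integrableOn).congr_fun (fun y hy => ?_) measurableSet_Ioi
    simp only
    rw [rpow_natCast, neg_one_mul]
  have hnn : ∀ y ∈ Set.Ioi (0 : ℝ), 0 ≤ y ^ m * exp (-y ^ 2) := fun y hy =>
    mul_nonneg (pow_nonneg (le_of_lt hy) _) (exp_pos _).le
  have h1 : ∫⁻ t : ℝ, ENNReal.ofReal (exp t ^ (m + 1) * exp (-exp t ^ 2)) =
      ∫⁻ y in Set.Ioi (0 : ℝ), ENNReal.ofReal (y ^ m * exp (-y ^ 2)) := by
    have h2 := lintegral_image_eq_lintegral_abs_deriv_mul MeasurableSet.univ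
      (fun x _ => (hasDerivAt_exp x).hasDerivWithinAt) exp_injective.injOn
      (fun y => ENNReal.ofReal (y ^ m * exp (-y ^ 2)))
    rw [Set.image_univ, range_exp, Measure.restrict_univ] at h2
    rw [h2]
    refine lintegral_congr fun t => ?_
    rw [← ENNReal.ofReal_mul (abs_nonneg _), abs_of_pos (exp_pos t), pow_succ']
    congr 1
    ring
  have h3 : sphereVol m = ENNReal.ofReal ((m + 1 : ℕ) *
      (volume : Measure (EuclideanSpace ℝ (Fin (m + 1)))).real (Metric.ball 0 1)) := by
    rw [sphereVol, Measure.toSphere_apply_univ, finrank_euclideanSpace, Fintype.card_fin,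
      ENNReal.ofReal_mul (Nat.cast_nonneg _), ENNReal.ofReal_natCast, Measure.real,
      ENNReal.ofReal_toReal measure_ball_lt_top.ne]
  rw [h1, ← ofReal_integral_eq_lintegral_ofReal hint
    ((ae_restrict_iff' measurableSet_Ioi).2 (Filter.Eventually.of_forall hnn)), h3,
    ← ENNReal.ofReal_mul (by positivity), ← ENNReal.ofReal_pow (sqrt_nonneg _)]
  congr 1
  have h4 := integral_fun_norm_addHaar (volume : Measure (EuclideanSpace ℝ (Fin (m + 1))))
    fun y : ℝ => exp (-y ^ 2)
  have h5 := GaussianFourier.integral_rexp_neg_mul_sq_norm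
    (V := EuclideanSpace ℝ (Fin (m + 1))) one_pos
  simp only [neg_one_mul] at h5
  rw [h5, finrank_euclideanSpace, Fintype.card_fin, div_one] at h4
  simp only [nsmul_eq_mul, smul_eq_mul, Nat.add_sub_cancel] at h4
  rw [mul_assoc, ← h4, sqrt_eq_rpow, ← rpow_natCast, ← rpow_mul pi_pos.le]
  congr 1
  push_cast
  ring

theorem sphereVol_ne_zero (m : ℕ) : sphereVol m ≠ 0 := by
  intro h
  have h1 := sphereVol_mul_lintegral m
  rw [h, zero_mul] at h1
  exact pow_ne_zero _ (ENNReal.ofReal_pos.2 (sqrt_pos.2 pi_pos)).ne' h1.symm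

theorem sphereVol_ne_top (m : ℕ) : sphereVol m ≠ ∞ := measure_ne_top _ _

theorem integrable_exp_pow_mul (m : ℕ) :
    Integrable fun t : ℝ => exp t ^ (m + 1) * exp (-exp t ^ 2) := by
  rw [← lintegral_ofReal_ne_top_iff_integrable (by fun_prop)
    (Filter.Eventually.of_forall fun t => by positivity)]
  intro h
  have h1 := sphereVol_mul_lintegral m
  rw [h, ENNReal.mul_top (sphereVol_ne_zero m)] at h1
  exact ENNReal.pow_ne_top ENNReal.ofReal_ne_top h1.symm

end Gaussian

/-! ### A fundamental domain for the stabilizer of `d - 1` vectors -/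

section LastColumn

variable {d : ℕ}

/-- The inclusion of the first `d - 1` indices. -/
abbrev initIdx (i : Fin (d - 1)) : Fin d := Fin.castLE (Nat.sub_le d 1) i

/-- The last index. -/
abbrev lastIdx (hd : 2 ≤ d) : Fin d := ⟨d - 1, by omega⟩

theorem prod_initIdx_mul_lastIdx {M : Type*} [CommMonoid M] (hd : 2 ≤ d) (F : Fin d → M) :
    ∏ r, F r = (∏ j : Fin (d - 1), F (initIdx j)) * F (lastIdx hd) := by
  obtain ⟨m, rfl⟩ : ∃ m, d = m + 1 := ⟨d - 1, by omega⟩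
  exact Fin.prod_univ_castSucc F

theorem sum_initIdx_add_lastIdx {M : Type*} [AddCommMonoid M] (hd : 2 ≤ d) (F : Fin d → M) :
    ∑ r, F r = (∑ j : Fin (d - 1), F (initIdx j)) + F (lastIdx hd) := by
  obtain ⟨m, rfl⟩ : ∃ m, d = m + 1 := ⟨d - 1, by omega⟩
  exact Fin.sum_univ_castSucc F

theorem initIdx_lt_lastIdx (hd : 2 ≤ d) (i : Fin (d - 1)) : initIdx i < lastIdx hd :=
  Fin.lt_def.2 i.2

/-- A unitriangular system of real numbers can be reduced to the unit cube by integers in exactly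
one way. -/
theorem existsUnique_int_add_sum_mem_Ico {m : ℕ} {n : Matrix (Fin m) (Fin m) ℝ}
    (hn : n.IsUpperTriangular) (h1 : ∀ i, n i i = 1) (c : Fin m → ℝ) :
    ∃! b : Fin m → ℤ, ∀ i, c i + ∑ j, n i j * (b j : ℝ) ∈ Set.Ico (0 : ℝ) 1 := by
  induction m with
  | zero => exact ⟨Fin.elim0, fun i => i.elim0, fun _ _ => funext fun i => i.elim0⟩
  | succ m ih =>
    obtain ⟨b', hb', hu'⟩ := ih (n := fun i j => n i.succ j.succ)
      (fun i j hij => hn (Fin.succ_lt_succ_iff.2 hij)) (fun i => h1 i.succ) fun i => c i.succ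
    have hiff : ∀ b : Fin (m + 1) → ℤ, (∀ i, c i + ∑ j, n i j * (b j : ℝ) ∈ Set.Ico (0 : ℝ) 1) ↔
        (c 0 + ∑ j : Fin m, n 0 j.succ * (b j.succ : ℝ) + b 0 ∈ Set.Ico (0 : ℝ) 1) ∧
          ∀ i : Fin m, c i.succ + ∑ j : Fin m, n i.succ j.succ * (b j.succ : ℝ) ∈
            Set.Ico (0 : ℝ) 1 := by
      intro b
      rw [Fin.forall_fin_succ]
      refine and_congr ?_ (forall_congr' fun i => ?_)
      · rw [Fin.sum_univ_succ, h1, one_mul, add_comm (b 0 : ℝ), add_assoc]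
      · rw [Fin.sum_univ_succ, hn (show id (0 : Fin (m + 1)) < id i.succ from Fin.succ_pos i), zero_mul,
          zero_add]
    have hfl : ∀ (x : ℝ) (z : ℤ), x + z ∈ Set.Ico (0 : ℝ) 1 ↔ z = -⌊x⌋ := by
      intro x z
      rw [eq_comm, neg_eq_iff_eq_neg, Int.floor_eq_iff, Set.mem_Ico]
      push_cast
      constructor <;> rintro ⟨h, h'⟩ <;> constructor <;> linarith
    refine ⟨Fin.cons (-⌊c 0 + ∑ j : Fin m, n 0 j.succ * (b' j : ℝ)⌋) b', ?_, ?_⟩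
    · refine (hiff _).2 ⟨?_, ?_⟩
      · simp only [Fin.cons_succ, Fin.cons_zero]
        exact (hfl _ _).2 rfl
      · simp only [Fin.cons_succ]
        exact hb'
    · intro b hb
      replace hb := (hiff b).1 hb
      have h2 : (fun j => b j.succ) = b' := hu' _ hb.2
      have h3 := (hfl _ _).1 hb.1
      rw [← h2]
      funext i
      induction i using Fin.cases with
      | zero => rw [h3, Fin.cons_zero]
      | succ i => rw [Fin.cons_succ]

/-- The integral unipotent matrix that differs from the identity only in its last column. -/
def lastColMatrix (b : Fin (d - 1) → ℤ) : Matrix (Fin d) (Fin d) ℤ := fun i j =>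
  if i = j then 1 else if h : (i : ℕ) < d - 1 ∧ (j : ℕ) = d - 1 then b ⟨i, h.1⟩ else 0

/-- `lastColMatrix` as an element of `SL(d, ℤ)`. -/
def lastColElt (b : Fin (d - 1) → ℤ) : SpecialLinearGroup (Fin d) ℤ :=
  ⟨lastColMatrix b, by
    rw [Matrix.det_of_isUpperTriangular]
    · simp [lastColMatrix]
    · intro i j hij
      have hji : j < i := hij
      have h1 : i ≠ j := hji.ne'
      have h2 : ¬ ((i : ℕ) < d - 1 ∧ (j : ℕ) = d - 1) := by
        have := Fin.lt_def.1 hji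
        omega
      simp [lastColMatrix, h1, h2]⟩

theorem lastColElt_apply_lastIdx (hd : 2 ≤ d) (b : Fin (d - 1) → ℤ) (i : Fin (d - 1)) :
    lastColElt b (initIdx i) (lastIdx hd) = b i := by
  have h1 : initIdx i ≠ lastIdx hd := (initIdx_lt_lastIdx hd i).ne
  have h2 : ((initIdx i : Fin d) : ℕ) < d - 1 ∧ ((lastIdx hd : Fin d) : ℕ) = d - 1 := ⟨i.2, rfl⟩
  change (if _ then _ else _) = _
  rw [if_neg h1, dif_pos h2]
  rfl

theorem lastColElt_apply_initIdx (b : Fin (d - 1) → ℤ) (r : Fin d) (j : Fin (d - 1)) :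
    lastColElt b r (initIdx j) = if r = initIdx j then 1 else 0 := by
  have h2 : ¬ ((r : ℕ) < d - 1 ∧ ((initIdx j : Fin d) : ℕ) = d - 1) := by
    have := j.2
    rw [Fin.val_castLE]
    omega
  change (if _ then _ else _) = _
  rw [dif_neg h2]

theorem lastColElt_apply_self (b : Fin (d - 1) → ℤ) (r : Fin d) : lastColElt b r r = 1 := by
  change (if _ then _ else _) = _
  rw [if_pos rfl]

theorem toSLR_apply (m : SpecialLinearGroup (Fin d) ℤ) (i j : Fin d) :
    toSLR m i j = ((m i j : ℤ) : ℝ) := rfl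

theorem toSLR_mem_stabG_iff (m : SpecialLinearGroup (Fin d) ℤ) :
    toSLR m ∈ stabG d (d - 1) ↔
      ∀ (j : Fin (d - 1)) (r : Fin d), m r (initIdx j) = if r = initIdx j then 1 else 0 := by
  rw [mem_stabG_iff]
  constructor
  · intro h j r
    have h1 := congrFun (congrFun h j) r
    rw [smul_stdTuple_apply (Nat.sub_le d 1), toSLR_apply] at h1
    simp only [stdTuple] at h1
    simp only [Fin.ext_iff, Fin.val_castLE]
    split_ifs at h1 ⊢ <;> exact_mod_cast h1
  · intro h
    funext j r
    rw [smul_stdTuple_apply (Nat.sub_le d 1), toSLR_apply, h j r]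
    simp only [stdTuple, Fin.ext_iff, Fin.val_castLE]
    split_ifs <;> simp

/-- An integral matrix fixing `e₁, …, e_{d-1}` differs from the identity only in its last column, and
its last entry is `1` since its determinant is. -/
theorem mem_SLZ_inf_stabG_iff (hd : 2 ≤ d) (γ : SLR d) :
    γ ∈ SLZ d ⊓ stabG d (d - 1) ↔ ∃ b : Fin (d - 1) → ℤ, toSLR (lastColElt b) = γ := by
  constructor
  · rintro ⟨⟨m, rfl⟩, hm⟩
    have h1 := (toSLR_mem_stabG_iff m).1 hm
    have hU : (m : Matrix (Fin d) (Fin d) ℤ).IsUpperTriangular := by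
      intro i j hij
      have hji : j < i := hij
      have hj : (j : ℕ) < d - 1 := by
        have := Fin.lt_def.1 hji
        omega
      have := h1 ⟨j, hj⟩ i
      rw [show initIdx ⟨j, hj⟩ = j from rfl] at this
      rw [this, if_neg hji.ne']
    have hlast : m (lastIdx hd) (lastIdx hd) = 1 := by
      have h2 := Matrix.det_of_isUpperTriangular hU
      rw [m.2, prod_initIdx_mul_lastIdx hd, Finset.prod_eq_one, one_mul] at h2
      · exact h2.symm
      · intro j _
        rw [h1, if_pos rfl]
    refine ⟨fun i => m (initIdx i) (lastIdx hd), ?_⟩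
    change toSLR _ = toSLR m
    congr 1
    ext i j
    by_cases hj : (j : ℕ) < d - 1
    · have e : j = initIdx ⟨j, hj⟩ := rfl
      rw [e, lastColElt_apply_initIdx, h1]
    · have e : j = lastIdx hd := Fin.ext (by simp only; omega)
      rw [e]
      by_cases hi : (i : ℕ) < d - 1
      · have e' : i = initIdx ⟨i, hi⟩ := rfl
        rw [e', lastColElt_apply_lastIdx hd]
      · have e' : i = lastIdx hd := Fin.ext (by simp only; omega)
        rw [e', lastColElt_apply_self, hlast]
  · rintro ⟨b, rfl⟩
    exact ⟨⟨_, rfl⟩, (toSLR_mem_stabG_iff _).2 fun j r => lastColElt_apply_initIdx b r j⟩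

theorem toSLR_lastColElt_mem_upperTri (b : Fin (d - 1) → ℤ) : toSLR (lastColElt b) ∈ upperTri d := by
  refine ⟨fun i j hij => ?_, fun i => ?_⟩
  · have hji : j < i := hij
    have hj : (j : ℕ) < d - 1 := by
      have := Fin.lt_def.1 hji
      omega
    rw [toSLR_apply, show j = initIdx ⟨j, hj⟩ from rfl, lastColElt_apply_initIdx,
      if_neg (show i ≠ initIdx ⟨j, hj⟩ from hji.ne')]
    simp
  · rw [toSLR_apply, lastColElt_apply_self]
    simp

/-- The set of all `k a n` for which the last column of `n` lies in the unit cube. -/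
def cubeDomain (hd : 2 ≤ d) : Set (SLR d) :=
  (fun p : SOd d × upperTri d => (p.1 : SLR d) * p.2) ''
    {p | ∀ i : Fin (d - 1), (p.2 : SLR d) (initIdx i) (lastIdx hd) /
      (p.2 : SLR d) (initIdx i) (initIdx i) ∈ Set.Ico (0 : ℝ) 1}

theorem injective_SOd_mul_upperTri :
    Function.Injective fun p : SOd d × upperTri d => (p.1 : SLR d) * p.2 := by
  rintro ⟨k, s⟩ ⟨k', s'⟩ h
  have h1 : (k' : SLR d)⁻¹ * k = s' * (s : SLR d)⁻¹ := by
    rw [inv_mul_eq_iff_eq_mul, ← mul_assoc, eq_mul_inv_iff_mul_eq]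
    exact h
  have h2 : (k' : SLR d)⁻¹ * k = 1 :=
    eq_one_of_mem_SOd_of_mem_upperTri (mul_mem (inv_mem k'.2) k.2)
      (h1 ▸ mul_mem s'.2 (inv_mem s.2))
  have h3 : (k : SLR d) = k' := (inv_mul_eq_one.1 h2).symm
  refine Prod.ext (Subtype.ext h3) (Subtype.ext ?_)
  have h4 : (k : SLR d) * s = k' * s' := h
  rw [h3] at h4
  exact mul_left_cancel h4

theorem mul_mem_cubeDomain_iff (hd : 2 ≤ d) (k : SOd d) (s : upperTri d) :
    (k : SLR d) * s ∈ cubeDomain hd ↔ ∀ i : Fin (d - 1), (s : SLR d) (initIdx i) (lastIdx hd) /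
      (s : SLR d) (initIdx i) (initIdx i) ∈ Set.Ico (0 : ℝ) 1 :=
  injective_SOd_mul_upperTri.mem_set_image (a := (k, s))

theorem measurableSet_cubeDomain (hd : 2 ≤ d) : MeasurableSet (cubeDomain hd) := by
  refine MeasurableSet.image_of_continuousOn_injOn ?_ ?_ injective_SOd_mul_upperTri.injOn
  · have h : ∀ i j, Measurable fun p : SOd d × upperTri d => (p.2 : SLR d) i j := fun i j =>
      ((SLR.continuous_apply i j).comp (continuous_subtype_val.comp continuous_snd)).measurable
    have : {p : SOd d × upperTri d | ∀ i : Fin (d - 1), (p.2 : SLR d) (initIdx i) (lastIdx hd) /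
        (p.2 : SLR d) (initIdx i) (initIdx i) ∈ Set.Ico (0 : ℝ) 1} =
        ⋂ i : Fin (d - 1), (fun p : SOd d × upperTri d => (p.2 : SLR d) (initIdx i) (lastIdx hd) /
          (p.2 : SLR d) (initIdx i) (initIdx i)) ⁻¹' Set.Ico (0 : ℝ) 1 := by
      ext p
      simp only [Set.mem_iInter, Set.mem_preimage, Set.mem_ofPred_eq]
    rw [this]
    exact MeasurableSet.iInter fun i => ((h _ _).div (h _ _)) measurableSet_Ico
  · exact ((continuous_subtype_val.comp continuous_fst).mul
      (continuous_subtype_val.comp continuous_snd)).continuousOn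

/-- Right multiplication by an element of `Γ_{d-1}` changes the last column of `n` by an integral
combination of the first `d - 1` columns, which form a unitriangular system. -/
theorem existsUnique_mul_mem_cubeDomain (hd : 2 ≤ d) (g : SLR d) :
    ∃! γ : (SLZ d ⊓ stabG d (d - 1) : Subgroup (SLR d)), g * γ ∈ cubeDomain hd := by
  obtain ⟨k, hk, s, hs, rfl⟩ := exists_mul_eq_of_SLR g
  have key : ∀ b : Fin (d - 1) → ℤ, k * s * toSLR (lastColElt b) ∈ cubeDomain hd ↔
      ∀ i : Fin (d - 1), s (initIdx i) (lastIdx hd) / s (initIdx i) (initIdx i) +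
        ∑ j : Fin (d - 1), s (initIdx i) (initIdx j) / s (initIdx i) (initIdx i) * (b j : ℝ) ∈
          Set.Ico (0 : ℝ) 1 := by
    intro b
    rw [mul_assoc, mul_mem_cubeDomain_iff hd ⟨k, hk⟩
      ⟨s * toSLR (lastColElt b), mul_mem hs (toSLR_lastColElt_mem_upperTri b)⟩]
    refine forall_congr' fun i => ?_
    have e1 : (s * toSLR (lastColElt b)) (initIdx i) (initIdx i) = s (initIdx i) (initIdx i) := by
      refine (hs.1.mul_apply_diag (toSLR_lastColElt_mem_upperTri b).1 _).trans ?_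
      rw [toSLR_apply, lastColElt_apply_self, Int.cast_one, mul_one]
    have e2 : (s * toSLR (lastColElt b)) (initIdx i) (lastIdx hd) =
        ∑ j : Fin (d - 1), s (initIdx i) (initIdx j) * (b j : ℝ) + s (initIdx i) (lastIdx hd) := by
      change ((s : Matrix (Fin d) (Fin d) ℝ) * (toSLR (lastColElt b) : Matrix (Fin d) (Fin d) ℝ)) _ _ = _
      rw [Matrix.mul_apply, sum_initIdx_add_lastIdx hd]
      simp only [toSLR_apply]
      rw [lastColElt_apply_self, Int.cast_one, mul_one]
      congr 1
      refine Finset.sum_congr rfl fun j _ => ?_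
      rw [lastColElt_apply_lastIdx hd]
    simp only
    rw [e1, e2, add_div, add_comm, Finset.sum_div]
    have e3 : ∀ j : Fin (d - 1), s (initIdx i) (initIdx j) * (b j : ℝ) / s (initIdx i) (initIdx i) =
        s (initIdx i) (initIdx j) / s (initIdx i) (initIdx i) * (b j : ℝ) := fun j => by ring
    simp_rw [e3]
  obtain ⟨b, hb, hu⟩ := existsUnique_int_add_sum_mem_Ico
    (n := fun i j : Fin (d - 1) => s (initIdx i) (initIdx j) / s (initIdx i) (initIdx i))
    (fun i j hij => by
      have : initIdx j < initIdx i := hij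
      have h0 : s (initIdx i) (initIdx j) = 0 := hs.1 this
      change s (initIdx i) (initIdx j) / s (initIdx i) (initIdx i) = 0
      exact (congrArg (fun x => x / s (initIdx i) (initIdx i)) h0).trans (zero_div _))
    (fun i => div_self (hs.2 _).ne')
    fun i => s (initIdx i) (lastIdx hd) / s (initIdx i) (initIdx i)
  refine ⟨⟨toSLR (lastColElt b), (mem_SLZ_inf_stabG_iff hd _).2 ⟨b, rfl⟩⟩, (key b).2 hb, ?_⟩
  rintro ⟨γ, hγ⟩ h
  obtain ⟨b', rfl⟩ := (mem_SLZ_inf_stabG_iff hd γ).1 hγ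
  have := hu b' ((key b').1 h)
  subst this
  rfl

end LastColumn

/-! ### The volume of the quotient by the stabilizer of `d - 1` vectors -/

section BaseCase

open Real

variable {d : ℕ}

/-- A product over the positions `i < j`, with the positions in the last column split off. -/
theorem prod_upperIndex {M : Type*} [CommMonoid M] (hd : 2 ≤ d) (G : UpperIndex d → M) :
    ∏ p, G p = (∏ j : Fin (d - 1), ∏ i : Fin d,
      if h : i < initIdx j then G ⟨(i, initIdx j), h⟩ else 1) *
        ∏ i : Fin (d - 1), G ⟨(initIdx i, lastIdx hd), initIdx_lt_lastIdx hd i⟩ := by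
  let G' : Fin d × Fin d → M := fun x => if h : x.1 < x.2 then G ⟨x, h⟩ else 1
  have h1 : ∏ p, G p = ∏ p : UpperIndex d, G' p.1 :=
    Finset.prod_congr rfl fun p _ => by
      simp only [G']
      rw [dif_pos p.2]
  have h2 : ∏ p : UpperIndex d, G' p.1 = ∏ x : Fin d × Fin d, G' x := by
    rw [← Finset.prod_subtype (Finset.univ.filter fun x : Fin d × Fin d => x.1 < x.2) (by simp) G',
      Finset.prod_filter]
    refine Finset.prod_congr rfl fun x _ => ?_
    by_cases h : x.1 < x.2
    · rw [if_pos h]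
    · rw [if_neg h]
      simp only [G']
      rw [dif_neg h]
  rw [h1, h2, Fintype.prod_prod_type_right, prod_initIdx_mul_lastIdx hd]
  congr 1
  rw [prod_initIdx_mul_lastIdx hd]
  have h3 : G' (lastIdx hd, lastIdx hd) = 1 := dif_neg (lt_irrefl _)
  rw [h3, mul_one]
  exact Finset.prod_congr rfl fun i _ => dif_pos (initIdx_lt_lastIdx hd i)

theorem prod_ite_lt (j : Fin d) (c : ℝ) : ∏ i : Fin d, (if i < j then c else 1) = c ^ (j : ℕ) := by
  rw [Finset.prod_ite, Finset.prod_const, Finset.prod_const_one, mul_one]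
  congr 1
  rw [← Fin.card_Iio j]
  congr 1
  ext i
  simp

theorem diagEntry_initIdx (t : Fin (d - 1) → ℝ) (i : Fin (d - 1)) :
    diagEntry t (initIdx i) = exp (t i) := by
  rw [diagEntry, dif_pos (show ((initIdx i : Fin d) : ℕ) < d - 1 from i.2)]
  rfl

theorem prod_exp_mul_diagEntry_lastIdx (hd : 2 ≤ d) (t : Fin (d - 1) → ℝ) :
    (∏ i, exp (t i)) * diagEntry t (lastIdx hd) = 1 := by
  have h := prod_diagEntry t
  rw [prod_initIdx_mul_lastIdx hd] at h
  simp_rw [diagEntry_initIdx] at h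
  exact h

/-- The weight `ρ(a)`, together with the factors `√π / a_i` contributed by the Gaussian integrals
over `n_ij`, `j < d`. -/
theorem rhoWeight_mul_prod (hd : 2 ≤ d) (t : Fin (d - 1) → ℝ) :
    rhoWeight t * ∏ p : UpperIndex d, (if p.1.2 = lastIdx hd then 1 else √π / diagEntry t p.1.1) =
      ∏ j : Fin (d - 1), √π ^ (j : ℕ) * exp (t j) ^ (d - j) := by
  rw [rhoWeight, ← Finset.prod_mul_distrib, prod_upperIndex hd]
  have h1 : ∀ (j : Fin (d - 1)) (i : Fin d), (if h : i < initIdx j then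
      diagEntry t i / diagEntry t (initIdx j) *
        (if initIdx j = lastIdx hd then 1 else √π / diagEntry t i) else 1) =
      if i < initIdx j then √π / exp (t j) else 1 := by
    intro j i
    by_cases h : i < initIdx j
    · rw [dif_pos h, if_pos h, if_neg (initIdx_lt_lastIdx hd j).ne, diagEntry_initIdx]
      have := (diagEntry_pos t i).ne'
      field_simp
    · rw [dif_neg h, if_neg h]
  rw [Finset.prod_congr rfl fun j _ => Finset.prod_congr rfl fun i _ => h1 j i]
  simp only [prod_ite_lt, if_true, mul_one, diagEntry_initIdx]
  have h2 := prod_exp_mul_diagEntry_lastIdx hd t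
  have h3 : ∏ i : Fin (d - 1), exp (t i) / diagEntry t (lastIdx hd) =
      ∏ j : Fin (d - 1), exp (t j) ^ d := by
    rw [Finset.prod_div_distrib, Finset.prod_const, Finset.card_univ, Fintype.card_fin,
      Finset.prod_pow]
    have h4 := (diagEntry_pos t (lastIdx hd)).ne'
    have h5 : (∏ i, exp (t i)) = (diagEntry t (lastIdx hd))⁻¹ := eq_inv_of_mul_eq_one_left h2
    have h6 : ∀ x : ℝ, x ^ d = x ^ (d - 1) * x := fun x => by
      rw [← pow_succ, Nat.sub_add_cancel (by omega)]
    rw [h6, h5, inv_pow, div_eq_mul_inv, mul_comm]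
  rw [h3, ← Finset.prod_mul_distrib]
  refine Finset.prod_congr rfl fun j _ => ?_
  have h7 : (initIdx j : ℕ) = j := rfl
  have h8 : exp (t j) ^ d = exp (t j) ^ (d - j) * exp (t j) ^ (j : ℕ) := by
    rw [← pow_add, Nat.sub_add_cancel (by have := j.2; omega)]
  rw [h7, div_pow, h8]
  have := (exp_pos (t j)).ne'
  field_simp

theorem sum_sq_smul_of_mem_SOd {k : SLR d} (hk : k ∈ SOd d) (x : Fin d → ℝ) :
    ∑ r, (k • x) r ^ 2 = ∑ r, x r ^ 2 := by
  have h1 : ∀ y : Fin d → ℝ, ∑ r, y r ^ 2 = y ⬝ᵥ y := fun y =>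
    Finset.sum_congr rfl fun r _ => sq (y r)
  rw [h1, h1, SLR.smul_eq_mulVec, Matrix.dotProduct_mulVec, Matrix.vecMul_mulVec,
    transpose_mul_self_of_mem_SOd hk, Matrix.vecMul_one]

/-- The Gaussian on tuples of vectors. -/
def gaussTuple {k : ℕ} (v : Fin k → Fin d → ℝ) : ℝ := ∏ j, ∏ r, exp (-(v j r) ^ 2)

theorem gaussTuple_smul_of_mem_SOd {n : ℕ} {k : SLR d} (hk : k ∈ SOd d) (v : Fin n → Fin d → ℝ) :
    gaussTuple (k • v) = gaussTuple v := by
  unfold gaussTuple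
  refine Finset.prod_congr rfl fun j _ => ?_
  rw [← Real.exp_sum, ← Real.exp_sum, Finset.sum_neg_distrib, Finset.sum_neg_distrib]
  congr 2
  exact sum_sq_smul_of_mem_SOd hk (v j)

theorem continuous_gaussTuple {k : ℕ} :
    Continuous (gaussTuple : (Fin k → Fin d → ℝ) → ℝ) := by
  unfold gaussTuple
  fun_prop

theorem lintegral_gaussTuple (k : ℕ) :
    ∫⁻ v : Fin k → Fin d → ℝ, ENNReal.ofReal (gaussTuple v) = (ENNReal.ofReal √π ^ d) ^ k := by
  have h0 : Integrable fun x : ℝ => exp (-x ^ 2) := by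
    simpa using integrable_exp_neg_sq_mul one_pos
  have h1 : ∫⁻ x : ℝ, ENNReal.ofReal (exp (-x ^ 2)) = ENNReal.ofReal √π := by
    simpa using lintegral_exp_neg_sq_mul one_pos
  have h2 : Integrable fun x : Fin d → ℝ => ∏ r, exp (-(x r) ^ 2) :=
    Integrable.fintype_prod fun _ => h0
  have h3 := lintegral_pi_prod_ofReal (ι := Fin k) (f := fun _ (x : Fin d → ℝ) => ∏ r, exp (-(x r) ^ 2))
    (fun _ => h2) fun _ _ => Finset.prod_nonneg fun _ _ => (exp_pos _).le
  have h4 := lintegral_pi_prod_ofReal (ι := Fin d) (f := fun _ x => exp (-x ^ 2))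
    (fun _ => h0) fun _ _ => (exp_pos _).le
  unfold gaussTuple
  rw [h3, h4, h1, Finset.prod_const, Finset.prod_const]
  simp

/-- The Gaussian at the first `d - 1` columns of `a n`. -/
theorem gaussTuple_an (t : Fin (d - 1) → ℝ) (u : UpperIndex d → ℝ) :
    gaussTuple ((diagElt t * unipElt u) • stdTuple d (d - 1)) =
      ∏ j : Fin (d - 1), exp (-exp (t j) ^ 2) * ∏ i : Fin d,
        if h : i < initIdx j then exp (-(diagEntry t i * u ⟨(i, initIdx j), h⟩) ^ 2) else 1 := by
  unfold gaussTuple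
  refine Finset.prod_congr rfl fun j _ => ?_
  have h1 : ∀ r : Fin d, exp (-((diagElt t * unipElt u) • stdTuple d (d - 1)) j r ^ 2) =
      (if r = initIdx j then exp (-exp (t j) ^ 2) else 1) *
        if h : r < initIdx j then exp (-(diagEntry t r * u ⟨(r, initIdx j), h⟩) ^ 2) else 1 := by
    intro r
    rw [smul_stdTuple_apply (Nat.sub_le d 1), diagElt_mul_unipElt_apply]
    rcases lt_trichotomy r (initIdx j) with h | h | h
    · rw [if_neg h.ne, dif_pos h, one_mul, unipMatrix, dif_pos h]
    · subst h
      rw [if_pos rfl, dif_neg (lt_irrefl _), unipMatrix_diag, diagEntry_initIdx, mul_one, mul_one]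
    · have h0 : unipMatrix u r (initIdx j) = 0 := unipMatrix_isUpperTriangular u h
      rw [if_neg h.ne', dif_neg h.not_gt]
      change exp (-(diagEntry t r * unipMatrix u r (initIdx j)) ^ 2) = _
      rw [h0]
      simp
  rw [Finset.prod_congr rfl fun r _ => h1 r, Finset.prod_mul_distrib]
  simp

/-- The factor at the position `p` in the integral over `N`: an indicator function in the last
column, where the domain is a cube, and a Gaussian in the other columns. -/
def unipFactor (hd : 2 ≤ d) (t : Fin (d - 1) → ℝ) (p : UpperIndex d) : ℝ → ℝ :=
  if p.1.2 = lastIdx hd then (Set.Ico (0 : ℝ) 1).indicator 1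
  else fun x => exp (-(diagEntry t p.1.1 * x) ^ 2)

theorem unipFactor_nonneg (hd : 2 ≤ d) (t : Fin (d - 1) → ℝ) (p : UpperIndex d) (x : ℝ) :
    0 ≤ unipFactor hd t p x := by
  unfold unipFactor
  split_ifs
  · exact Set.indicator_nonneg (fun _ _ => zero_le_one) x
  · exact (exp_pos _).le

theorem integrable_unipFactor (hd : 2 ≤ d) (t : Fin (d - 1) → ℝ) (p : UpperIndex d) :
    Integrable (unipFactor hd t p) := by
  unfold unipFactor
  split_ifs
  · exact (integrable_indicator_iff measurableSet_Ico).2 (integrableOn_const (by simp))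
  · exact integrable_exp_neg_sq_mul (diagEntry_pos t _)

theorem lintegral_unipFactor (hd : 2 ≤ d) (t : Fin (d - 1) → ℝ) (p : UpperIndex d) :
    ∫⁻ x, ENNReal.ofReal (unipFactor hd t p x) =
      ENNReal.ofReal (if p.1.2 = lastIdx hd then 1 else √π / diagEntry t p.1.1) := by
  unfold unipFactor
  split_ifs
  · have h : ∀ x : ℝ, ENNReal.ofReal ((Set.Ico (0 : ℝ) 1).indicator 1 x) =
        (Set.Ico (0 : ℝ) 1).indicator 1 x := by
      intro x
      by_cases hx : x ∈ Set.Ico (0 : ℝ) 1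
      · rw [Set.indicator_of_mem hx, Set.indicator_of_mem hx]
        simp
      · rw [Set.indicator_of_notMem hx, Set.indicator_of_notMem hx]
        simp
    simp_rw [h]
    rw [lintegral_indicator_one measurableSet_Ico]
    simp
  · exact lintegral_exp_neg_sq_mul (diagEntry_pos t _)

theorem gaussTuple_mul_indicator (hd : 2 ≤ d) (k : SOd d) (t : Fin (d - 1) → ℝ)
    (u : UpperIndex d → ℝ) :
    ENNReal.ofReal (gaussTuple (((k : SLR d) * diagElt t * unipElt u) • stdTuple d (d - 1))) *
      (cubeDomain hd).indicator 1 ((k : SLR d) * diagElt t * unipElt u) =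
    ENNReal.ofReal (∏ j, exp (-exp (t j) ^ 2)) *
      ENNReal.ofReal (∏ p, unipFactor hd t p (u p)) := by
  have hmem : (k : SLR d) * diagElt t * unipElt u ∈ cubeDomain hd ↔
      ∀ i : Fin (d - 1), u ⟨(initIdx i, lastIdx hd), initIdx_lt_lastIdx hd i⟩ ∈ Set.Ico (0 : ℝ) 1 := by
    rw [mul_assoc]
    refine (mul_mem_cubeDomain_iff hd k (anElt (t, u))).trans (forall_congr' fun i => ?_)
    rw [anElt_apply, anElt_apply, unipMatrix_diag, mul_one,
      mul_div_cancel_left₀ _ (diagEntry_pos _ _).ne', unipMatrix, dif_pos (initIdx_lt_lastIdx hd i)]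
  have hprod : ∏ p, unipFactor hd t p (u p) = (∏ j : Fin (d - 1), ∏ i : Fin d,
      if h : i < initIdx j then exp (-(diagEntry t i * u ⟨(i, initIdx j), h⟩) ^ 2) else 1) *
        ∏ i : Fin (d - 1), (Set.Ico (0 : ℝ) 1).indicator 1
          (u ⟨(initIdx i, lastIdx hd), initIdx_lt_lastIdx hd i⟩) := by
    rw [prod_upperIndex hd]
    congr 1
    · refine Finset.prod_congr rfl fun j _ => Finset.prod_congr rfl fun i _ => ?_
      simp only [unipFactor, if_neg (initIdx_lt_lastIdx hd j).ne]
    · refine Finset.prod_congr rfl fun i _ => ?_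
      simp only [unipFactor, if_true]
  have hE : 0 ≤ ∏ j, exp (-exp (t j) ^ 2) := Finset.prod_nonneg fun _ _ => (exp_pos _).le
  rw [← ENNReal.ofReal_mul hE, hprod, ← mul_assoc, ← Finset.prod_mul_distrib, ← gaussTuple_an,
    mul_assoc (k : SLR d), mul_smul, gaussTuple_smul_of_mem_SOd k.2, ← mul_assoc]
  by_cases h : (k : SLR d) * diagElt t * unipElt u ∈ cubeDomain hd
  · rw [Set.indicator_of_mem h, Finset.prod_eq_one, mul_one]
    · simp
    · intro i _
      rw [Set.indicator_of_mem (hmem.1 h i)]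
      rfl
  · rw [Set.indicator_of_notMem h]
    rw [hmem] at h
    push Not at h
    obtain ⟨i, hi⟩ := h
    rw [Finset.prod_eq_zero (Finset.mem_univ i) (Set.indicator_of_notMem hi _)]
    simp

theorem lintegral_gaussTuple_mul_indicator (hd : 2 ≤ d) (κ : Measure (SOd d)) [SFinite κ] :
    ∫⁻ g, ENNReal.ofReal (gaussTuple (g • stdTuple d (d - 1))) * (cubeDomain hd).indicator 1 g
        ∂(iwasawaMeasure κ) =
      κ Set.univ * ∏ j : Fin (d - 1), (ENNReal.ofReal √π ^ (j : ℕ) *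
        ∫⁻ t : ℝ, ENNReal.ofReal (exp t ^ (d - j) * exp (-exp t ^ 2))) := by
  have hf : Measurable fun g : SLR d => ENNReal.ofReal (gaussTuple (g • stdTuple d (d - 1))) *
      (cubeDomain hd).indicator 1 g :=
    ((continuous_gaussTuple.measurable.comp (measurable_smul_const _)).ennreal_ofReal).mul
      (measurable_one.indicator (measurableSet_cubeDomain hd))
  rw [lintegral_iwasawaMeasure κ hf]
  have h1 : ∀ (k : SOd d) (t : Fin (d - 1) → ℝ), ∫⁻ u : UpperIndex d → ℝ,
      ENNReal.ofReal (gaussTuple (((k : SLR d) * diagElt t * unipElt u) • stdTuple d (d - 1))) *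
      (cubeDomain hd).indicator 1 ((k : SLR d) * diagElt t * unipElt u) =
      ENNReal.ofReal ((∏ j, exp (-exp (t j) ^ 2)) *
        ∏ p : UpperIndex d, (if p.1.2 = lastIdx hd then 1 else √π / diagEntry t p.1.1)) := by
    intro k t
    simp_rw [gaussTuple_mul_indicator hd k t]
    rw [lintegral_const_mul' _ _ ENNReal.ofReal_ne_top,
      lintegral_pi_prod_ofReal (integrable_unipFactor hd t) (unipFactor_nonneg hd t)]
    simp_rw [lintegral_unipFactor]
    rw [ENNReal.ofReal_mul (Finset.prod_nonneg fun _ _ => (exp_pos _).le),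
      ENNReal.ofReal_prod_of_nonneg (f := fun p : UpperIndex d =>
        if p.1.2 = lastIdx hd then 1 else √π / diagEntry t p.1.1)]
    intro p _
    split_ifs
    · exact zero_le_one
    · exact div_nonneg (sqrt_nonneg _) (diagEntry_pos t _).le
  have h2 : ∫⁻ t, ENNReal.ofReal ((∏ j, exp (-exp (t j) ^ 2)) *
      ∏ p : UpperIndex d, (if p.1.2 = lastIdx hd then 1 else √π / diagEntry t p.1.1))
        ∂(rhoMeasure d) =
      ∫⁻ t : Fin (d - 1) → ℝ, ENNReal.ofReal (∏ j : Fin (d - 1),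
        √π ^ (j : ℕ) * (exp (t j) ^ (d - j) * exp (-exp (t j) ^ 2))) := by
    have hm : Measurable fun t : Fin (d - 1) → ℝ => ENNReal.ofReal ((∏ j, exp (-exp (t j) ^ 2)) *
      ∏ p : UpperIndex d, (if p.1.2 = lastIdx hd then 1 else √π / diagEntry t p.1.1)) := by
      refine Measurable.ennreal_ofReal (Measurable.mul ?_ ?_)
      · exact Finset.measurable_prod _ fun j _ => by fun_prop
      · refine Finset.measurable_prod _ fun p _ => ?_
        split_ifs
        · exact measurable_const
        · exact (continuous_diagEntry _).measurable.const_div _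
    rw [rhoMeasure, lintegral_withDensity_eq_lintegral_mul _ measurable_ofReal_rhoWeight hm]
    refine lintegral_congr fun t => ?_
    rw [Pi.mul_apply, ← ENNReal.ofReal_mul (rhoWeight_pos t).le, mul_left_comm,
      rhoWeight_mul_prod hd, ← Finset.prod_mul_distrib]
    congr 1
    exact Finset.prod_congr rfl fun j _ => by ring
  simp_rw [h1, h2]
  rw [lintegral_const, mul_comm,
    lintegral_pi_prod_ofReal (f := fun (j : Fin (d - 1)) (x : ℝ) =>
      √π ^ (j : ℕ) * (exp x ^ (d - j) * exp (-exp x ^ 2)))]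
  · congr 1
    refine Finset.prod_congr rfl fun j _ => ?_
    rw [← ENNReal.ofReal_pow (sqrt_nonneg _), ← lintegral_const_mul' _ _ ENNReal.ofReal_ne_top]
    refine lintegral_congr fun t => ?_
    rw [ENNReal.ofReal_mul (pow_nonneg (sqrt_nonneg _) _)]
  · intro j
    have h3 : d - j = (d - j - 1) + 1 := by have := j.2; omega
    rw [h3]
    exact (integrable_exp_pow_mul _).const_mul _
  · intro j x
    positivity

theorem prod_sphereVol (d : ℕ) : ∏ j : Fin (d - 1), sphereVol (d - j - 1) =
    ∏ i ∈ Finset.Icc 1 (d - 1), sphereVol i := by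
  rw [Fin.prod_univ_eq_prod_range (fun j => sphereVol (d - j - 1)) (d - 1)]
  refine Finset.prod_bij (fun j _ => d - j - 1) (fun j hj => ?_) (fun i hi j hj h => ?_)
    (fun i hi => ⟨d - i - 1, ?_, ?_⟩) fun _ _ => rfl
  · rw [Finset.mem_range] at hj
    rw [Finset.mem_Icc]
    omega
  · rw [Finset.mem_range] at hi hj
    omega
  · rw [Finset.mem_Icc] at hi
    rw [Finset.mem_range]
    omega
  · rw [Finset.mem_Icc] at hi
    omega

/-- The volume of `G_{d-1} / Γ_{d-1}` in Iwasawa coordinates: the Gaussian is integrated over a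
fundamental domain of `Γ_{d-1}` in two ways, once by the quotient integral formula and once by
polar coordinates in each of the `d - 1` entries of `A`. -/
theorem quotientVol_stabΓ_smul_iwasawaMeasure (hd : 2 ≤ d) (κ : Measure (SOd d)) [SFinite κ]
    {c : ℝ≥0∞} {ν : Measure (SLR d)} [ν.IsHaarMeasure] (hν : ν = c • iwasawaMeasure κ)
    {νk : Measure (stabG d (d - 1))} (h : IsInducedHaar ν νk) :
    quotientVol (stabΓ d (d - 1)) νk * ∏ i ∈ Finset.Icc 1 (d - 1), sphereVol i =
      c * κ Set.univ := by
  have h1 := h.lintegral_mul_indicator hd (by omega) (measurableSet_cubeDomain hd)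
    (existsUnique_mul_mem_cubeDomain hd)
    (f := fun v => ENNReal.ofReal (gaussTuple v)) continuous_gaussTuple.measurable.ennreal_ofReal
  rw [hν, lintegral_smul_measure, smul_eq_mul, lintegral_gaussTuple_mul_indicator hd κ,
    lintegral_gaussTuple] at h1
  set P := ENNReal.ofReal √π
  have hP0 : P ≠ 0 := (ENNReal.ofReal_pos.2 (sqrt_pos.2 pi_pos)).ne'
  have hPt : P ≠ ∞ := ENNReal.ofReal_ne_top
  have h2 : (∏ j : Fin (d - 1), (P ^ (j : ℕ) *
      ∫⁻ t : ℝ, ENNReal.ofReal (exp t ^ (d - j) * exp (-exp t ^ 2)))) *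
        ∏ i ∈ Finset.Icc 1 (d - 1), sphereVol i = (P ^ d) ^ (d - 1) := by
    have h5 : (P ^ d) ^ (d - 1) = ∏ _j : Fin (d - 1), P ^ d := by simp
    rw [← prod_sphereVol, ← Finset.prod_mul_distrib, h5]
    refine Finset.prod_congr rfl fun j _ => ?_
    have h3 := sphereVol_mul_lintegral (d - j - 1)
    have h4 : d - j - 1 + 1 = d - j := by have := j.2; omega
    rw [h4] at h3
    rw [mul_assoc, mul_comm _ (sphereVol _), h3, ← pow_add]
    congr 1
    have := j.2
    omega
  have hPP0 : (P ^ d) ^ (d - 1) ≠ 0 := pow_ne_zero _ (pow_ne_zero _ hP0)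
  have hPPt : (P ^ d) ^ (d - 1) ≠ ∞ := ENNReal.pow_ne_top (ENNReal.pow_ne_top hPt)
  refine (ENNReal.mul_left_inj hPP0 hPPt).1 ?_
  rw [mul_right_comm, ← h1, mul_assoc, mul_assoc, h2, mul_assoc]

end BaseCase

/-! ### Volumes of `G / Γ` and of `G_k / Γ_k` -/

section Volumes

variable {d k : ℕ}

/-- There is one tuple of length `0`, so that the mean value formula is trivial. -/
theorem isTupleMean_zero (μ : Measure (SLR d)) : IsTupleMean μ 0 (μ Set.univ) := by
  intro f _
  have : Unique (primOrbit d 0) := ⟨⟨⟨_, MulAction.mem_orbit_self _⟩⟩, fun _ => Subsingleton.elim _ _⟩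
  have h1 : ∀ g : SLR d, ∑' w : primOrbit d 0, f (g • (w : Fin 0 → Fin d → ℝ)) = f default := by
    intro g
    refine (hasSum_unique _).tsum_eq.trans ?_
    exact congrArg f (Subsingleton.elim _ _)
  simp_rw [h1]
  rw [lintegral_const, lintegral_unique, volume_pi, Measure.pi_univ]
  rw [Finset.univ_eq_empty, Finset.prod_empty, mul_one, mul_comm]
  exact congrArg (fun v => μ Set.univ * f v) (Subsingleton.elim _ _)

theorem prod_sphereVol_ne_zero (n : ℕ) : ∏ i ∈ Finset.Icc 1 n, sphereVol i ≠ 0 :=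
  Finset.prod_ne_zero_iff.2 fun i _ => sphereVol_ne_zero i

theorem prod_sphereVol_ne_top (n : ℕ) : ∏ i ∈ Finset.Icc 1 n, sphereVol i ≠ ∞ :=
  ENNReal.prod_ne_top fun i _ => sphereVol_ne_top i

/-- Finiteness, by comparison with a Haar measure in Iwasawa coordinates. -/
theorem quotientVol_stabΓ_ne_top (hd : 2 ≤ d) {ν : Measure (SLR d)} [ν.IsHaarMeasure]
    {νk : Measure (stabG d (d - 1))} (h : IsInducedHaar ν νk) :
    quotientVol (stabΓ d (d - 1)) νk ≠ ∞ := by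
  obtain ⟨c, -, hct, hν⟩ := exists_smul_iwasawaMeasure_eq hd ν Measure.haar
  have h1 := quotientVol_stabΓ_smul_iwasawaMeasure hd Measure.haar hν h
  intro htop
  rw [htop, ENNReal.top_mul (prod_sphereVol_ne_zero _)] at h1
  exact ENNReal.mul_ne_top hct (measure_ne_top _ _) h1.symm

theorem prod_zetaVal_pos {s : Finset ℕ} (hs : ∀ j ∈ s, 2 ≤ j) : 0 < ∏ j ∈ s, zetaVal j :=
  Finset.prod_pos fun j hj => zetaVal_pos (hs j hj)

/-- `vol(G / Γ) = ζ(2) ⋯ ζ(d) vol(G_{d-1} / Γ_{d-1})`, and the same with `G_k / Γ_k` for `G / Γ`. -/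
theorem quotientVol_eq_prod_zetaVal_mul (hd : 2 ≤ d) {ν : Measure (SLR d)} [ν.IsHaarMeasure]
    {νl : Measure (stabG d (d - 1))} (hl : IsInducedHaar ν νl) :
    quotientVol (SLZ d) ν = ENNReal.ofReal (∏ j ∈ Finset.Icc 2 d, zetaVal j) *
        quotientVol (stabΓ d (d - 1)) νl ∧
      ∀ k (νk : Measure (stabG d k)), k < d → IsInducedHaar ν νk →
        quotientVol (stabΓ d k) νk = ENNReal.ofReal (∏ j ∈ Finset.Icc 2 (d - k), zetaVal j) *
          quotientVol (stabΓ d (d - 1)) νl := by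
  have := SLR.isMulRightInvariant hd ν
  obtain ⟨F, hF, hFΓ⟩ := exists_measurableSet_existsUnique_mul_mem (SLZ d)
  choose! W hW using fun (k : ℕ) (hkd : k < d) =>
    (⟨quotientVol (stabΓ d k) (existsUnique_isInducedHaar hkd ν).choose, fun f hf =>
      (existsUnique_isInducedHaar hkd ν).choose_spec.1.setLIntegral_tsum_orbit hd hkd hF hFΓ hf⟩ :
      ∃ W, IsTupleMean (ν.restrict F) k W)
  -- a mean value is determined by its value at one function
  have huniq : ∀ k W W', IsTupleMean (ν.restrict F) k W → IsTupleMean (ν.restrict F) k W' →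
      W = W' := by
    intro k W W' h h'
    have h1 := (h (fun v => ENNReal.ofReal (gaussTuple v))
      continuous_gaussTuple.measurable.ennreal_ofReal).symm.trans (h' _
      continuous_gaussTuple.measurable.ennreal_ofReal)
    rw [lintegral_gaussTuple] at h1
    refine (ENNReal.mul_left_inj (pow_ne_zero _ (pow_ne_zero _ ?_))
      (ENNReal.pow_ne_top (ENNReal.pow_ne_top ENNReal.ofReal_ne_top))).1 h1
    exact (ENNReal.ofReal_pos.2 (Real.sqrt_pos.2 Real.pi_pos)).ne'
  have hvol : ∀ k (νk : Measure (stabG d k)), k < d → IsInducedHaar ν νk →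
      W k = quotientVol (stabΓ d k) νk := fun k νk hkd h =>
    huniq k _ _ (hW k hkd) fun f hf => h.setLIntegral_tsum_orbit hd hkd hF hFΓ hf
  have h0 : W 0 = quotientVol (SLZ d) ν := by
    rw [huniq 0 _ _ (hW 0 (by omega)) (isTupleMean_zero _), Measure.restrict_apply_univ,
      quotientVol_eq_of_existsUnique hF hFΓ ν]
  have hl' := hvol (d - 1) νl (by omega) hl
  have hfin : W (d - 1) ≠ ∞ := hl' ▸ quotientVol_stabΓ_ne_top hd hl
  refine ⟨?_, fun k νk hkd h => ?_⟩
  · rw [← h0, ← hl', IsTupleMean.eq_prod_zetaVal_mul hW hfin (by omega : 0 < d), Nat.sub_zero]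
  · rw [← hvol k νk hkd h, ← hl', IsTupleMean.eq_prod_zetaVal_mul hW hfin hkd]

theorem quotientVol_stabΓ_eq (hd : 2 ≤ d) (hkd : k < d) {ν : Measure (SLR d)}
    [ν.IsHaarMeasure] {νk : Measure (stabG d k)} (h : IsInducedHaar ν νk) :
    quotientVol (stabΓ d k) νk = ENNReal.ofReal (siegelConst d k) * quotientVol (SLZ d) ν := by
  obtain ⟨νl, hl, -⟩ := existsUnique_isInducedHaar (by omega : d - 1 < d) ν
  obtain ⟨h1, h2⟩ := quotientVol_eq_prod_zetaVal_mul hd hl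
  have h3 : ∏ j ∈ Finset.Icc 2 d, zetaVal j =
      (∏ j ∈ Finset.Icc 2 (d - k), zetaVal j) * ∏ j ∈ Finset.Icc (d - k + 1) d, zetaVal j := by
    rw [← Finset.prod_union]
    · congr 1
      ext j
      simp only [Finset.mem_union, Finset.mem_Icc]
      omega
    · rw [Finset.disjoint_left]
      intro j
      simp only [Finset.mem_Icc]
      omega
  have h4 : 0 < ∏ j ∈ Finset.Icc (d - k + 1) d, zetaVal j :=
    prod_zetaVal_pos fun j hj => by
      rw [Finset.mem_Icc] at hj
      omega
  rw [h1, h2 k νk hkd h, ← mul_assoc, siegelConst, ← ENNReal.ofReal_mul (inv_nonneg.2 h4.le), h3]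
  congr 2
  field_simp

theorem quotientVol_SLZ_ne_top (hd : 2 ≤ d) (ν : Measure (SLR d)) [ν.IsHaarMeasure] :
    quotientVol (SLZ d) ν ≠ ∞ := by
  obtain ⟨νl, hl, -⟩ := existsUnique_isInducedHaar (by omega : d - 1 < d) ν
  rw [(quotientVol_eq_prod_zetaVal_mul hd hl).1]
  exact ENNReal.mul_ne_top ENNReal.ofReal_ne_top (quotientVol_stabΓ_ne_top hd hl)

theorem quotientVol_SLZ_iwasawaMeasure (hd : 2 ≤ d) (κ : Measure (SOd d)) [κ.IsHaarMeasure]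
    (hκ : κ Set.univ = ∏ i ∈ Finset.Icc 1 (d - 1), sphereVol i) :
    quotientVol (SLZ d) (iwasawaMeasure κ) =
      ENNReal.ofReal (∏ j ∈ Finset.Icc 2 d, zetaVal j) := by
  have := isHaarMeasure_iwasawaMeasure hd κ
  obtain ⟨νl, hl, -⟩ := existsUnique_isInducedHaar (by omega : d - 1 < d) (iwasawaMeasure κ)
  have h1 := quotientVol_stabΓ_smul_iwasawaMeasure hd κ (one_smul _ _).symm hl
  rw [hκ, ENNReal.mul_left_inj (prod_sphereVol_ne_zero _) (prod_sphereVol_ne_top _)] at h1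
  rw [(quotientVol_eq_prod_zetaVal_mul hd hl).1, h1, mul_one]

end Volumes

/-! ### The invariant probability measure on the space of lattices -/

section InvariantMeasure

variable {d k : ℕ}

theorem isHaarMeasure_count {H : Type*} [Group H] [TopologicalSpace H] [DiscreteTopology H]
    [MeasurableSpace H] [BorelSpace H] : (Measure.count : Measure H).IsHaarMeasure where
  lt_top_of_isCompact C hC := Measure.count_apply_lt_top.2 hC.finite_of_discrete
  map_mul_left_eq_self h := by
    ext s hs
    rw [Measure.map_apply (measurable_const_mul h) hs, Measure.count_apply hs,
      Measure.count_apply (measurable_const_mul h hs),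
      Set.encard_preimage_of_bijective (Group.mulLeft_bijective h)]
  open_pos U _ hne h := hne.ne_empty (Measure.count_eq_zero_iff.1 h)

theorem SLZ.mem_iff_smul_mk_one (g : SLR d) :
    g ∈ SLZ d ↔ g • (QuotientGroup.mk 1 : LatticeSpace d) = QuotientGroup.mk 1 := by
  rw [MulAction.Quotient.smul_mk, smul_eq_mul, mul_one, eq_comm, QuotientGroup.eq, inv_one, one_mul]

theorem LatticeSpace.measurable_iff {β : Type*} [MeasurableSpace β] {F : LatticeSpace d → β} :
    Measurable F ↔ Measurable fun g : SLR d => F (QuotientGroup.mk g) :=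
  measurable_from_quotient

/-- An invariant probability measure on `G / Γ` is a multiple of the image of the restriction of
Haar measure to a fundamental domain. -/
theorem exists_eq_smul_map_restrict (hd : 2 ≤ d) (ν : Measure (SLR d)) [ν.IsHaarMeasure]
    {F : Set (SLR d)} (hF : MeasurableSet F) (hFΓ : ∀ g : SLR d, ∃! γ : SLZ d, g * γ ∈ F)
    (μ : Measure (LatticeSpace d)) [IsProbabilityMeasure μ]
    [SMulInvariantMeasure (SLR d) (LatticeSpace d) μ] :
    ∃ c : ℝ≥0∞, c * quotientVol (SLZ d) ν = 1 ∧
      μ = c • Measure.map QuotientGroup.mk (ν.restrict F) := by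
  have := SLR.isMulRightInvariant hd ν
  have := isHaarMeasure_count (H := SLZ d)
  have hfib : ∀ (φ : SLR d → ℝ≥0∞) (g : SLR d),
      orbitFibre (QuotientGroup.mk 1 : LatticeSpace d) (Measure.count : Measure (SLZ d)) φ
        (QuotientGroup.mk g) = ∑' γ : SLZ d, φ (g * γ) := by
    intro φ g
    have h1 : (QuotientGroup.mk g : LatticeSpace d) = g • QuotientGroup.mk 1 := by
      rw [MulAction.Quotient.smul_mk, smul_eq_mul, mul_one]
    rw [h1, orbitFibre_smul SLZ.mem_iff_smul_mk_one, lintegral_count]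
  obtain ⟨c, -, -, hc⟩ := exists_lintegral_orbitFibre_eq SLZ.mem_iff_smul_mk_one
    (Subgroup.isClosed_of_discrete) ν (Measure.count : Measure (SLZ d)) μ
    (fun φ hφ => by
      rw [LatticeSpace.measurable_iff]
      simp_rw [hfib]
      have h0 : ∀ γ : SLZ d, Measurable fun g : SLR d => φ (g * γ) := fun γ =>
        hφ.comp (measurable_mul_const _)
      exact Measurable.tsum h0)
    (Filter.Eventually.of_forall fun y => by
      obtain ⟨g, rfl⟩ := QuotientGroup.mk_surjective y
      exact ⟨g, by simp only [MulAction.Quotient.smul_mk, smul_eq_mul, mul_one]⟩)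
    (fun C _ => measure_ne_top _ _) (IsProbabilityMeasure.ne_zero μ)
  have hμ : μ = c • Measure.map QuotientGroup.mk (ν.restrict F) := by
    ext A hA
    have hA' : MeasurableSet ((QuotientGroup.mk : SLR d → LatticeSpace d) ⁻¹' A) :=
      QuotientGroup.measurable_coe hA
    rw [Measure.smul_apply, smul_eq_mul, Measure.map_apply QuotientGroup.measurable_coe hA,
      Measure.restrict_apply hA', ← lintegral_indicator_one hA,
      ← lintegral_indicator_one (hA'.inter hF), ← hc _ (measurable_one.indicator (hA'.inter hF))]
    refine lintegral_congr fun x => ?_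
    obtain ⟨g, rfl⟩ := QuotientGroup.mk_surjective x
    rw [hfib]
    -- only one term of the sum over `Γ` is in `F`
    obtain ⟨γ₀, hγ₀, huniq⟩ := hFΓ g
    rw [tsum_eq_single γ₀ fun γ hγ => Set.indicator_of_notMem
      (fun h => hγ (huniq γ h.2)) _]
    have hmk : (QuotientGroup.mk (g * γ₀) : LatticeSpace d) = QuotientGroup.mk g :=
      QuotientGroup.mk_mul_of_mem g γ₀.2
    by_cases hx : (QuotientGroup.mk g : LatticeSpace d) ∈ A
    · rw [Set.indicator_of_mem hx, Set.indicator_of_mem]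
      · rfl
      · exact ⟨by rw [Set.mem_preimage, hmk]; exact hx, hγ₀⟩
    · rw [Set.indicator_of_notMem hx, Set.indicator_of_notMem]
      rintro ⟨h, -⟩
      rw [Set.mem_preimage, hmk] at h
      exact hx h
  refine ⟨c, ?_, hμ⟩
  have h1 : μ Set.univ = 1 := measure_univ
  rwa [hμ, Measure.smul_apply, smul_eq_mul, Measure.map_apply QuotientGroup.measurable_coe .univ,
    Set.preimage_univ, Measure.restrict_apply_univ, ← quotientVol_eq_of_existsUnique hF hFΓ ν] at h1

/-- The image of `ν|_F` is invariant, since `F` and its left translates are fundamental domains of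
`G / Γ`. -/
theorem smulInvariantMeasure_map_restrict (hd : 2 ≤ d) (ν : Measure (SLR d)) [ν.IsHaarMeasure]
    {F : Set (SLR d)} (hF : MeasurableSet F) (hFΓ : ∀ g : SLR d, ∃! γ : SLZ d, g * γ ∈ F) :
    SMulInvariantMeasure (SLR d) (LatticeSpace d)
      (Measure.map QuotientGroup.mk (ν.restrict F)) := by
  have := SLR.isMulRightInvariant hd ν
  have : Countable (SLZ d).op := (SLZ d).equivOp.symm.injective.countable
  refine ⟨fun x A hA => ?_⟩
  have hB : MeasurableSet ((QuotientGroup.mk : SLR d → LatticeSpace d) ⁻¹' A) :=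
    QuotientGroup.measurable_coe hA
  have hxF : MeasurableSet ((fun g => x⁻¹ * g) ⁻¹' F) := measurable_const_mul _ hF
  have hxFΓ : ∀ g : SLR d, ∃! γ : SLZ d, g * γ ∈ (fun g => x⁻¹ * g) ⁻¹' F := by
    intro g
    simpa only [Set.mem_preimage, mul_assoc] using hFΓ (x⁻¹ * g)
  rw [Measure.map_apply QuotientGroup.measurable_coe hA,
    Measure.map_apply QuotientGroup.measurable_coe (measurable_const_smul x hA),
    Measure.restrict_apply hB,
    Measure.restrict_apply (QuotientGroup.measurable_coe (measurable_const_smul x hA)),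
    (isFundamentalDomain_op_of_existsUnique hF hFΓ ν).measure_set_eq
      (isFundamentalDomain_op_of_existsUnique hxF hxFΓ ν) hB,
    ← measure_preimage_mul ν x (_ ∩ (fun g => x⁻¹ * g) ⁻¹' F)]
  · congr 1
    ext g
    simp only [Set.mem_inter_iff, Set.mem_preimage, inv_mul_cancel_left]
    rfl
  · rintro ⟨γ, hγ⟩
    ext g
    have hmk : (QuotientGroup.mk (g * γ.unop) : LatticeSpace d) = QuotientGroup.mk g :=
      QuotientGroup.mk_mul_of_mem g hγ
    change (QuotientGroup.mk (g * γ.unop) : LatticeSpace d) ∈ A ↔ (QuotientGroup.mk g : LatticeSpace d) ∈ A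
    rw [hmk]

theorem quotientVol_SLZ_ne_zero (hd : 2 ≤ d) (ν : Measure (SLR d)) [ν.IsHaarMeasure] :
    quotientVol (SLZ d) ν ≠ 0 := by
  have := SLR.isMulRightInvariant hd ν
  obtain ⟨F, hF, hFΓ⟩ := exists_measurableSet_existsUnique_mul_mem (SLZ d)
  rw [quotientVol_eq_of_existsUnique hF hFΓ ν]
  intro h
  have h1 := lintegral_eq_setLIntegral_tsum hF hFΓ ν (measurable_one : Measurable (1 : SLR d → ℝ≥0∞))
  rw [Measure.restrict_eq_zero.2 h, lintegral_zero_measure] at h1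
  simp at h1
  exact NeZero.ne ν h1

theorem existsUnique_invariant_probabilityMeasure (hd : 2 ≤ d) :
    ∃! μ : Measure (LatticeSpace d),
      IsProbabilityMeasure μ ∧ SMulInvariantMeasure (SLR d) (LatticeSpace d) μ := by
  let ν : Measure (SLR d) := Measure.haar
  have := SLR.isMulRightInvariant hd ν
  obtain ⟨F, hF, hFΓ⟩ := exists_measurableSet_existsUnique_mul_mem (SLZ d)
  have h0 := quotientVol_SLZ_ne_zero hd ν
  have ht := quotientVol_SLZ_ne_top hd ν
  refine ⟨(quotientVol (SLZ d) ν)⁻¹ • Measure.map QuotientGroup.mk (ν.restrict F), ⟨⟨?_⟩, ?_⟩, ?_⟩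
  · rw [Measure.smul_apply, smul_eq_mul, Measure.map_apply QuotientGroup.measurable_coe .univ,
      Set.preimage_univ, Measure.restrict_apply_univ, ← quotientVol_eq_of_existsUnique hF hFΓ ν,
      ENNReal.inv_mul_cancel h0 ht]
  · have := smulInvariantMeasure_map_restrict hd ν hF hFΓ
    infer_instance
  · rintro μ ⟨hμ, hμ'⟩
    obtain ⟨c, hc, h⟩ := exists_eq_smul_map_restrict hd ν hF hFΓ μ
    rw [h, ENNReal.eq_inv_of_mul_eq_one_left hc]

end InvariantMeasure

/-! ### The mean value formula -/

section MeanValue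

variable {d k : ℕ}

/-- The primitive tuples of `g ℤ^d` are the images under `g` of those of `ℤ^d`. -/
def primitiveTuplesEquiv (hkd : k < d) (g : SLR d) :
    primOrbit d k ≃ primitiveTuples k (LatticeSpace.lattice (QuotientGroup.mk g : LatticeSpace d)) :=
  Equiv.ofBijective
    (fun w => ⟨g • (w : Fin k → Fin d → ℝ),
      (mem_primitiveTuples_latticeOf_iff hkd g _).2 ⟨w, w.2, rfl⟩⟩)
    ⟨fun w w' h => Subtype.ext (smul_left_cancel g (congrArg Subtype.val h)), fun v => by
      obtain ⟨w, hw, h⟩ := (mem_primitiveTuples_latticeOf_iff hkd g _).1 v.2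
      exact ⟨⟨w, hw⟩, Subtype.ext h⟩⟩

theorem tsum_primitiveTuples_mk (hkd : k < d) (g : SLR d) (f : (Fin k → Fin d → ℝ) → ℝ≥0∞) :
    ∑' v : primitiveTuples k (LatticeSpace.lattice (QuotientGroup.mk g : LatticeSpace d)), f v =
      ∑' w : primOrbit d k, f (g • (w : Fin k → Fin d → ℝ)) :=
  ((primitiveTuplesEquiv hkd g).tsum_eq fun v => f v).symm

theorem measurable_tsum_primitiveTuples (hkd : k < d) {f : (Fin k → Fin d → ℝ) → ℝ≥0∞}
    (hf : Measurable f) :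
    Measurable fun x : LatticeSpace d => ∑' v : primitiveTuples k x.lattice, f v := by
  rw [LatticeSpace.measurable_iff]
  simp_rw [tsum_primitiveTuples_mk hkd]
  have h0 : ∀ w : primOrbit d k, Measurable fun g : SLR d => f (g • (w : Fin k → Fin d → ℝ)) :=
    fun w => hf.comp (measurable_smul_const _)
  exact Measurable.tsum h0

/-- Siegel's mean value formula for nonnegative functions. -/
theorem lintegral_tsum_primitiveTuples (hk : 1 ≤ k) (hkd : k < d) (μ : Measure (LatticeSpace d))
    [IsProbabilityMeasure μ] [SMulInvariantMeasure (SLR d) (LatticeSpace d) μ]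
    {f : (Fin k → Fin d → ℝ) → ℝ≥0∞} (hf : Measurable f) :
    ∫⁻ x, ∑' v : primitiveTuples k x.lattice, f v ∂μ =
      ENNReal.ofReal (siegelConst d k) * ∫⁻ v, f v := by
  have hd : 2 ≤ d := by omega
  obtain ⟨F, hF, hFΓ⟩ := exists_measurableSet_existsUnique_mul_mem (SLZ d)
  obtain ⟨c, hc, hμ⟩ := exists_eq_smul_map_restrict hd Measure.haar hF hFΓ μ
  obtain ⟨νk, hνk, -⟩ := existsUnique_isInducedHaar hkd (Measure.haar : Measure (SLR d))
  rw [hμ, lintegral_smul_measure, smul_eq_mul,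
    lintegral_map (measurable_tsum_primitiveTuples hkd hf) QuotientGroup.measurable_coe]
  simp_rw [tsum_primitiveTuples_mk hkd]
  rw [hνk.setLIntegral_tsum_orbit hd hkd hF hFΓ hf, quotientVol_stabΓ_eq hd hkd hνk,
    mul_comm (ENNReal.ofReal _) (quotientVol _ _), ← mul_assoc, ← mul_assoc, hc, one_mul]

theorem siegelConst_nonneg (d k : ℕ) : 0 ≤ siegelConst d k :=
  inv_nonneg.2 (Finset.prod_nonneg fun _ _ => tsum_nonneg fun _ => by positivity)

/-- Functions that agree almost everywhere agree on the primitive tuples of almost every lattice. -/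
theorem ae_forall_primitiveTuples_eq (hk : 1 ≤ k) (hkd : k < d) (μ : Measure (LatticeSpace d))
    [IsProbabilityMeasure μ] [SMulInvariantMeasure (SLR d) (LatticeSpace d) μ]
    {f f' : (Fin k → Fin d → ℝ) → ℝ} (h : f =ᵐ[volume] f') :
    ∀ᵐ x ∂μ, ∀ v : primitiveTuples k x.lattice, f v = f' v := by
  set N := toMeasurable volume {v | ¬ f v = f' v}
  have hN : MeasurableSet N := measurableSet_toMeasurable _ _
  have hN0 : volume N = 0 := (measure_toMeasurable _).trans h
  have h1 := lintegral_tsum_primitiveTuples hk hkd μ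
    (measurable_one.indicator hN : Measurable (N.indicator (1 : (Fin k → Fin d → ℝ) → ℝ≥0∞)))
  rw [lintegral_indicator_one hN, hN0, mul_zero, lintegral_eq_zero_iff
    (measurable_tsum_primitiveTuples hkd (measurable_one.indicator hN))] at h1
  filter_upwards [h1] with x hx v
  by_contra hv
  have h2 := ENNReal.tsum_eq_zero.1 hx v
  rw [Set.indicator_of_mem (subset_toMeasurable _ _ hv)] at h2
  exact one_ne_zero h2

/-- Siegel's mean value formula for integrable functions. -/
theorem siegel_meanValue (hk : 1 ≤ k) (hkd : k < d) (μ : Measure (LatticeSpace d))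
    [IsProbabilityMeasure μ] [SMulInvariantMeasure (SLR d) (LatticeSpace d) μ]
    {f : (Fin k → Fin d → ℝ) → ℝ} (hf : Integrable f) :
    (∀ᵐ x ∂μ, Summable fun v : primitiveTuples k x.lattice => f v) ∧
      Integrable (siegelTransform f) μ ∧
      ∫ x, siegelTransform f x ∂μ = siegelConst d k * ∫ v, f v := by
  set f' := hf.1.mk f
  have hff' : f =ᵐ[volume] f' := hf.1.ae_eq_mk
  have hf'm : Measurable f' := hf.1.stronglyMeasurable_mk.measurable
  have hf' : Integrable f' := hf.congr hff'
  have hae := ae_forall_primitiveTuples_eq hk hkd μ hff'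
  -- the sums over the positive and over the negative part
  let T : ((Fin k → Fin d → ℝ) → ℝ) → LatticeSpace d → ℝ≥0∞ := fun h x =>
    ∑' v : primitiveTuples k x.lattice, ENNReal.ofReal (h v)
  have hTm : ∀ h, Measurable h → Measurable (T h) := fun h hh =>
    measurable_tsum_primitiveTuples hkd hh.ennreal_ofReal
  have hT : ∀ h, Measurable h → ∫⁻ x, T h x ∂μ =
      ENNReal.ofReal (siegelConst d k) * ∫⁻ v, ENNReal.ofReal (h v) := fun h hh =>
    lintegral_tsum_primitiveTuples hk hkd μ hh.ennreal_ofReal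
  have hTfin : ∀ h, Measurable h → Integrable h → ∫⁻ x, T h x ∂μ ≠ ∞ := fun h hh hi => by
    rw [hT h hh]
    exact ENNReal.mul_ne_top ENNReal.ofReal_ne_top hi.lintegral_lt_top.ne
  have hTint : ∀ h, Measurable h → Integrable h → Integrable (fun x => (T h x).toReal) μ ∧
      ∫ x, (T h x).toReal ∂μ = siegelConst d k * (∫⁻ v, ENNReal.ofReal (h v)).toReal := by
    intro h hh hi
    refine ⟨integrable_toReal_of_lintegral_ne_top (hTm h hh).aemeasurable (hTfin h hh hi), ?_⟩
    rw [integral_toReal (hTm h hh).aemeasurable (ae_lt_top (hTm h hh) (hTfin h hh hi)), hT h hh,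
      ENNReal.toReal_mul, ENNReal.toReal_ofReal (siegelConst_nonneg d k)]
  obtain ⟨hp1, hp2⟩ := hTint f' hf'm hf'
  obtain ⟨hn1, hn2⟩ := hTint (fun v => -f' v) hf'm.neg hf'.neg
  have hkey : ∀ᵐ x ∂μ, HasSum (fun v : primitiveTuples k x.lattice => f v)
      ((T f' x).toReal - (T (fun v => -f' v) x).toReal) := by
    filter_upwards [hae, ae_lt_top (hTm _ hf'm) (hTfin _ hf'm hf'),
      ae_lt_top (hTm _ hf'm.neg) (hTfin _ hf'm.neg hf'.neg)] with x hx hp hn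
    have hsum : ∀ h : (Fin k → Fin d → ℝ) → ℝ, T h x ≠ ∞ →
        HasSum (fun v : primitiveTuples k x.lattice => (ENNReal.ofReal (h v)).toReal)
          (T h x).toReal := by
      intro h hh
      rw [ENNReal.tsum_toReal_eq fun _ => ENNReal.ofReal_ne_top]
      exact (ENNReal.summable_toReal hh).hasSum
    refine ((hsum _ hp.ne).sub (hsum _ hn.ne)).congr_fun ?_
    intro v
    rw [hx v, ENNReal.toReal_ofReal', ENNReal.toReal_ofReal']
    exact (max_zero_sub_eq_self _).symm
  have heq : siegelTransform f =ᵐ[μ] fun x =>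
      (T f' x).toReal - (T (fun v => -f' v) x).toReal := by
    filter_upwards [hkey] with x hx using hx.tsum_eq
  refine ⟨hkey.mono fun x hx => hx.summable, (hp1.sub hn1).congr heq.symm, ?_⟩
  rw [integral_congr_ae heq, integral_sub hp1 hn1, hp2, hn2, ← mul_sub,
    ← integral_eq_lintegral_pos_part_sub_lintegral_neg_part hf', integral_congr_ae hff']

end MeanValue

theorem mainTheorem5 (d k : ℕ) (hk : 1 ≤ k) (hkd : k < d) :
    -- the invariant probability measure on the space of unimodular lattices
    (∃! μ : Measure (LatticeSpace d),
      IsProbabilityMeasure μ ∧ SMulInvariantMeasure (SLR d) (LatticeSpace d) μ) ∧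
    -- the mean value formula
    (∀ μ : Measure (LatticeSpace d), IsProbabilityMeasure μ →
      SMulInvariantMeasure (SLR d) (LatticeSpace d) μ →
      ∀ f : (Fin k → Fin d → ℝ) → ℝ, Integrable f volume →
        (∀ᵐ x ∂μ, Summable fun v : primitiveTuples k x.lattice => f v) ∧
        Integrable (siegelTransform f) μ ∧
        ∫ x, siegelTransform f x ∂μ = siegelConst d k * ∫ v, f v) ∧
    -- the constant is the volume of `G_k / Γ_k` relative to that of `G / Γ`
    (∀ ν : Measure (SLR d), ν.IsHaarMeasure →
      (∃! νk : Measure (stabG d k), IsInducedHaar ν νk) ∧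
      ∀ νk : Measure (stabG d k), IsInducedHaar ν νk →
        quotientVol (stabΓ d k) νk =
          ENNReal.ofReal (siegelConst d k) * quotientVol (SLZ d) ν) ∧
    -- the volume of `G / Γ` for the Haar measure normalized in Iwasawa coordinates
    (∀ κ : Measure (SOd d), κ.IsHaarMeasure →
      κ Set.univ = ∏ i ∈ Finset.Icc 1 (d - 1), sphereVol i →
        (iwasawaMeasure κ).IsHaarMeasure ∧
        quotientVol (SLZ d) (iwasawaMeasure κ) =
          ENNReal.ofReal (∏ j ∈ Finset.Icc 2 d, zetaVal j)) :=
  have hd : 2 ≤ d := by omega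
  ⟨existsUnique_invariant_probabilityMeasure hd,
    fun μ _ _ _ hf => siegel_meanValue hk hkd μ hf,
    fun ν _ => ⟨existsUnique_isInducedHaar hkd ν, fun _ h => quotientVol_stabΓ_eq hd hkd h⟩,
    fun κ _ hκ => ⟨isHaarMeasure_iwasawaMeasure hd κ, quotientVol_SLZ_iwasawaMeasure hd κ hκ⟩⟩

end
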